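/- Let $d,m$ be natural numbers, $\mathbb{E}=\mathbb{R}^d\times\{1,\dots,m\}$, and let $C_R\subset\mathbb{R}^d$ be the open cube of edge length $R$ centred at $0$, of Lebesgue measure $\ell(C_R)$. A point measure on $\mathbb{E}$ is a Borel measure taking finite, natural number values on all relatively compact Borel sets; it is $r$-uniformly discrete if $\lambda((a+C_r)\times\{1,\dots,m\})\le 1$ for all $a\in\mathbb{R}^d$. An $m$-coloured stationary, uniformly discrete, ergodic point process is given by its law $\mu$: a probability measure on the space of measures on $\mathbb{E}$ (with the $\sigma$-algebra generated by the evaluations $\lambda\mapsto\lambda(A)$) that is concentrated on the $r$-uniformly discrete point measures for some $r>0$, and is invariant and ergodic under the translations $(T_t\lambda)(A)=\lambda(-t+A)$, $t\in\mathbb{R}^d$, which act on $\mathbb{E}$ by $t+(x,i)=(t+x,i)$. Let $w=(w_1,\dots,w_m)$ be real weights and put $\lambda^w(\{x\})=\sum_{i=1}^m w_i\,\lambda(\{(x,i)\})$ for $x\in\mathbb{R}^d$. For $n\ge 1$ the weighted $(n+1)$-point correlation of $\lambda$ is the Radon measure $\gamma^{(n+1)}_\lambda$ on $(\mathbb{R}^d)^n$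 given by $$\gamma^{(n+1)}_\lambda(f)=\lim_{R\to\infty}\frac{1}{\ell(C_R)}\sum_{x,y_1,\dots,y_n\in C_R}\lambda^w(\{x\})\prod_{j=1}^n\lambda^w(\{y_j\})\,f(y_1-x,\dots,y_n-x)\qquad\text{for all } f\in C_c((\mathbb{R}^d)^n),$$ if these limits exist and define a Radon measure. Theorem. Suppose that the weights $w_1,\dots,w_m$ are pairwise distinct and all nonzero. Then $\mu$ is completely determined by the weighted $(n+1)$-point correlations, $n=1,2,\dots$, of $\mu$-almost every $\lambda$. That is, for every $m$-coloured stationary, uniformly discrete, ergodic point process $\mu$ there are Radon measures $\gamma^{(n+1)}$ on $(\mathbb{R}^d)^n$, $n\ge1$, such that for $\mu$-almost every $\lambda$ the correlations $\gamma_\lambda^{(n+1)}$ exist and equal $\gamma^{(n+1)}$ for all $n\ge1$; and if $\nu$ is any $m$-coloured stationary, uniformly discrete, ergodic point process on $\mathbb{R}^d$ such that the set of $\lambda$ with $\gamma^{(n+1)}_\lambda=\gamma^{(n+1)}$ for all $n\ge1$ is not $\nu$-null, then $\nu=\mu$. -/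

import Mathlib

open MeasureTheory Filter Topology
open scoped CompactlySupported

noncomputable section

namespace ColouredPointProcess

/-- The ambient space `ℝ^d` with the Euclidean metric. -/
abbrev Pos (d : ℕ) : Type := EuclideanSpace ℝ (Fin d)

/-- The space `𝔼 = ℝ^d × {1, …, m}` of coloured points. -/
abbrev ColPt (d m : ℕ) : Type := Pos d × Fin m

/-- The open cube `C_R` of edge length `R` about `0`. -/
def cube (d : ℕ) (R : ℝ) : Set (Pos d) := {x | ∀ k, |x k| < R / 2}

/-- The translation `(x, i) ↦ (t + x, i)` of coloured points. -/
def shift {d m : ℕ} (t : Pos d) (p : ColPt d m) : ColPt d m := (t + p.1, p.2)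

/-- The induced translation of measures, `(T_t lam)(A) = lam (-t + A)`. -/
def shiftMeasure {d m : ℕ} (t : Pos d) (lam : Measure (ColPt d m)) : Measure (ColPt d m) :=
  lam.map (shift t)

/-- Point measures: `lam A` is a (finite) natural number for every relatively compact Borel set. -/
def IsPointMeasure {d m : ℕ} (lam : Measure (ColPt d m)) : Prop :=
  ∀ A : Set (ColPt d m), MeasurableSet A → IsCompact (closure A) → ∃ k : ℕ, lam A = k

/-- The set of `r`-uniformly discrete point measures: every translate of the cube of edge
length `r` carries at most one point, all colours counted together. -/
def uniformlyDiscrete (d m : ℕ) (r : ℝ) : Set (Measure (ColPt d m)) :=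
  {lam | IsPointMeasure lam ∧ ∀ a : Pos d, lam {p | p.1 - a ∈ cube d r} ≤ 1}

/-- `μ` is the law of an `m`-coloured, stationary, uniformly discrete, ergodic point process
on `ℝ^d`. The space of measures carries the `σ`-algebra generated by the evaluations
`lam ↦ lam A`. -/
structure IsProcess {d m : ℕ} (μ : Measure (Measure (ColPt d m))) : Prop where
  prob : IsProbabilityMeasure μ
  unifDiscrete : ∃ r : ℝ, 0 < r ∧ ∀ᵐ lam ∂μ, lam ∈ uniformlyDiscrete d m r
  stationary : ∀ t : Pos d, MeasurePreserving (shiftMeasure t) μ μ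
  ergodic : ∀ D : Set (Measure (ColPt d m)), MeasurableSet D →
    (∀ t : Pos d, shiftMeasure t ⁻¹' D = D) → μ D = 0 ∨ μ D = 1

/-- The mass `lam^w({x})` of the weighted measure `lam^w = ∑ᵢ wᵢ lamⁱ` on `ℝ^d`. -/
def weightAt {d m : ℕ} (w : Fin m → ℝ) (lam : Measure (ColPt d m)) (x : Pos d) : ℝ :=
  ∑ i, w i * lam.real {(x, i)}

/-- The sum
`∑_{x, y₁, …, yₙ ∈ C_R} lam^w({x}) ∏ⱼ lam^w({yⱼ}) f (y₁ - x, …, yₙ - x)`.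
For a uniformly discrete `lam` it has only finitely many nonzero terms. -/
def corrSum {d m : ℕ} (w : Fin m → ℝ) (lam : Measure (ColPt d m)) (n : ℕ) (R : ℝ)
    (f : (Fin n → Pos d) → ℂ) : ℂ :=
  ∑ᶠ x ∈ cube d R, ∑ᶠ y ∈ {y : Fin n → Pos d | ∀ j, y j ∈ cube d R},
    ((weightAt w lam x * ∏ j, weightAt w lam (y j) : ℝ) : ℂ) * f (fun j => y j - x)

/-- A complex Radon measure on `S`, viewed as a linear functional on `C_c(S)`: on the functions
supported in a fixed compact set it is bounded with respect to the sup norm. -/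
def IsRadonFunctional {S : Type*} [TopologicalSpace S] (γ : C_c(S, ℂ) →ₗ[ℂ] ℂ) : Prop :=
  ∀ K : Set S, IsCompact K → ∃ C : ℝ, ∀ f : C_c(S, ℂ), tsupport f ⊆ K →
    ∀ B : ℝ, (∀ s, ‖f s‖ ≤ B) → ‖γ f‖ ≤ C * B

/-- The weighted `(n+1)`-point correlation of `lam` exists and is the measure `γ` on `(ℝ^d)^n`. -/
structure IsCorrelation {d m : ℕ} (w : Fin m → ℝ) (lam : Measure (ColPt d m)) (n : ℕ)
    (γ : C_c(Fin n → Pos d, ℂ) →ₗ[ℂ] ℂ) : Prop where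
  radon : IsRadonFunctional γ
  tendsto : ∀ f : C_c(Fin n → Pos d, ℂ),
    Tendsto (fun R : ℝ => corrSum w lam n R f / ((volume.real (cube d R) : ℝ) : ℂ))
      atTop (𝓝 (γ f))

end ColouredPointProcess

end

open ColouredPointProcess

/-! Existence. Up to a boundary shell of volume o(R^d), the normalised correlation sum over `C_R` is
an average, over the integer translates of `lam`, of one bounded local statistic: the sum of
`lam^w({x}) ∏ lam^w({y_j}) f(y_j - x)` with the first point weighted by a tent whose integer
translates form a partition of unity (`Sparse.multiSum_tentSum`, `Sparse.tendsto_corrSum`). The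
pointwise ergodic theorem for `ℤ^d` (`exists_ae_tendsto_average_latticeBox`) makes these averages
converge almost surely. Only ergodicity under `ℝ^d` is given, but a real translation changes the
averages by a boundary term, so the limit is `ℝ^d`-invariant, hence constant, and equals the mean of
the statistic. Separability of the test functions supported in a box gives one null set for all `f`.

Uniqueness. If a non-null set of `ν`-configurations has the correlations of `μ`, some configuration
has those of both `μ` and `ν`, so the two families agree. By stationarity the `(n+1)`-point
correlation, evaluated at `G` with its base point integrated out, is a fixed positive multiple of
the mean of the multiple sum of `G` (`corrFunctional_reduceMap`). Hence the means of all multiple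
sums over at least two points agree, and so do those over their linear span, which is closed under
products.

This span contains the sum of any test function over the points of one colour. By uniform
discreteness, a function supported near the diagonal sees only tuples of equal points, so it
produces sums of `W(x)^k f(x)` with `W = lam^w` and `k ≥ 2`. As the weights are distinct and
nonzero, the indicator of a colour is `W^2` times a polynomial in `W` (`measureReal_eq_colourPoly`);
the square supplies the second point, since one-point means are not given directly.

Colour sums are bounded on `r`-uniformly discrete measures, so their moments determine their
characteristic functions and thus all finite-dimensional distributions (`map_colourMap_eq`). They
also generate the `σ`-algebra on the uniformly discrete measures (`measurable_subtype_val_comap`),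
so `μ = ν`. -/

namespace ColouredPointProcess

/-! ### Pointwise ergodic theorems -/

section Ergodic

variable {Ω : Type*}

/-- The running maximum of the Birkhoff sums of `g`, including the empty sum. -/
noncomputable def birkhoffMax (T : Ω → Ω) (g : Ω → ℝ) : ℕ → Ω → ℝ
  | 0 => fun _ => 0
  | n + 1 => fun x => max 0 (g x + birkhoffMax T g n (T x))

lemma birkhoffMax_nonneg (T : Ω → Ω) (g : Ω → ℝ) (n : ℕ) (x : Ω) : 0 ≤ birkhoffMax T g n x := by
  cases n <;> simp [birkhoffMax]

lemma birkhoffMax_mono (T : Ω → Ω) (g : Ω → ℝ) (n : ℕ) (x : Ω) :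
    birkhoffMax T g n x ≤ birkhoffMax T g (n + 1) x := by
  induction n generalizing x with
  | zero => exact birkhoffMax_nonneg T g 1 x
  | succ n ih => exact max_le_max le_rfl (add_le_add le_rfl (ih (T x)))

lemma birkhoffSum_le_birkhoffMax (T : Ω → Ω) (g : Ω → ℝ) (n : ℕ) (x : Ω) :
    birkhoffSum T g n x ≤ birkhoffMax T g n x := by
  induction n generalizing x with
  | zero => simp [birkhoffMax]
  | succ n ih =>
    rw [birkhoffSum_succ']
    exact (add_le_add le_rfl (ih (T x))).trans (le_max_right _ _)

/-- The set of points at which the Birkhoff sums of `g` are unbounded above. -/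
def birkhoffUnbounded (T : Ω → Ω) (g : Ω → ℝ) : Set Ω :=
  {x | ∀ C : ℕ, ∃ n, (C : ℝ) < birkhoffMax T g n x}

/-- Passing from `x` to `T x` drops the first summand `g x`, a finite quantity that cannot affect
unboundedness. -/
lemma preimage_birkhoffUnbounded (T : Ω → Ω) (g : Ω → ℝ) :
    T ⁻¹' birkhoffUnbounded T g = birkhoffUnbounded T g := by
  ext x
  simp only [birkhoffUnbounded, Set.mem_preimage, Set.mem_ofPred_eq]
  constructor
  · intro h C
    obtain ⟨D, hD⟩ := exists_nat_ge (C - g x)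
    obtain ⟨n, hn⟩ := h D
    exact ⟨n + 1, lt_max_of_lt_right (by linarith)⟩
  · intro h C
    obtain ⟨D, hD⟩ := exists_nat_ge (C + g x)
    obtain ⟨n, hn⟩ := h D
    cases n with
    | zero => exact absurd hn (by simp [birkhoffMax])
    | succ n =>
      refine ⟨n, ?_⟩
      rcases lt_max_iff.1 hn with h0 | h0
      · exact absurd h0 (by simp)
      · linarith

lemma birkhoffSum_const_apply (T : Ω → Ω) (c : ℝ) (n : ℕ) (x : Ω) :
    birkhoffSum T (fun _ => c) n x = n * c := by
  simp [birkhoffSum]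

variable [MeasurableSpace Ω] {μ : Measure Ω}

lemma measurable_birkhoffMax {T : Ω → Ω} (hT : Measurable T) {g : Ω → ℝ} (hg : Measurable g)
    (n : ℕ) : Measurable (birkhoffMax T g n) := by
  induction n with
  | zero => exact measurable_const
  | succ n ih => exact measurable_const.max (hg.add (ih.comp hT))

lemma integrable_birkhoffMax {T : Ω → Ω} (hT : MeasurePreserving T μ μ) {g : Ω → ℝ}
    (hg : Integrable g μ) (n : ℕ) : Integrable (birkhoffMax T g n) μ := by
  induction n with
  | zero => exact integrable_zero _ _ _
  | succ n ih =>
    exact (integrable_zero _ _ _).sup (hg.add (hT.integrable_comp_of_integrable ih))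

lemma measurableSet_birkhoffUnbounded {T : Ω → Ω} (hT : Measurable T) {g : Ω → ℝ}
    (hg : Measurable g) : MeasurableSet (birkhoffUnbounded T g) := by
  have : birkhoffUnbounded T g = ⋂ C : ℕ, ⋃ n, {x | (C : ℝ) < birkhoffMax T g n x} := by
    ext x; simp [birkhoffUnbounded]
  rw [this]
  exact .iInter fun C => .iUnion fun n =>
    measurableSet_lt measurable_const (measurable_birkhoffMax hT hg n)

/-- Maximal ergodic theorem. -/
lemma setIntegral_birkhoffUnbounded_nonneg [IsFiniteMeasure μ] {T : Ω → Ω}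
    (hT : MeasurePreserving T μ μ) {g : Ω → ℝ} (hgm : Measurable g) (hg : Integrable g μ) :
    0 ≤ ∫ x in birkhoffUnbounded T g, g x ∂μ := by
  set B := birkhoffUnbounded T g with hB
  have hBm : MeasurableSet B := measurableSet_birkhoffUnbounded hT.measurable hgm
  have hMi := integrable_birkhoffMax hT hg
  -- The integrand is `max (-M_n(T x)) (g x)` with `M_n ≥ 0`, so it is dominated by `|g|`. On `B` it
  -- is eventually `g x`, because `M_n(T x)` is unbounded there.
  have hlim : Tendsto (fun n => ∫ x in B, (birkhoffMax T g (n + 1) x - birkhoffMax T g n (T x)) ∂μ)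
      atTop (𝓝 (∫ x in B, g x ∂μ)) := by
    apply tendsto_integral_of_dominated_convergence (fun x => |g x|)
    · intro n
      exact ((measurable_birkhoffMax hT.measurable hgm (n + 1)).sub
        ((measurable_birkhoffMax hT.measurable hgm n).comp hT.measurable)).aestronglyMeasurable
    · exact hg.abs.integrableOn
    · intro n
      refine Eventually.of_forall fun x => ?_
      have := birkhoffMax_nonneg T g n (T x)
      simp only [birkhoffMax, Real.norm_eq_abs]
      rcases max_cases 0 (g x + birkhoffMax T g n (T x)) with ⟨h, h'⟩ | ⟨h, h'⟩ <;> rw [h]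
      · rw [zero_sub, abs_neg, abs_of_nonneg this, abs_of_nonpos (by linarith)]; linarith
      · rw [add_sub_cancel_right]
    · refine (ae_restrict_mem hBm).mono fun x hx => ?_
      have hx' : T x ∈ B := by
        have : x ∈ T ⁻¹' B := by rw [hB, preimage_birkhoffUnbounded]; exact hx
        exact this
      obtain ⟨C, hC⟩ := exists_nat_ge (- g x)
      obtain ⟨n, hn⟩ := hx' C
      have hmono : Monotone fun n => birkhoffMax T g n (T x) :=
        monotone_nat_of_le_succ fun n => birkhoffMax_mono T g n (T x)
      refine tendsto_const_nhds.congr' ?_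
      filter_upwards [eventually_ge_atTop n] with k hk
      have := hmono hk
      simp only [birkhoffMax] at this ⊢
      rw [max_eq_right (by linarith), add_sub_cancel_right]
  -- Since `B` is invariant, `M_n ∘ T` may be replaced by `M_n` under the integral, and `M_n ≤
  -- M_{n+1}`.
  refine ge_of_tendsto' hlim fun n => ?_
  have hMT : Integrable (fun x => birkhoffMax T g n (T x)) μ :=
    hT.integrable_comp_of_integrable (hMi n)
  rw [integral_sub (hMi (n + 1)).integrableOn hMT.integrableOn]
  have h1 : ∫ x in B, birkhoffMax T g n (T x) ∂μ = ∫ x in B, birkhoffMax T g n x ∂μ := by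
    have h2 : MeasurePreserving T (μ.restrict B) (μ.restrict B) := by
      have := hT.restrict_preimage hBm
      rwa [hB, preimage_birkhoffUnbounded] at this
    calc ∫ x in B, birkhoffMax T g n (T x) ∂μ
        = ∫ x, birkhoffMax T g n x ∂((μ.restrict B).map T) :=
          (integral_map h2.measurable.aemeasurable
            (measurable_birkhoffMax hT.measurable hgm n).aestronglyMeasurable).symm
      _ = _ := by rw [h2.map_eq]
  rw [h1, sub_nonneg]
  exact integral_mono (hMi n).integrableOn (hMi (n + 1)).integrableOn
    fun x => birkhoffMax_mono T g n x

/-- For `g = f - E[f | invariants] - ε/2`, the integral over the invariant set where the sums are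
unbounded is `-ε/2` times its measure. The maximal theorem forces this set to be null. Elsewhere the
sums of `g` stay below some `C`, and `C ≤ n ε/2` for large `n`. -/
lemma ae_eventually_birkhoffAverage_le [IsFiniteMeasure μ] {T : Ω → Ω}
    (hT : MeasurePreserving T μ μ) {f : Ω → ℝ} (hfm : Measurable f) (hf : Integrable f μ)
    {ε : ℝ} (hε : 0 < ε) :
    ∀ᵐ x ∂μ, ∀ᶠ n : ℕ in atTop,
      birkhoffAverage ℝ T f n x ≤ (μ[f | MeasurableSpace.invariants T]) x + ε := by
  have hle := MeasurableSpace.invariants_le T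
  set F := μ[f | MeasurableSpace.invariants T] with hF
  have hFm' : Measurable[MeasurableSpace.invariants T] F := stronglyMeasurable_condExp.measurable
  have hFT : F ∘ T = F := MeasurableSpace.comp_eq_of_measurable_invariants hFm'
  have hFm : Measurable F := hFm'.mono hle le_rfl
  have hFi : Integrable F μ := integrable_condExp
  set g : Ω → ℝ := fun x => f x - F x - ε / 2 with hgdef
  have hgm : Measurable g := (hfm.sub hFm).sub measurable_const
  have hgi : Integrable g μ := (hf.sub hFi).sub (integrable_const _)
  have hBm := measurableSet_birkhoffUnbounded hT.measurable hgm
  have h0 := setIntegral_birkhoffUnbounded_nonneg hT hgm hgi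
  have h1 : ∫ x in birkhoffUnbounded T g, g x ∂μ = -(ε / 2) * μ.real (birkhoffUnbounded T g) := by
    have hd : Integrable (fun x => f x - F x) μ := hf.sub hFi
    rw [show (∫ x in birkhoffUnbounded T g, g x ∂μ) =
        ∫ x in birkhoffUnbounded T g, (f x - F x - ε / 2) ∂μ from rfl,
      integral_sub hd.integrableOn (integrable_const _).integrableOn,
      integral_sub hf.integrableOn hFi.integrableOn,
      setIntegral_condExp hle hf ⟨hBm, preimage_birkhoffUnbounded T g⟩]
    simp [mul_comm]
  have h2 : μ (birkhoffUnbounded T g) = 0 := by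
    have : μ.real (birkhoffUnbounded T g) = 0 := by
      have := measureReal_nonneg (μ := μ) (s := birkhoffUnbounded T g)
      rw [h1] at h0
      nlinarith
    rwa [measureReal_eq_zero_iff] at this
  have h3 : ∀ᵐ x ∂μ, x ∉ birkhoffUnbounded T g := measure_eq_zero_iff_ae_notMem.1 h2
  filter_upwards [h3] with x hx
  simp only [birkhoffUnbounded, Set.mem_ofPred_eq, not_forall, not_exists, not_lt] at hx
  obtain ⟨C, hC⟩ := hx
  obtain ⟨N, hN⟩ := exists_nat_ge (2 * C / ε)
  filter_upwards [eventually_ge_atTop (N + 1)] with n hn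
  have hn0 : (0 : ℝ) < n := by exact_mod_cast (by omega : 0 < n)
  have h4 : birkhoffSum T g n x = birkhoffSum T f n x - n * F x - n * (ε / 2) := by
    have e : g = (f - F) - fun _ => ε / 2 := rfl
    rw [e, birkhoffSum_sub, birkhoffSum_sub, birkhoffSum_const_apply, birkhoffSum_of_comp_eq hFT]
    simp
  have h5 := (birkhoffSum_le_birkhoffMax T g n x).trans (hC n)
  have h6 : (C : ℝ) ≤ n * (ε / 2) := by
    have : (N : ℝ) ≤ n := by exact_mod_cast (by omega : N ≤ n)
    have h7 := hN.trans this
    rw [div_le_iff₀ hε] at h7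
    linarith
  rw [birkhoffAverage, smul_eq_mul, inv_mul_le_iff₀ hn0]
  rw [h4] at h5
  linarith

/-- Birkhoff's pointwise ergodic theorem. -/
theorem ae_tendsto_birkhoffAverage [IsFiniteMeasure μ] {T : Ω → Ω}
    (hT : MeasurePreserving T μ μ) {f : Ω → ℝ} (hfm : Measurable f) (hf : Integrable f μ) :
    ∀ᵐ x ∂μ, Tendsto (fun n => birkhoffAverage ℝ T f n x) atTop
      (𝓝 ((μ[f | MeasurableSpace.invariants T]) x)) := by
  have hup : ∀ᵐ x ∂μ, ∀ j : ℕ, ∀ᶠ n : ℕ in atTop, birkhoffAverage ℝ T f n x ≤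
      (μ[f | MeasurableSpace.invariants T]) x + 1 / ((j : ℝ) + 1) :=
    ae_all_iff.2 fun j => ae_eventually_birkhoffAverage_le hT hfm hf Nat.one_div_pos_of_nat
  have hlo : ∀ᵐ x ∂μ, ∀ j : ℕ, ∀ᶠ n : ℕ in atTop, birkhoffAverage ℝ T (-f) n x ≤
      (μ[-f | MeasurableSpace.invariants T]) x + 1 / ((j : ℝ) + 1) :=
    ae_all_iff.2 fun j => ae_eventually_birkhoffAverage_le hT hfm.neg hf.neg Nat.one_div_pos_of_nat
  filter_upwards [hup, hlo, condExp_neg f (MeasurableSpace.invariants T)] with x h1 h2 h3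
  rw [Metric.tendsto_atTop']
  intro ε hε
  obtain ⟨j, hj⟩ := exists_nat_one_div_lt hε
  obtain ⟨N, hN⟩ := eventually_atTop.1 ((h1 j).and (h2 j))
  refine ⟨N, fun n hn => ?_⟩
  obtain ⟨h4, h5⟩ := hN n hn.le
  rw [birkhoffAverage_neg, h3] at h5
  simp only [Pi.neg_apply] at h5
  rw [Real.dist_eq, abs_lt]
  constructor <;> linarith

/-- Two-sided version, for actions of `ℤ` and bounded functions. -/
lemma exists_ae_tendsto_average_int [IsFiniteMeasure μ] (σ : ℤ → Ω → Ω)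
    (hσ : ∀ k, MeasurePreserving (σ k) μ μ) (h0 : ∀ x, σ 0 x = x)
    (hadd : ∀ k l x, σ (k + l) x = σ k (σ l x)) {f : Ω → ℝ} (hfm : Measurable f) {B : ℝ}
    (hB : ∀ x, |f x| ≤ B) :
    ∃ F : Ω → ℝ, Measurable F ∧ ∀ᵐ x ∂μ, Tendsto
      (fun n : ℕ => (∑ a ∈ Finset.Ico (-(n : ℤ)) n, f (σ a x)) / (2 * n)) atTop (𝓝 (F x)) := by
  have hf : Integrable f μ :=
    Integrable.of_bound hfm.aestronglyMeasurable B (Eventually.of_forall fun x => hB x)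
  have hle := MeasurableSpace.invariants_le (σ 1)
  have hle' := MeasurableSpace.invariants_le (σ (-1))
  -- The interval `[-n, n)` splits into a forward orbit starting at `x` and a backward orbit
  -- starting at `σ (-1) x`, which is why the second term is evaluated there.
  refine ⟨fun x => ((μ[f | MeasurableSpace.invariants (σ 1)]) x +
    (μ[f | MeasurableSpace.invariants (σ (-1))]) (σ (-1) x)) / 2, ?_, ?_⟩
  · refine Measurable.div_const (Measurable.add ?_ ?_) _
    · exact stronglyMeasurable_condExp.measurable.mono hle le_rfl
    · exact (stronglyMeasurable_condExp.measurable.mono hle' le_rfl).comp (hσ _).measurable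
  have it1 : ∀ (k : ℕ) x, (σ 1)^[k] x = σ k x := by
    intro k
    induction k with
    | zero => intro x; simp [h0]
    | succ k ih => intro x; rw [Function.iterate_succ_apply, ih, ← hadd]; simp
  have it2 : ∀ (k : ℕ) x, (σ (-1))^[k] x = σ (-(k : ℤ)) x := by
    intro k
    induction k with
    | zero => intro x; simp [h0]
    | succ k ih =>
      intro x; rw [Function.iterate_succ_apply, ih, ← hadd]; push_cast; congr 1; ring_nf
  have h1 := ae_tendsto_birkhoffAverage (hσ 1) hfm hf
  have h2 := (hσ (-1)).quasiMeasurePreserving.ae (ae_tendsto_birkhoffAverage (hσ (-1)) hfm hf)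
  filter_upwards [h1, h2] with x h1 h2
  refine ((h1.add h2).div_const 2).congr fun n => ?_
  simp only [birkhoffAverage, birkhoffSum, smul_eq_mul, it1, it2, ← hadd]
  have hsplit : ∑ a ∈ Finset.Ico (-(n : ℤ)) n, f (σ a x) =
      ∑ k ∈ Finset.range n, f (σ k x) + ∑ k ∈ Finset.range n, f (σ (-(k : ℤ) + -1) x) := by
    have e : Finset.Ico (-(n : ℤ)) n =
        (Finset.range n).image (fun k : ℕ => (k : ℤ)) ∪
          (Finset.range n).image (fun k : ℕ => -(k : ℤ) + -1) := by
      ext a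
      simp only [Finset.mem_Ico, Finset.mem_union, Finset.mem_image, Finset.mem_range]
      constructor
      · intro h
        rcases le_or_gt 0 a with h' | h'
        · exact Or.inl ⟨a.toNat, by omega, by omega⟩
        · exact Or.inr ⟨(-a - 1).toNat, by omega, by omega⟩
      · rintro (⟨k, hk, rfl⟩ | ⟨k, hk, rfl⟩) <;> omega
    rw [e, Finset.sum_union, Finset.sum_image, Finset.sum_image]
    · intro a _ b _ h; simpa using h
    · intro a _ b _ h; simpa using h
    · rw [Finset.disjoint_left]
      simp only [Finset.mem_image, Finset.mem_range]
      rintro _ ⟨k, hk, rfl⟩ ⟨l, hl, h⟩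
      omega
  rw [hsplit]
  ring

/-- A bounded family converging almost everywhere may be averaged along a `ℤ`-action. -/
lemma ae_tendsto_average_int_of_ae_tendsto [IsProbabilityMeasure μ] (σ : ℤ → Ω → Ω)
    (hσ : ∀ k, MeasurePreserving (σ k) μ μ) (h0 : ∀ x, σ 0 x = x)
    (hadd : ∀ k l x, σ (k + l) x = σ k (σ l x)) {Φ : ℕ → Ω → ℝ} {f : Ω → ℝ}
    (hΦm : ∀ n, Measurable (Φ n)) (hfm : Measurable f) {B : ℝ}
    (hΦB : ∀ n x, |Φ n x| ≤ B) (hB : ∀ x, |f x| ≤ B)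
    (hlim : ∀ᵐ x ∂μ, Tendsto (fun n => Φ n x) atTop (𝓝 (f x))) :
    ∀ᵐ x ∂μ, Tendsto (fun n : ℕ =>
      (∑ a ∈ Finset.Ico (-(n : ℤ)) n, Φ n (σ a x)) / (2 * n) -
      (∑ a ∈ Finset.Ico (-(n : ℤ)) n, f (σ a x)) / (2 * n)) atTop (𝓝 0) := by
  -- Maximal-tail trick: for `n ≥ N` the averaged error is at most the average of the fixed function
  -- `g N`, which converges to some `G N` with the same integral. These integrals tend to 0, so the
  -- infimum of the `G N` vanishes almost everywhere.
  set g : ℕ → Ω → ℝ := fun N x => ⨆ n, |Φ (N + n) x - f x| with hg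
  have hbd : ∀ N x n, |Φ (N + n) x - f x| ≤ 2 * B := fun N x n =>
    (abs_sub _ _).trans (by linarith [hΦB (N + n) x, hB x])
  have hbdd : ∀ N x, BddAbove (Set.range fun n => |Φ (N + n) x - f x|) := fun N x =>
    ⟨2 * B, by rintro _ ⟨n, rfl⟩; exact hbd N x n⟩
  have hg0 : ∀ N x, 0 ≤ g N x := fun N x => Real.iSup_nonneg fun _ => abs_nonneg _
  have hgB : ∀ N x, g N x ≤ 2 * B := fun N x => ciSup_le (hbd N x)
  have hgabs : ∀ N x, |g N x| ≤ 2 * B := fun N x => by rw [abs_of_nonneg (hg0 N x)]; exact hgB N x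
  have hgm : ∀ N, Measurable (g N) := fun N =>
    Measurable.iSup fun n => ((hΦm (N + n)).sub hfm).abs
  have hle : ∀ N n x, N ≤ n → |Φ n x - f x| ≤ g N x := by
    intro N n x h
    obtain ⟨k, rfl⟩ := Nat.exists_eq_add_of_le h
    exact le_ciSup (hbdd N x) k
  have hInt : Tendsto (fun N => ∫ x, g N x ∂μ) atTop (𝓝 0) := by
    have : Tendsto (fun N => ∫ x, g N x ∂μ) atTop (𝓝 (∫ _, (0 : ℝ) ∂μ)) := by
      apply tendsto_integral_of_dominated_convergence (fun _ => 2 * B)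
      · exact fun N => (hgm N).aestronglyMeasurable
      · exact integrable_const _
      · exact fun N => Eventually.of_forall fun x => hgabs N x
      · filter_upwards [hlim] with x hx
        rw [Metric.tendsto_atTop] at hx ⊢
        intro ε hε
        obtain ⟨N, hN⟩ := hx (ε / 2) (half_pos hε)
        refine ⟨N, fun n hn => ?_⟩
        rw [Real.dist_0_eq_abs, abs_of_nonneg (hg0 n x)]
        refine lt_of_le_of_lt (ciSup_le fun k => ?_) (half_lt_self hε)
        exact (hN (n + k) (by omega)).le
    simpa using this
  choose G hGm hG using fun N => exists_ae_tendsto_average_int σ hσ h0 hadd (hgm N) (hgabs N)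
  have hcard : ∀ n : ℕ, (Finset.Ico (-(n : ℤ)) n).card = 2 * n := fun n => by
    rw [Int.card_Ico]; omega
  have havg : ∀ N (n : ℕ) x, 0 ≤ (∑ a ∈ Finset.Ico (-(n : ℤ)) n, g N (σ a x)) / (2 * n) ∧
      (∑ a ∈ Finset.Ico (-(n : ℤ)) n, g N (σ a x)) / (2 * n) ≤ 2 * B := by
    intro N n x
    refine ⟨div_nonneg (Finset.sum_nonneg fun _ _ => hg0 _ _) (by positivity), ?_⟩
    have hBpos : 0 ≤ 2 * B := (hg0 N x).trans (hgB N x)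
    rcases n.eq_zero_or_pos with rfl | hn
    · simpa using hBpos
    · rw [div_le_iff₀ (by positivity)]
      have := Finset.sum_le_card_nsmul (Finset.Ico (-(n : ℤ)) n) (fun a => g N (σ a x)) (2 * B)
        fun a _ => hgB _ _
      rw [hcard, nsmul_eq_mul] at this
      push_cast at this
      linarith
  have hGint : ∀ N, ∫ x, G N x ∂μ = ∫ x, g N x ∂μ := by
    intro N
    have h1 : Tendsto (fun n : ℕ => ∫ x, (∑ a ∈ Finset.Ico (-(n : ℤ)) n, g N (σ a x)) / (2 * n) ∂μ)
        atTop (𝓝 (∫ x, G N x ∂μ)) := by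
      apply tendsto_integral_of_dominated_convergence (fun _ => 2 * B)
      · exact fun n => ((Finset.measurable_sum _ fun a _ =>
          (hgm N).comp (hσ a).measurable).div_const _).aestronglyMeasurable
      · exact integrable_const _
      · refine fun n => Eventually.of_forall fun x => ?_
        rw [Real.norm_eq_abs, abs_of_nonneg (havg N n x).1]
        exact (havg N n x).2
      · exact hG N
    refine tendsto_nhds_unique h1 (tendsto_const_nhds.congr' ?_)
    filter_upwards [eventually_ge_atTop 1] with n hn
    have hgi : Integrable (g N) μ := Integrable.of_bound (hgm N).aestronglyMeasurable (2 * B)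
      (Eventually.of_forall fun x => hgabs N x)
    have hn' : (n : ℝ) ≠ 0 := by positivity
    have hsi : ∀ a, ∫ x, g N (σ a x) ∂μ = ∫ x, g N x ∂μ := by
      intro a
      conv_rhs => rw [← (hσ a).map_eq]
      exact (integral_map (hσ a).measurable.aemeasurable (hgm N).aestronglyMeasurable).symm
    have hsig : ∀ a, Integrable (fun x => g N (σ a x)) μ := fun a =>
      (hσ a).integrable_comp_of_integrable hgi
    rw [integral_div, integral_finsetSum _ fun a _ => hsig a]
    simp only [hsi, Finset.sum_const, hcard, nsmul_eq_mul]
    push_cast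
    field_simp
  have hG0 : ∀ᵐ x ∂μ, ∀ N, 0 ≤ G N x := ae_all_iff.2 fun N => by
    filter_upwards [hG N] with x hx
    exact ge_of_tendsto' hx fun n => (havg N n x).1
  have hGB : ∀ᵐ x ∂μ, ∀ N, G N x ≤ 2 * B := ae_all_iff.2 fun N => by
    filter_upwards [hG N] with x hx
    exact le_of_tendsto' hx fun n => (havg N n x).2
  have hGi : ∀ N, Integrable (G N) μ := fun N =>
    Integrable.of_bound (hGm N).aestronglyMeasurable (2 * B) (by
      filter_upwards [hG0, hGB] with x h1 h2
      rw [Real.norm_eq_abs, abs_of_nonneg (h1 N)]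
      exact h2 N)
  have hinf : ∀ᵐ x ∂μ, ⨅ N, G N x = 0 := by
    have hnn : ∀ᵐ x ∂μ, 0 ≤ ⨅ N, G N x := hG0.mono fun x hx => Real.iInf_nonneg hx
    have hinfm : Measurable fun x => ⨅ N, G N x := Measurable.iInf hGm
    have hinfle : ∀ᵐ x ∂μ, ∀ N, ⨅ N, G N x ≤ G N x := hG0.mono fun x hx N =>
      ciInf_le ⟨0, by rintro _ ⟨k, rfl⟩; exact hx k⟩ N
    have hinfi : Integrable (fun x => ⨅ N, G N x) μ := by
      refine Integrable.mono' (hGi 0) hinfm.aestronglyMeasurable ?_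
      filter_upwards [hnn, hinfle] with x h1 h2
      rw [Real.norm_eq_abs, abs_of_nonneg h1]
      exact h2 0
    have hz : ∫ x, ⨅ N, G N x ∂μ = 0 := by
      refine le_antisymm (ge_of_tendsto' hInt fun N => ?_) (integral_nonneg_of_ae hnn)
      rw [← hGint N]
      exact integral_mono_ae hinfi (hGi N) (hinfle.mono fun x hx => hx N)
    exact (integral_eq_zero_iff_of_nonneg_ae hnn hinfi).1 hz
  filter_upwards [hinf, ae_all_iff.2 hG] with x hx hGx
  rw [Metric.tendsto_atTop']
  intro ε hε
  obtain ⟨N, hN⟩ : ∃ N, G N x < ε := by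
    by_contra hcon
    push Not at hcon
    have := le_ciInf hcon
    rw [hx] at this
    linarith
  obtain ⟨n₀, hn₀⟩ := eventually_atTop.1 ((hGx N).eventually_lt_const hN)
  refine ⟨max n₀ N, fun n hn => ?_⟩
  rw [Real.dist_0_eq_abs, ← sub_div, ← Finset.sum_sub_distrib, abs_div]
  refine lt_of_le_of_lt ?_ (hn₀ n (le_of_lt (lt_of_le_of_lt (le_max_left _ _) hn)))
  rw [abs_of_nonneg (by positivity : (0 : ℝ) ≤ 2 * n)]
  gcongr
  refine (Finset.abs_sum_le_sum_abs _ _).trans (Finset.sum_le_sum fun a _ => ?_)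
  exact hle N n _ (le_of_lt (lt_of_le_of_lt (le_max_right _ _) hn))

/-- The integer points of the box `[-n, n)^d`. -/
noncomputable def latticeBox (d n : ℕ) : Finset (Fin d → ℤ) :=
  Fintype.piFinset fun _ => Finset.Ico (-(n : ℤ)) n

lemma card_latticeBox (d n : ℕ) : (latticeBox d n).card = (2 * n) ^ d := by
  simp only [latticeBox, Fintype.card_piFinset, Int.card_Ico, Finset.prod_const, Finset.card_univ,
    Fintype.card_fin]
  congr 1
  omega

lemma sum_piFinset_cons {α E : Type*} [AddCommMonoid E] (n : ℕ) (S : Finset α)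
    (f : (Fin (n + 1) → α) → E) :
    ∑ y ∈ Fintype.piFinset (fun _ : Fin (n + 1) => S), f y =
      ∑ a ∈ S, ∑ y ∈ Fintype.piFinset (fun _ : Fin n => S), f (Fin.cons a y) := by
  rw [← Finset.sum_product']
  refine Finset.sum_bij' (fun k _ => (k 0, Fin.tail k)) (fun p _ => Fin.cons p.1 p.2) ?_ ?_ ?_ ?_ ?_
  · intro k hk
    simp only [Fintype.mem_piFinset] at hk
    simp only [Finset.mem_product, Fintype.mem_piFinset]
    exact ⟨hk 0, fun j => hk j.succ⟩
  · intro p hp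
    simp only [Finset.mem_product, Fintype.mem_piFinset] at hp ⊢
    exact fun j => Fin.cases hp.1 (fun j => hp.2 j) j
  · intro k _; exact Fin.cons_self_tail k
  · intro p _; simp
  · intro k _; rw [Fin.cons_self_tail]

/-- The pointwise ergodic theorem for `ℤ^d`-actions, boxes and bounded functions. -/
theorem exists_ae_tendsto_average_latticeBox [IsProbabilityMeasure μ] (d : ℕ)
    (τ : (Fin d → ℤ) → Ω → Ω) (hτ : ∀ k, MeasurePreserving (τ k) μ μ) (h0 : ∀ x, τ 0 x = x)
    (hadd : ∀ k l x, τ (k + l) x = τ k (τ l x)) {f : Ω → ℝ} (hfm : Measurable f) {B : ℝ}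
    (hB : ∀ x, |f x| ≤ B) :
    ∃ F : Ω → ℝ, Measurable F ∧ ∀ᵐ x ∂μ, Tendsto
      (fun n : ℕ => (∑ k ∈ latticeBox d n, f (τ k x)) / (2 * n) ^ d) atTop (𝓝 (F x)) := by
  induction d with
  | zero =>
    refine ⟨f, hfm, Eventually.of_forall fun x => tendsto_const_nhds.congr fun n => ?_⟩
    have : latticeBox 0 n = {0} := by
      ext k; simp [latticeBox, eq_iff_true_of_subsingleton]
    rw [this, Finset.sum_singleton, h0, pow_zero, div_one]
  | succ d ih =>
    rcases isEmpty_or_nonempty Ω with hΩ | ⟨⟨x₀⟩⟩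
    · exact ⟨f, hfm, Eventually.of_forall fun x => hΩ.elim x⟩
    have hB0 : 0 ≤ B := (abs_nonneg _).trans (hB x₀)
    have cadd : ∀ (a b : ℤ) (k l : Fin d → ℤ),
        (Fin.cons a k : Fin (d + 1) → ℤ) + Fin.cons b l = Fin.cons (a + b) (k + l) := by
      intro a b k l
      ext j
      exact Fin.cases (by simp) (fun j => by simp) j
    have c0 : (Fin.cons (0 : ℤ) (0 : Fin d → ℤ) : Fin (d + 1) → ℤ) = 0 := by
      ext j
      exact Fin.cases (by simp) (fun j => by simp) j
    obtain ⟨F₀, hF₀m, hF₀⟩ := ih (fun k => τ (Fin.cons 0 k)) (fun k => hτ _)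
      (fun x => by rw [c0, h0]) (fun k l x => by rw [← hadd, cadd, add_zero])
    set Φ : ℕ → Ω → ℝ := fun n x => (∑ k ∈ latticeBox d n, f (τ (Fin.cons 0 k) x)) / (2 * n) ^ d
      with hΦ
    have hΦm : ∀ n, Measurable (Φ n) := fun n =>
      (Finset.measurable_sum _ fun k _ => hfm.comp (hτ _).measurable).div_const _
    have hΦB : ∀ n x, |Φ n x| ≤ B := by
      intro n x
      simp only [hΦ]
      rw [abs_div, abs_of_nonneg (by positivity : (0 : ℝ) ≤ (2 * n) ^ d)]
      refine div_le_of_le_mul₀ (by positivity) hB0 ?_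
      refine (Finset.abs_sum_le_sum_abs _ _).trans ?_
      refine (Finset.sum_le_card_nsmul _ _ B fun k _ => hB _).trans ?_
      rw [card_latticeBox, nsmul_eq_mul, mul_comm]
      push_cast
      exact le_rfl
    -- Truncation makes the bound hold everywhere, as the one-dimensional theorem requires; almost
    -- everywhere nothing changes.
    set F₁ : Ω → ℝ := fun x => max (-B) (min B (F₀ x)) with hF₁
    have hF₁m : Measurable F₁ := measurable_const.max (measurable_const.min hF₀m)
    have hF₁B : ∀ x, |F₁ x| ≤ B := fun x =>
      abs_le.2 ⟨le_max_left _ _, max_le (by linarith) (min_le_left _ _)⟩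
    have hlim : ∀ᵐ x ∂μ, Tendsto (fun n => Φ n x) atTop (𝓝 (F₁ x)) := by
      filter_upwards [hF₀] with x hx
      have h1 : F₀ x ≤ B := le_of_tendsto' hx fun n => (abs_le.1 (hΦB n x)).2
      have h2 : -B ≤ F₀ x := ge_of_tendsto' hx fun n => (abs_le.1 (hΦB n x)).1
      simpa only [hF₁, min_eq_right h1, max_eq_right h2] using hx
    have hσ : ∀ a : ℤ, MeasurePreserving (τ (Fin.cons a 0)) μ μ := fun a => hτ _
    have hσ0 : ∀ x, τ (Fin.cons 0 0) x = x := fun x => by rw [c0, h0]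
    have hσadd : ∀ (a b : ℤ) x, τ (Fin.cons (a + b) 0) x = τ (Fin.cons a 0) (τ (Fin.cons b 0) x) :=
      fun a b x => by rw [← hadd, cadd, add_zero]
    obtain ⟨F₂, hF₂m, hF₂⟩ := exists_ae_tendsto_average_int (fun a : ℤ => τ (Fin.cons a 0))
      hσ hσ0 hσadd hF₁m hF₁B
    -- The inner average has the same side length `n` as the outer one, so the limits are not
    -- iterated; this replaces the inner average by its limit inside the outer one.
    have hdiff := ae_tendsto_average_int_of_ae_tendsto (fun a : ℤ => τ (Fin.cons a 0))
      hσ hσ0 hσadd hΦm hF₁m hΦB hF₁B hlim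
    refine ⟨F₂, hF₂m, ?_⟩
    filter_upwards [hF₂, hdiff] with x h1 h2
    have h3 := h2.add h1
    rw [zero_add] at h3
    refine h3.congr fun n => ?_
    rw [sub_add_cancel, latticeBox, sum_piFinset_cons]
    simp only [hΦ, latticeBox, ← Finset.sum_div, ← hadd, cadd, zero_add, add_zero]
    rw [div_div, pow_succ]

end Ergodic

/-! ### Sums over sparse configurations -/

section Deterministic

variable {d : ℕ}

/-- The index of the unit cell containing `x`. -/
noncomputable def cellIndex (x : Pos d) : Fin d → ℤ := fun j => ⌊x j⌋

/-- The half-open box `[-N, N)^d`. -/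
def box (d N : ℕ) : Set (Pos d) := {x | ∀ j, -(N : ℝ) ≤ x j ∧ x j < N}

lemma cellIndex_mem_latticeBox {N : ℕ} {x : Pos d} :
    cellIndex x ∈ latticeBox d N ↔ x ∈ box d N := by
  simp only [latticeBox, Fintype.mem_piFinset, Finset.mem_Ico, cellIndex, box, Set.mem_ofPred_eq,
    Int.le_floor, Int.floor_lt]
  push_cast
  exact Iff.rfl

lemma box_mono {N M : ℕ} (h : N ≤ M) : box d N ⊆ box d M := by
  intro x hx j
  have : (N : ℝ) ≤ M := by exact_mod_cast h
  exact ⟨by linarith [(hx j).1], by linarith [(hx j).2]⟩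

lemma add_mem_box {N M : ℕ} {x y : Pos d} (hx : x ∈ box d N) (hy : y ∈ box d M) :
    x + y ∈ box d (N + M) := by
  intro j
  have h1 := hx j
  have h2 := hy j
  simp only [PiLp.add_apply, Nat.cast_add]
  exact ⟨by linarith [h1.1, h2.1], by linarith [h1.2, h2.2]⟩

/-- The box is half-open, so a coordinate `-N` is sent to the excluded value `N`; hence the extra
unit. -/
lemma neg_mem_box {N : ℕ} {x : Pos d} (hx : x ∈ box d N) : -x ∈ box d (N + 1) := by
  intro j
  have h1 := hx j
  simp only [PiLp.neg_apply, Nat.cast_add, Nat.cast_one]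
  exact ⟨by linarith [h1.1, h1.2], by linarith [h1.1, h1.2]⟩

lemma exists_mem_box (x : Pos d) : ∃ N : ℕ, x ∈ box d N := by
  obtain ⟨N, hN⟩ := exists_nat_gt ‖x‖
  refine ⟨N, fun j => ?_⟩
  have := (PiLp.norm_apply_le x j).trans_lt hN
  rw [Real.norm_eq_abs, abs_lt] at this
  exact ⟨this.1.le, this.2⟩

lemma exists_subset_box {s : Set (Pos d)} (hs : Bornology.IsBounded s) :
    ∃ N : ℕ, s ⊆ box d N := by
  obtain ⟨C, hC⟩ := hs.exists_norm_le
  obtain ⟨N, hN⟩ := exists_nat_gt C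
  refine ⟨N, fun x hx j => ?_⟩
  have := (PiLp.norm_apply_le x j).trans_lt ((hC x hx).trans_lt hN)
  rw [Real.norm_eq_abs, abs_lt] at this
  exact ⟨this.1.le, this.2⟩

/-- `W` is bounded by `c`, and has at most `K` points of its support in every unit cell. -/
structure Sparse (W : Pos d → ℝ) (c : ℝ) (K : ℕ) : Prop where
  abs_le : ∀ x, |W x| ≤ c
  encard_le : ∀ k, ({x | W x ≠ 0 ∧ cellIndex x = k} : Set (Pos d)).encard ≤ K

namespace Sparse

variable {W : Pos d → ℝ} {c : ℝ} {K : ℕ}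

lemma const_nonneg (h : Sparse W c K) : 0 ≤ c := (abs_nonneg _).trans (h.abs_le 0)

lemma finite_points (h : Sparse W c K) (Q : Finset (Fin d → ℤ)) :
    ({x | W x ≠ 0 ∧ cellIndex x ∈ Q} : Set (Pos d)).Finite := by
  have : ({x | W x ≠ 0 ∧ cellIndex x ∈ Q} : Set (Pos d)) =
      ⋃ k ∈ Q, {x | W x ≠ 0 ∧ cellIndex x = k} := by
    ext x; simp
  rw [this]
  exact Q.finite_toSet.biUnion fun k _ => Set.finite_of_encard_le_coe (h.encard_le k)

/-- The points of the support of `W` whose cell belongs to `Q`. -/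
noncomputable def points (h : Sparse W c K) (Q : Finset (Fin d → ℤ)) : Finset (Pos d) :=
  (h.finite_points Q).toFinset

lemma mem_points (h : Sparse W c K) {Q : Finset (Fin d → ℤ)} {x : Pos d} :
    x ∈ h.points Q ↔ W x ≠ 0 ∧ cellIndex x ∈ Q := by
  simp [points]

lemma card_points_le (h : Sparse W c K) (Q : Finset (Fin d → ℤ)) :
    (h.points Q).card ≤ K * Q.card := by
  refine Finset.card_le_mul_card_image_of_maps_to (f := cellIndex)
    (fun x hx => (h.mem_points.1 hx).2) K fun k hk => ?_
  have h1 := h.encard_le k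
  have h2 : ((h.points Q).filter fun x => cellIndex x = k : Set (Pos d)).encard ≤ K := by
    refine le_trans (Set.encard_le_encard fun x hx => ?_) h1
    simp only [Finset.coe_filter, Set.mem_ofPred_eq, h.mem_points] at hx
    exact ⟨hx.1.1, hx.2⟩
  rw [Set.encard_coe_eq_coe_finsetCard] at h2
  exact_mod_cast h2

end Sparse

/-! ### Multiple sums -/

/-- The sum of `G` over all `ι`-tuples, weighted by the product of the values of `W`. -/
noncomputable def multiSum {ι : Type*} [Fintype ι] (W : Pos d → ℝ) (G : (ι → Pos d) → ℂ) : ℂ :=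
  ∑ᶠ y : ι → Pos d, (∏ j, (W (y j) : ℂ)) * G y

/-- The support of `G` is contained in the power of a box. -/
def BoundedSupport {ι : Type*} (G : (ι → Pos d) → ℂ) : Prop :=
  ∃ L : ℕ, ∀ y, G y ≠ 0 → ∀ j, y j ∈ box d L

section MultiSum

variable {ι : Type*} [Fintype ι] {W : Pos d → ℝ} {c : ℝ} {K : ℕ}

lemma multiSum_eq_sum_of_subset {G : (ι → Pos d) → ℂ} (Y : Finset (ι → Pos d))
    (hY : ∀ y, G y ≠ 0 → (∀ j, W (y j) ≠ 0) → y ∈ Y) :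
    multiSum W G = ∑ y ∈ Y, (∏ j, (W (y j) : ℂ)) * G y := by
  refine finsum_eq_sum_of_support_subset _ fun y hy => ?_
  rw [Function.mem_support, mul_ne_zero_iff, Finset.prod_ne_zero_iff] at hy
  exact hY y hy.2 fun j => by exact_mod_cast hy.1 j (Finset.mem_univ j)

lemma Sparse.multiSum_eq_sum [DecidableEq ι] (h : Sparse W c K) {G : (ι → Pos d) → ℂ} {L : ℕ}
    (hG : ∀ y, G y ≠ 0 → ∀ j, y j ∈ box d L) :
    multiSum W G = ∑ y ∈ Fintype.piFinset fun _ : ι => h.points (latticeBox d L),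
      (∏ j, (W (y j) : ℂ)) * G y :=
  multiSum_eq_sum_of_subset _ fun y h1 h2 => Fintype.mem_piFinset.2 fun j =>
    h.mem_points.2 ⟨h2 j, cellIndex_mem_latticeBox.2 (hG y h1 j)⟩

/-- A `finsum` with infinite support is 0 by default, so linearity of `multiSum` rests on this
finiteness. -/
lemma Sparse.finite_support (h : Sparse W c K) {G : (ι → Pos d) → ℂ} (hG : BoundedSupport G) :
    (Function.support fun y : ι → Pos d => (∏ j, (W (y j) : ℂ)) * G y).Finite := by
  classical
  obtain ⟨L, hL⟩ := hG
  refine (Finset.finite_toSet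
    (Fintype.piFinset fun _ : ι => h.points (latticeBox d L))).subset fun y hy => ?_
  rw [Function.mem_support, mul_ne_zero_iff, Finset.prod_ne_zero_iff] at hy
  exact Fintype.mem_piFinset.2 fun j => h.mem_points.2
    ⟨by exact_mod_cast hy.1 j (Finset.mem_univ j), cellIndex_mem_latticeBox.2 (hL y hy.2 j)⟩

lemma Sparse.multiSum_add (h : Sparse W c K) {G G' : (ι → Pos d) → ℂ} (hG : BoundedSupport G)
    (hG' : BoundedSupport G') :
    multiSum W (fun y => G y + G' y) = multiSum W G + multiSum W G' := by
  rw [multiSum, multiSum, multiSum, ← finsum_add_distrib (h.finite_support hG) (h.finite_support hG')]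
  simp only [mul_add]

lemma Sparse.multiSum_sub (h : Sparse W c K) {G G' : (ι → Pos d) → ℂ} (hG : BoundedSupport G)
    (hG' : BoundedSupport G') :
    multiSum W (fun y => G y - G' y) = multiSum W G - multiSum W G' := by
  rw [multiSum, multiSum, multiSum, ← finsum_sub_distrib (h.finite_support hG) (h.finite_support hG')]
  simp only [mul_sub]

lemma Sparse.multiSum_sum (h : Sparse W c K) {κ : Type*} (s : Finset κ) {G : κ → (ι → Pos d) → ℂ}
    (hG : ∀ k, BoundedSupport (G k)) :
    multiSum W (fun y => ∑ k ∈ s, G k y) = ∑ k ∈ s, multiSum W (G k) := by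
  simp only [multiSum, Finset.mul_sum]
  exact finsum_sum_comm _ _ fun k _ => h.finite_support (hG k)

lemma multiSum_const_mul (W : Pos d → ℝ) (a : ℂ) (G : (ι → Pos d) → ℂ) :
    multiSum W (fun y => a * G y) = a * multiSum W G := by
  have := smul_finsum a fun y : ι → Pos d => (∏ j, (W (y j) : ℂ)) * G y
  simp only [smul_eq_mul] at this
  rw [multiSum, multiSum, this]
  exact finsum_congr fun y => by ring

lemma multiSum_translate (W : Pos d → ℝ) (t : Pos d) (G : (ι → Pos d) → ℂ) :
    multiSum (fun x => W (x - t)) G = multiSum W (fun y => G fun j => y j + t) := by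
  have := finsum_comp_equiv (Equiv.subRight (fun _ : ι => t))
    (f := fun y : ι → Pos d => (∏ j, (W (y j) : ℂ)) * G (fun j => y j + t))
  rw [multiSum, multiSum, ← this]
  exact finsum_congr fun y => by simp

lemma multiSum_reindex {κ : Type*} [Fintype κ] (W : Pos d → ℝ) (e : κ ≃ ι)
    (G : (ι → Pos d) → ℂ) :
    multiSum W (fun y : κ → Pos d => G (y ∘ e.symm)) = multiSum W G := by
  have := finsum_comp_equiv (Equiv.arrowCongr e (Equiv.refl (Pos d)))
    (f := fun y : ι → Pos d => (∏ j, (W (y j) : ℂ)) * G y)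
  rw [multiSum, multiSum, ← this]
  refine finsum_congr fun y => ?_
  congr 1
  exact Fintype.prod_equiv e _ _ fun j => by simp

/-- Tuples are not required to have distinct entries, so no diagonal corrections appear. This makes
higher moments of multiple sums means of multiple sums. -/
lemma Sparse.multiSum_mul {κ : Type*} [Fintype κ] (h : Sparse W c K) {G : (ι → Pos d) → ℂ}
    {G' : (κ → Pos d) → ℂ} (hG : BoundedSupport G) (hG' : BoundedSupport G') :
    multiSum W G * multiSum W G' =
      multiSum W (fun y : ι ⊕ κ → Pos d => G (y ∘ Sum.inl) * G' (y ∘ Sum.inr)) := by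
  classical
  obtain ⟨L, hL⟩ := hG
  obtain ⟨L', hL'⟩ := hG'
  have hM : ∀ y, G y ≠ 0 → ∀ j, y j ∈ box d (max L L') := fun y hy j =>
    box_mono (le_max_left _ _) (hL y hy j)
  have hM' : ∀ y, G' y ≠ 0 → ∀ j, y j ∈ box d (max L L') := fun y hy j =>
    box_mono (le_max_right _ _) (hL' y hy j)
  rw [h.multiSum_eq_sum hM, h.multiSum_eq_sum hM', Finset.sum_mul_sum, ← Finset.sum_product',
    h.multiSum_eq_sum (L := max L L')]
  · refine Finset.sum_bij' (fun p _ => Sum.elim p.1 p.2) (fun y _ => (y ∘ Sum.inl, y ∘ Sum.inr))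
      ?_ ?_ ?_ ?_ ?_
    · intro p hp
      simp only [Finset.mem_product, Fintype.mem_piFinset] at hp ⊢
      rintro (j | j)
      · exact hp.1 j
      · exact hp.2 j
    · intro y hy
      simp only [Finset.mem_product, Fintype.mem_piFinset] at hy ⊢
      exact ⟨fun j => hy _, fun j => hy _⟩
    · intro p _; simp
    · intro y _; simp
    · intro p _
      simp only [Fintype.prod_sum_type, Sum.elim_inl, Sum.elim_inr, Sum.elim_comp_inl,
        Sum.elim_comp_inr]
      ring
  · intro y hy
    rw [mul_ne_zero_iff] at hy
    rintro (j | j)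
    · exact hM _ hy.1 j
    · exact hM' _ hy.2 j

lemma Sparse.norm_prod_le (h : Sparse W c K) (y : ι → Pos d) :
    ‖∏ j, (W (y j) : ℂ)‖ ≤ c ^ Fintype.card ι := by
  rw [norm_prod]
  refine (Finset.prod_le_prod (fun _ _ => norm_nonneg _) fun j _ => ?_).trans
    (by rw [Finset.prod_const, Finset.card_univ])
  rw [Complex.norm_real, Real.norm_eq_abs]
  exact h.abs_le _

lemma Sparse.norm_multiSum_le_of_subset (h : Sparse W c K) {G : (ι → Pos d) → ℂ}
    (Y : Finset (ι → Pos d)) (hY : ∀ y, G y ≠ 0 → (∀ j, W (y j) ≠ 0) → y ∈ Y) {B : ℝ}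
    (hB : ∀ y, ‖G y‖ ≤ B) : ‖multiSum W G‖ ≤ Y.card * (c ^ Fintype.card ι * B) := by
  rw [multiSum_eq_sum_of_subset Y hY, ← nsmul_eq_mul]
  refine norm_sum_le_of_le _ (fun y _ => ?_) |>.trans (by rw [Finset.sum_const])
  rw [norm_mul]
  have := h.const_nonneg
  exact mul_le_mul (h.norm_prod_le y) (hB y) (norm_nonneg _) (by positivity)

lemma Sparse.norm_multiSum_le (h : Sparse W c K) {G : (ι → Pos d) → ℂ} {L : ℕ}
    (hG : ∀ y, G y ≠ 0 → ∀ j, y j ∈ box d L) {B : ℝ} (hB : ∀ y, ‖G y‖ ≤ B) :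
    ‖multiSum W G‖ ≤
      ((K * (2 * L) ^ d : ℕ) : ℝ) ^ Fintype.card ι * (c ^ Fintype.card ι * B) := by
  classical
  have hB0 : 0 ≤ B := (norm_nonneg _).trans (hB fun _ => 0)
  have := h.const_nonneg
  refine (h.norm_multiSum_le_of_subset
    (Fintype.piFinset fun _ : ι => h.points (latticeBox d L)) (fun y h1 h2 =>
      Fintype.mem_piFinset.2 fun j => h.mem_points.2
        ⟨h2 j, cellIndex_mem_latticeBox.2 (hG y h1 j)⟩) hB).trans ?_
  refine mul_le_mul_of_nonneg_right ?_ (by positivity)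
  rw [Fintype.card_piFinset, Finset.prod_const, Finset.card_univ, ← Nat.cast_pow]
  refine Nat.cast_le.2 (Nat.pow_le_pow_left ?_ _)
  rw [← card_latticeBox]
  exact h.card_points_le _

/-- A bound for sums in which all points are close to the first one, and the cell of the first one
is restricted to `Q`. -/
lemma Sparse.norm_multiSum_le_card (h : Sparse W c K) {n : ℕ} {E : (Fin (n + 1) → Pos d) → ℂ}
    (Q : Finset (Fin d → ℤ)) (ρ : ℕ)
    (hE : ∀ y, E y ≠ 0 → cellIndex (y 0) ∈ Q ∧ ∀ j : Fin n, y j.succ - y 0 ∈ box d ρ) {B : ℝ}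
    (hB : ∀ y, ‖E y‖ ≤ B) :
    ‖multiSum W E‖ ≤ Q.card * ((K : ℝ) * (K * (2 * ρ + 1) ^ d : ℕ) ^ n * (c ^ (n + 1) * B)) := by
  classical
  have hB0 : 0 ≤ B := (norm_nonneg _).trans (hB fun _ => 0)
  have hc := h.const_nonneg
  -- A displacement in `[-ρ, ρ)` moves the integer part of a coordinate by at most `ρ` either way,
  -- which leaves `2 * ρ + 1` values per coordinate.
  set near : Pos d → Finset (Fin d → ℤ) := fun x =>
    Fintype.piFinset fun j => Finset.Ico (cellIndex x j - ρ) (cellIndex x j + ρ + 1) with hnear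
  have hcard : ∀ x, (near x).card = (2 * ρ + 1) ^ d := by
    intro x
    simp only [hnear, Fintype.card_piFinset, Int.card_Ico]
    rw [Finset.prod_congr rfl fun j _ =>
      (by omega : (cellIndex x j + ρ + 1 - (cellIndex x j - ρ)).toNat = 2 * ρ + 1)]
    simp
  have hmem : ∀ x z : Pos d, z - x ∈ box d ρ → cellIndex z ∈ near x := by
    intro x z hz
    simp only [hnear, Fintype.mem_piFinset, Finset.mem_Ico, cellIndex]
    intro j
    have h1 := hz j
    simp only [PiLp.sub_apply] at h1
    have h2 := Int.floor_le (x j)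
    have h3 := Int.lt_floor_add_one (x j)
    constructor
    · rw [Int.le_floor]; push_cast; linarith [h1.1]
    · rw [Int.floor_lt]; push_cast; linarith [h1.2]
  set Y : Finset (Fin (n + 1) → Pos d) := (h.points Q).biUnion fun x =>
    (Fintype.piFinset fun _ : Fin n => h.points (near x)).image fun y => Fin.cons x y with hY
  have hYcard : Y.card ≤ (K * Q.card) * (K * (2 * ρ + 1) ^ d) ^ n := by
    refine (Finset.card_biUnion_le_card_mul _ _ ((K * (2 * ρ + 1) ^ d) ^ n) fun x _ => ?_).trans
      (Nat.mul_le_mul_right _ (h.card_points_le Q))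
    refine Finset.card_image_le.trans ?_
    rw [Fintype.card_piFinset, Finset.prod_const, Finset.card_univ, Fintype.card_fin, ← hcard x]
    exact Nat.pow_le_pow_left (h.card_points_le _) _
  refine (h.norm_multiSum_le_of_subset Y (fun y h1 h2 => ?_) hB).trans ?_
  · obtain ⟨h3, h4⟩ := hE y h1
    rw [hY, Finset.mem_biUnion]
    refine ⟨y 0, h.mem_points.2 ⟨h2 0, h3⟩, Finset.mem_image.2 ⟨Fin.tail y, ?_, ?_⟩⟩
    · exact Fintype.mem_piFinset.2 fun j => h.mem_points.2 ⟨h2 _, hmem _ _ (h4 j)⟩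
    · exact Fin.cons_self_tail y
  · rw [Fintype.card_fin]
    calc (Y.card : ℝ) * (c ^ (n + 1) * B)
        ≤ ((K * Q.card) * (K * (2 * ρ + 1) ^ d) ^ n : ℕ) * (c ^ (n + 1) * B) := by
          gcongr
      _ = _ := by push_cast; ring

end MultiSum

end Deterministic

/-! ### Box averages and correlation sums -/

section Averages

variable {d : ℕ}

/-- A shell of fixed thickness has volume of lower order than the box; every boundary error is
compared with it. The truncation in `N - a` concerns finitely many `N` only. -/
lemma tendsto_shell (d a : ℕ) : Tendsto (fun N : ℕ =>
    ((2 * ((N + a : ℕ) : ℝ)) ^ d - (2 * ((N - a : ℕ) : ℝ)) ^ d) / (2 * (N : ℝ)) ^ d)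
    atTop (𝓝 0) := by
  have h1 : Tendsto (fun N : ℕ => (a : ℝ) / N) atTop (𝓝 0) := tendsto_const_div_atTop_nhds_zero_nat _
  have h2 : Tendsto (fun N : ℕ => (1 + (a : ℝ) / N) ^ d - (1 - (a : ℝ) / N) ^ d) atTop (𝓝 0) := by
    have := ((h1.const_add 1).pow d).sub ((h1.const_sub 1).pow d)
    simpa using this
  refine h2.congr' ?_
  filter_upwards [eventually_ge_atTop (a + 1)] with N hN
  have hN0 : (0 : ℝ) < N := by exact_mod_cast (by omega : 0 < N)
  rw [sub_div, ← div_pow, ← div_pow, Nat.cast_sub (by omega), Nat.cast_add]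
  congr 2
  · field_simp
  · field_simp

/-- Sums over the points in a shell of bounded thickness. -/
lemma Sparse.norm_multiSum_le_shell {W : Pos d → ℝ} {c : ℝ} {K : ℕ} (h : Sparse W c K) {n : ℕ}
    {E : (Fin (n + 1) → Pos d) → ℂ} (N a ρ : ℕ)
    (hE : ∀ y, E y ≠ 0 → y 0 ∈ box d (N + a) ∧ y 0 ∉ box d (N - a) ∧
      ∀ j : Fin n, y j.succ - y 0 ∈ box d ρ) {B : ℝ} (hB : ∀ y, ‖E y‖ ≤ B) :
    ‖multiSum W E‖ ≤ ((2 * ((N + a : ℕ) : ℝ)) ^ d - (2 * ((N - a : ℕ) : ℝ)) ^ d) *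
      ((K : ℝ) * (K * (2 * ρ + 1) ^ d : ℕ) ^ n * (c ^ (n + 1) * B)) := by
  classical
  refine (h.norm_multiSum_le_card (latticeBox d (N + a) \ latticeBox d (N - a)) ρ
    (fun y hy => ?_) hB).trans_eq ?_
  · obtain ⟨h1, h2, h3⟩ := hE y hy
    refine ⟨?_, h3⟩
    rw [Finset.mem_sdiff, cellIndex_mem_latticeBox, cellIndex_mem_latticeBox]
    exact ⟨h1, h2⟩
  · have hsub : latticeBox d (N - a) ⊆ latticeBox d (N + a) :=
      Fintype.piFinset_subset _ _ fun j => Finset.Ico_subset_Ico (by omega) (by omega)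
    rw [Finset.card_sdiff_of_subset hsub, Nat.cast_sub (Finset.card_le_card hsub),
      card_latticeBox, card_latticeBox]
    push_cast
    rfl

/-! #### The tent partition of unity -/

/-- The one-dimensional tent function. -/
noncomputable def hat (u : ℝ) : ℝ := max 0 (1 - |u|)

lemma hat_nonneg (u : ℝ) : 0 ≤ hat u := le_max_left _ _

lemma hat_ne_zero {u : ℝ} (h : hat u ≠ 0) : |u| < 1 := by
  by_contra hcon
  exact h (max_eq_left (by linarith))

lemma hat_le_one (u : ℝ) : hat u ≤ 1 := max_le zero_le_one (by linarith [abs_nonneg u])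

/-- Only the tents at `⌊u⌋` and `⌊u⌋ + 1` can be nonzero at `u`, and their values there add up to 1.
-/
lemma sum_hat_le_one (A : Finset ℤ) (u : ℝ) : ∑ a ∈ A, hat (u - a) ≤ 1 ∧
    (⌊u⌋ ∈ A → ⌊u⌋ + 1 ∈ A → ∑ a ∈ A, hat (u - a) = 1) := by
  have h1 : ⌊u⌋ ≠ ⌊u⌋ + 1 := by omega
  have hpair : ∑ a ∈ ({⌊u⌋, ⌊u⌋ + 1} : Finset ℤ), hat (u - a) = 1 := by
    rw [Finset.sum_pair h1]
    have h2 := Int.floor_le u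
    have h3 := Int.lt_floor_add_one u
    simp only [hat]
    push_cast
    rw [abs_of_nonneg (by linarith), abs_of_nonpos (by linarith), max_eq_right (by linarith),
      max_eq_right (by linarith)]
    ring
  have hzero : ∀ a : ℤ, a ∉ ({⌊u⌋, ⌊u⌋ + 1} : Finset ℤ) → hat (u - a) = 0 := by
    intro a ha
    by_contra hcon
    have h4 := abs_lt.1 (hat_ne_zero hcon)
    have h5 : a ≤ ⌊u⌋ + 1 := by
      have : (a : ℝ) < ⌊u⌋ + 2 := by linarith [Int.lt_floor_add_one u]
      have : a < ⌊u⌋ + 2 := by exact_mod_cast this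
      omega
    have h6 : ⌊u⌋ ≤ a := by
      have : (⌊u⌋ : ℝ) < a + 1 := by linarith [Int.floor_le u]
      have : ⌊u⌋ < a + 1 := by exact_mod_cast this
      omega
    apply ha
    simp only [Finset.mem_insert, Finset.mem_singleton]
    omega
  constructor
  · rw [← hpair, ← Finset.sum_inter_add_sum_sdiff A ({⌊u⌋, ⌊u⌋ + 1} : Finset ℤ),
      Finset.sum_eq_zero (s := A \ _) fun a ha => hzero a (Finset.mem_sdiff.1 ha).2, add_zero]
    exact Finset.sum_le_sum_of_subset_of_nonneg Finset.inter_subset_right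
      fun _ _ _ => hat_nonneg _
  · intro h7 h8
    rw [← hpair]
    refine (Finset.sum_subset ?_ fun a _ ha => hzero a ha).symm
    intro a ha
    simp only [Finset.mem_insert, Finset.mem_singleton] at ha
    rcases ha with rfl | rfl <;> assumption

/-- The tent function on `ℝ^d`; its integer translates form a partition of unity. -/
noncomputable def tent (x : Pos d) : ℝ := ∏ j, hat (x j)

lemma continuous_tent : Continuous (tent (d := d)) := by
  unfold tent hat
  fun_prop

lemma tent_nonneg (x : Pos d) : 0 ≤ tent x := Finset.prod_nonneg fun _ _ => hat_nonneg _

lemma tent_le_one (x : Pos d) : tent x ≤ 1 :=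
  Finset.prod_le_one (fun _ _ => hat_nonneg _) fun _ _ => hat_le_one _

lemma tent_zero : tent (0 : Pos d) = 1 := by simp [tent, hat]

lemma mem_box_of_tent_ne_zero {x : Pos d} (h : tent x ≠ 0) : x ∈ box d 1 := by
  intro j
  have := abs_lt.1 (hat_ne_zero (Finset.prod_ne_zero_iff.1 h j (Finset.mem_univ j)))
  rw [Nat.cast_one]
  exact ⟨this.1.le, this.2⟩

/-- An integer vector as a point of `ℝ^d`. -/
noncomputable def latticeVec (k : Fin d → ℤ) : Pos d := WithLp.toLp 2 fun j => (k j : ℝ)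

lemma latticeVec_add (k l : Fin d → ℤ) : latticeVec (k + l) = latticeVec k + latticeVec l := by
  ext j; simp [latticeVec]

lemma latticeVec_zero : latticeVec (0 : Fin d → ℤ) = 0 := by
  ext j; simp [latticeVec]

/-- The sum of the tents centred in `[-N, N)^d`. -/
noncomputable def tentSum (N : ℕ) (x : Pos d) : ℝ := ∑ k ∈ latticeBox d N, tent (x - latticeVec k)

lemma tentSum_eq_prod (N : ℕ) (x : Pos d) :
    tentSum N x = ∏ j, ∑ a ∈ Finset.Ico (-(N : ℤ)) N, hat (x j - a) := by
  rw [Finset.prod_univ_sum]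
  rfl

lemma tentSum_nonneg (N : ℕ) (x : Pos d) : 0 ≤ tentSum N x :=
  Finset.sum_nonneg fun _ _ => tent_nonneg _

lemma tentSum_le_one (N : ℕ) (x : Pos d) : tentSum N x ≤ 1 := by
  rw [tentSum_eq_prod]
  exact Finset.prod_le_one (fun _ _ => Finset.sum_nonneg fun _ _ => hat_nonneg _)
    fun j _ => (sum_hat_le_one _ _).1

/-- Both `⌊x j⌋` and `⌊x j⌋ + 1` must be centres in `[-N, N)`, which costs one unit at the upper
end. -/
lemma tentSum_eq_one {N : ℕ} {x : Pos d} (hx : x ∈ box d (N - 1)) : tentSum N x = 1 := by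
  rw [tentSum_eq_prod]
  refine Finset.prod_eq_one fun j _ => (sum_hat_le_one _ _).2 ?_ ?_
  all_goals
    have h1 := cellIndex_mem_latticeBox.2 hx
    simp only [latticeBox, Fintype.mem_piFinset, Finset.mem_Ico, cellIndex] at h1
    have h2 := h1 j
    rw [Finset.mem_Ico]
    omega

lemma mem_box_of_tentSum_ne_zero {N : ℕ} {x : Pos d} (h : tentSum N x ≠ 0) :
    x ∈ box d (N + 1) := by
  obtain ⟨k, hk, h1⟩ := Finset.exists_ne_zero_of_sum_ne_zero h
  have h2 := mem_box_of_tent_ne_zero h1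
  have h3 : latticeVec k ∈ box d N := by
    simp only [latticeBox, Fintype.mem_piFinset, Finset.mem_Ico] at hk
    intro j
    simp only [latticeVec]
    exact ⟨by exact_mod_cast (hk j).1, by exact_mod_cast (hk j).2⟩
  have := add_mem_box h3 h2
  rwa [add_sub_cancel] at this

/-! #### Correlation sums as box averages -/

/-- The function of a point and its neighbours obtained from a function of the differences. -/
def diffFun {n : ℕ} (f : (Fin n → Pos d) → ℂ) (u : Pos d → ℝ) (y : Fin (n + 1) → Pos d) : ℂ :=
  u (y 0) * f fun j => y j.succ - y 0

lemma boundedSupport_diffFun {n : ℕ} {f : (Fin n → Pos d) → ℂ} (hf : BoundedSupport f)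
    {u : Pos d → ℝ} {M : ℕ} (hu : ∀ x, u x ≠ 0 → x ∈ box d M) :
    BoundedSupport (diffFun f u) := by
  obtain ⟨L, hL⟩ := hf
  refine ⟨M + L, fun y hy j => ?_⟩
  rw [diffFun, mul_ne_zero_iff, Complex.ofReal_ne_zero] at hy
  have h0 := hu _ hy.1
  refine Fin.cases (box_mono (by omega) h0) (fun j => ?_) j
  have := add_mem_box h0 (hL _ hy.2 j)
  rwa [add_sub_cancel] at this

variable {W : Pos d → ℝ} {c : ℝ} {K : ℕ}

/-- Since `f` sees differences only, moving all points moves just the tent. The box sum thus becomes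
an orbit sum of one local statistic, to which the ergodic theorem applies. -/
lemma Sparse.multiSum_tentSum (h : Sparse W c K) {n : ℕ} {f : (Fin n → Pos d) → ℂ}
    (hf : BoundedSupport f) (N : ℕ) :
    multiSum W (diffFun f (tentSum N)) =
      ∑ k ∈ latticeBox d N, multiSum (fun x => W (x + latticeVec k)) (diffFun f tent) := by
  have : diffFun f (tentSum N) = fun y => ∑ k ∈ latticeBox d N,
      diffFun f tent (fun j => y j - latticeVec k) := by
    ext y
    simp [diffFun, tentSum, Finset.sum_mul]
  rw [this, h.multiSum_sum]
  · refine Finset.sum_congr rfl fun k _ => ?_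
    have := multiSum_translate W (-latticeVec k) (diffFun f tent)
    simp only [sub_neg_eq_add, ← sub_eq_add_neg] at this
    rw [this]
  · intro k
    obtain ⟨L, hL⟩ := boundedSupport_diffFun hf fun x (hx : tent x ≠ 0) => mem_box_of_tent_ne_zero hx
    obtain ⟨M, hM⟩ := exists_mem_box (latticeVec k)
    refine ⟨M + L, fun y hy j => ?_⟩
    have := add_mem_box hM (hL _ hy j)
    rwa [add_sub_cancel] at this

/-- The average of the correlation function `f` over the tents centred in `[-N, N)^d`. -/
noncomputable def tentAverage {n : ℕ} (W : Pos d → ℝ) (f : (Fin n → Pos d) → ℂ) (N : ℕ) : ℂ :=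
  multiSum W (diffFun f (tentSum N)) / (2 * N) ^ d

/-- Box averages are asymptotically invariant under translations. -/
lemma Sparse.tendsto_tentAverage_translate (h : Sparse W c K) {n : ℕ} {f : (Fin n → Pos d) → ℂ}
    (hf : BoundedSupport f) {B : ℝ} (hB : ∀ z, ‖f z‖ ≤ B) (t : Pos d) :
    Tendsto (fun N => tentAverage (fun x => W (x - t)) f N - tentAverage W f N) atTop (𝓝 0) := by
  obtain ⟨ρ, hρ⟩ := hf
  obtain ⟨a₁, ha₁⟩ := exists_mem_box t
  obtain ⟨a₂, ha₂⟩ := exists_mem_box (-t)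
  -- The two tent sums differ only in a shell of thickness `a`: both are 1 well inside and 0 well
  -- outside. `a₁` and `a₂` absorb the shift, the 2 absorbs the width of the tents.
  set a := a₁ + a₂ + 2 with ha
  have hB0 : 0 ≤ B := (norm_nonneg _).trans (hB fun _ => 0)
  have key := (tendsto_shell d a).mul_const
    ((K : ℝ) * (K * (2 * ρ + 1) ^ d : ℕ) ^ n * (c ^ (n + 1) * B))
  rw [zero_mul] at key
  refine squeeze_zero_norm (fun N => ?_) key
  have hb1 : BoundedSupport (diffFun f fun x => tentSum N (x + t)) :=
    boundedSupport_diffFun ⟨ρ, hρ⟩ (M := N + 1 + a₂) fun x hx => by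
      have := add_mem_box (mem_box_of_tentSum_ne_zero hx) ha₂
      rwa [add_neg_cancel_right] at this
  have hb2 : BoundedSupport (diffFun f (tentSum N)) :=
    boundedSupport_diffFun ⟨ρ, hρ⟩ (M := N + 1) fun x hx => mem_box_of_tentSum_ne_zero hx
  have hrw : tentAverage (fun x => W (x - t)) f N - tentAverage W f N =
      multiSum W (fun y => diffFun f (fun x => tentSum N (x + t)) y - diffFun f (tentSum N) y) /
        (2 * N) ^ d := by
    rw [tentAverage, tentAverage, ← sub_div, h.multiSum_sub hb1 hb2, multiSum_translate]
    congr 3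
    ext y
    simp [diffFun]
  have hn : ‖((2 : ℂ) * N) ^ d‖ = (2 * (N : ℝ)) ^ d := by simp
  rw [hrw, norm_div, hn, div_mul_eq_mul_div]
  refine div_le_div_of_nonneg_right ?_ (by positivity)
  have hfac : ∀ y : Fin (n + 1) → Pos d,
      diffFun f (fun x => tentSum N (x + t)) y - diffFun f (tentSum N) y =
        ((tentSum N (y 0 + t) - tentSum N (y 0) : ℝ) : ℂ) * f fun j => y j.succ - y 0 := by
    intro y; simp [diffFun, sub_mul]
  refine h.norm_multiSum_le_shell N a ρ (fun y hy => ?_) fun y => ?_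
  · rw [hfac, mul_ne_zero_iff, Complex.ofReal_ne_zero] at hy
    refine ⟨?_, ?_, hρ _ hy.2⟩
    · by_cases h1 : tentSum N (y 0) = 0
      · have h2 : tentSum N (y 0 + t) ≠ 0 := fun h2 => hy.1 (by rw [h1, h2, sub_zero])
        have := add_mem_box (mem_box_of_tentSum_ne_zero h2) ha₂
        rw [add_neg_cancel_right] at this
        exact box_mono (by omega) this
      · exact box_mono (by omega) (mem_box_of_tentSum_ne_zero h1)
    · intro h1
      apply hy.1
      -- For `N < a` the inner box is `box d 0`, which is empty unless `d = 0`; in that case the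
      -- space is a single point.
      rcases Nat.lt_or_ge N a with h2 | h2
      · rcases Nat.eq_zero_or_pos d with rfl | hd
        · rw [Subsingleton.elim (y 0 + t) (y 0), sub_self]
        · have := h1 ⟨0, hd⟩
          rw [Nat.sub_eq_zero_of_le h2.le] at this
          simp at this
          linarith
      · rw [tentSum_eq_one (box_mono (by omega) h1),
          tentSum_eq_one (box_mono (by omega) (add_mem_box h1 ha₁)), sub_self]
  · rw [hfac, norm_mul, Complex.norm_real]
    have h1 : ‖tentSum N (y 0 + t) - tentSum N (y 0)‖ ≤ 1 := by
      rw [Real.norm_eq_abs, _root_.abs_le]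
      constructor <;> linarith [tentSum_nonneg N (y 0 + t), tentSum_nonneg N (y 0),
        tentSum_le_one N (y 0 + t), tentSum_le_one N (y 0)]
    calc _ ≤ 1 * B := mul_le_mul h1 (hB _) (norm_nonneg _) zero_le_one
      _ = B := one_mul B

lemma cube_subset_box (d : ℕ) (R : ℝ) : cube d R ⊆ box d (⌊R / 2⌋₊ + 1) := by
  intro x hx j
  have h1 := abs_lt.1 (hx j)
  have h2 := Nat.lt_floor_add_one (R / 2)
  push_cast
  exact ⟨by linarith, by linarith⟩

open Classical in
/-- The summand of the correlation sum. -/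
noncomputable def cubeFun {n : ℕ} (f : (Fin n → Pos d) → ℂ) (R : ℝ) (y : Fin (n + 1) → Pos d) : ℂ :=
  if ∀ j, y j ∈ cube d R then f fun j => y j.succ - y 0 else 0

lemma boundedSupport_cubeFun {n : ℕ} (f : (Fin n → Pos d) → ℂ) (R : ℝ) :
    BoundedSupport (cubeFun f R) := by
  refine ⟨⌊R / 2⌋₊ + 1, fun y hy j => cube_subset_box d R ?_⟩
  by_contra hcon
  exact hy (if_neg fun h => hcon (h j))

lemma Sparse.corrSum_eq_multiSum {m : ℕ} {w : Fin m → ℝ} {lam : Measure (ColPt d m)}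
    (h : Sparse (weightAt w lam) c K) (n : ℕ) (R : ℝ) (f : (Fin n → Pos d) → ℂ) :
    corrSum w lam n R f = multiSum (weightAt w lam) (cubeFun f R) := by
  classical
  set W := weightAt w lam with hW
  set P := (h.points (latticeBox d (⌊R / 2⌋₊ + 1))).filter (· ∈ cube d R) with hP
  have hmem : ∀ x, x ∈ P ↔ W x ≠ 0 ∧ x ∈ cube d R := by
    intro x
    rw [hP, Finset.mem_filter, h.mem_points, cellIndex_mem_latticeBox]
    exact ⟨fun hx => ⟨hx.1.1, hx.2⟩, fun hx => ⟨⟨hx.1, cube_subset_box d R hx.2⟩, hx.2⟩⟩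
  have inner : ∀ x : Pos d, (∑ᶠ y ∈ {y : Fin n → Pos d | ∀ j, y j ∈ cube d R},
      ((W x * ∏ j, W (y j) : ℝ) : ℂ) * f (fun j => y j - x)) =
      ∑ y ∈ Fintype.piFinset fun _ : Fin n => P,
        ((W x * ∏ j, W (y j) : ℝ) : ℂ) * f (fun j => y j - x) := by
    intro x
    refine finsum_mem_eq_sum_of_inter_support_eq _ ?_
    ext y
    simp only [Set.mem_inter_iff, Set.mem_ofPred_eq, Function.mem_support, mul_ne_zero_iff,
      Complex.ofReal_ne_zero, Finset.prod_ne_zero_iff, Finset.mem_coe, Fintype.mem_piFinset, hmem,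
      Finset.mem_univ, true_imp_iff, forall_and]
    tauto
  rw [corrSum]
  simp only [← hW, inner]
  rw [finsum_mem_eq_sum_of_inter_support_eq (t := P),
    multiSum_eq_sum_of_subset (Fintype.piFinset fun _ : Fin (n + 1) => P), sum_piFinset_cons]
  · refine Finset.sum_congr rfl fun x hx => Finset.sum_congr rfl fun y hy => ?_
    have : ∀ j, (Fin.cons x y : Fin (n + 1) → Pos d) j ∈ cube d R := fun j =>
      Fin.cases ((hmem x).1 hx).2 (fun j => ((hmem _).1 (Fintype.mem_piFinset.1 hy j)).2) j
    rw [cubeFun, if_pos this, Fin.prod_univ_succ]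
    simp
  · intro y h1 h2
    refine Fintype.mem_piFinset.2 fun j => (hmem _).2 ⟨h2 j, ?_⟩
    by_contra hcon
    exact h1 (if_neg fun h => hcon (h j))
  · ext x
    simp only [Set.mem_inter_iff, Finset.mem_coe, hmem]
    refine ⟨fun hx => ⟨⟨fun h0 => hx.2 ?_, hx.1⟩, hx.2⟩, fun hx => ⟨hx.1.2, hx.2⟩⟩
    exact Finset.sum_eq_zero fun y _ => by simp [h0]

lemma volume_real_cube (d : ℕ) {R : ℝ} (hR : 0 ≤ R) : volume.real (cube d R) = R ^ d := by
  have h1 : cube d R = (WithLp.ofLp : Pos d → Fin d → ℝ) ⁻¹'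
      (Set.univ.pi fun _ => Set.Ioo (-(R / 2)) (R / 2)) := by
    ext x
    simp [cube, abs_lt]
  rw [measureReal_def, h1, (PiLp.volume_preserving_ofLp (Fin d)).measure_preimage
    (MeasurableSet.univ_pi fun _ => measurableSet_Ioo).nullMeasurableSet, Real.volume_pi_Ioo]
  simp [ENNReal.toReal_ofReal hR]

/-- Correlation sums over the cubes `C_R` and box averages have the same limits. -/
lemma Sparse.tendsto_corrSum {m : ℕ} {w : Fin m → ℝ} {lam : Measure (ColPt d m)}
    (h : Sparse (weightAt w lam) c K) {n : ℕ} {f : (Fin n → Pos d) → ℂ}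
    (hf : BoundedSupport f) {B : ℝ} (hB : ∀ z, ‖f z‖ ≤ B) {l : ℂ}
    (hl : Tendsto (tentAverage (weightAt w lam) f) atTop (𝓝 l)) :
    Tendsto (fun R : ℝ => corrSum w lam n R f / ((volume.real (cube d R) : ℝ) : ℂ))
      atTop (𝓝 l) := by
  set W := weightAt w lam with hW
  obtain ⟨ρ, hρ⟩ := hf
  have hB0 : 0 ≤ B := (norm_nonneg _).trans (hB fun _ => 0)
  set N : ℝ → ℕ := fun R => ⌊R / 2⌋₊ with hN
  have hNt : Tendsto N atTop atTop :=
    tendsto_nat_floor_atTop.comp (tendsto_id.atTop_div_const two_pos)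
  have hratio : Tendsto (fun R : ℝ => (((2 * (N R : ℝ)) ^ d / R ^ d : ℝ) : ℂ)) atTop (𝓝 1) := by
    have h1 : Tendsto (fun R : ℝ => ((N R : ℝ) / (R / 2))) atTop (𝓝 1) :=
      (tendsto_nat_floor_div_atTop (R := ℝ)).comp (tendsto_id.atTop_div_const two_pos)
    have h2 := h1.pow d
    rw [one_pow] at h2
    have h3 := (Complex.continuous_ofReal.tendsto 1).comp h2
    refine h3.congr fun R => ?_
    simp only [Function.comp]
    rw [← div_pow]
    congr 2
    field_simp
  have hdiff : Tendsto (fun R : ℝ => (corrSum w lam n R f - multiSum W (diffFun f (tentSum (N R)))) /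
      (2 * (N R : ℂ)) ^ d) atTop (𝓝 0) := by
    -- If the first point lies in `box d (N R - a)`, its neighbours lie in `box d (N R - 1)`, hence
    -- in the cube, and the tent sum is 1: the two summands agree away from the shell.
    set a := ρ + 1 with ha
    have key := ((tendsto_shell d a).comp hNt).mul_const
      ((K : ℝ) * (K * (2 * ρ + 1) ^ d : ℕ) ^ n * (c ^ (n + 1) * B))
    rw [zero_mul] at key
    refine squeeze_zero_norm' ?_ key
    filter_upwards [hNt.eventually_ge_atTop (a + 1), eventually_gt_atTop 0] with R hR hR0
    have hNR : (N R : ℝ) ≤ R / 2 := Nat.floor_le (by linarith)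
    have hb2 : BoundedSupport (diffFun f (tentSum (N R))) :=
      boundedSupport_diffFun ⟨ρ, hρ⟩ (M := N R + 1) fun x hx => mem_box_of_tentSum_ne_zero hx
    have hn : ‖((2 : ℂ) * N R) ^ d‖ = (2 * (N R : ℝ)) ^ d := by simp
    rw [h.corrSum_eq_multiSum, ← h.multiSum_sub (boundedSupport_cubeFun f R) hb2, norm_div, hn,
      Function.comp, div_mul_eq_mul_div]
    refine div_le_div_of_nonneg_right ?_ (by positivity)
    refine h.norm_multiSum_le_shell (N R) a ρ (fun y hy => ?_) fun y => ?_
    · have hf0 : f (fun j => y j.succ - y 0) ≠ 0 := by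
        intro h0
        apply hy
        simp [cubeFun, diffFun, h0]
      refine ⟨?_, ?_, hρ _ hf0⟩
      · by_cases h1 : y 0 ∈ cube d R
        · exact box_mono (show ⌊R / 2⌋₊ + 1 ≤ ⌊R / 2⌋₊ + a by omega) (cube_subset_box d R h1)
        · have h2 : tentSum (N R) (y 0) ≠ 0 := by
            intro h2
            apply hy
            rw [cubeFun, if_neg fun h3 => h1 (h3 0), diffFun, h2]
            simp
          exact box_mono (by omega) (mem_box_of_tentSum_ne_zero h2)
      · intro h1
        apply hy
        have hin : ∀ x ∈ box d (N R - 1), x ∈ cube d R := by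
          intro x hx j
          have := hx j
          rw [Nat.cast_sub (by omega)] at this
          rw [abs_lt]
          push_cast at this
          exact ⟨by linarith [this.1], by linarith [this.2]⟩
        have h2 : ∀ j, y j ∈ cube d R := by
          refine Fin.cases (hin _ (box_mono (by omega) h1)) fun j => ?_
          have := add_mem_box h1 (hρ _ hf0 j)
          rw [add_sub_cancel] at this
          exact hin _ (box_mono (by omega) this)
        rw [cubeFun, if_pos h2, diffFun, tentSum_eq_one (box_mono (by omega) h1)]
        simp
    · have h1 := tentSum_nonneg (N R) (y 0)
      have h2 := tentSum_le_one (N R) (y 0)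
      have h3 := hB fun j => y j.succ - y 0
      simp only [cubeFun, diffFun]
      split_ifs
      · rw [← one_sub_mul, norm_mul, ← Complex.ofReal_one, ← Complex.ofReal_sub, Complex.norm_real,
          Real.norm_eq_abs, abs_of_nonneg (by linarith)]
        exact (mul_le_of_le_one_left (norm_nonneg _) (by linarith)).trans h3
      · rw [zero_sub, norm_neg, norm_mul, Complex.norm_real, Real.norm_eq_abs, abs_of_nonneg h1]
        exact (mul_le_of_le_one_left (norm_nonneg _) h2).trans h3
  have hlim := ((hl.comp hNt).add hdiff).mul hratio
  rw [add_zero, mul_one] at hlim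
  refine hlim.congr' ?_
  filter_upwards [hNt.eventually_ge_atTop 1, eventually_gt_atTop 0] with R hR hR0
  have hN0 : (2 * (N R : ℂ)) ^ d ≠ 0 := by
    have : N R ≠ 0 := by omega
    exact pow_ne_zero _ (by simpa using this)
  have hRc : (R : ℂ) ^ d ≠ 0 := pow_ne_zero _ (by exact_mod_cast hR0.ne')
  rw [volume_real_cube d hR0.le]
  simp only [Function.comp, tentAverage]
  push_cast
  field_simp
  ring

/-- Uniform bound of the normalised correlation sums. -/
lemma Sparse.norm_corrSum_div_le {m : ℕ} {w : Fin m → ℝ} {lam : Measure (ColPt d m)}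
    (h : Sparse (weightAt w lam) c K) {n : ℕ} {f : (Fin n → Pos d) → ℂ} {ρ : ℕ}
    (hρ : ∀ z, f z ≠ 0 → ∀ j, z j ∈ box d ρ) {B : ℝ} (hB : ∀ z, ‖f z‖ ≤ B) {R : ℝ} (hR : 2 ≤ R) :
    ‖corrSum w lam n R f / ((volume.real (cube d R) : ℝ) : ℂ)‖ ≤
      2 ^ d * ((K : ℝ) * (K * (2 * ρ + 1) ^ d : ℕ) ^ n * c ^ (n + 1)) * B := by
  have hB0 : 0 ≤ B := (norm_nonneg _).trans (hB fun _ => 0)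
  have hc := h.const_nonneg
  rw [volume_real_cube d (by linarith), norm_div, Complex.norm_real, Real.norm_eq_abs,
    abs_of_nonneg (by positivity), div_le_iff₀ (by positivity), h.corrSum_eq_multiSum]
  refine (h.norm_multiSum_le_card (latticeBox d (⌊R / 2⌋₊ + 1)) ρ (fun y hy => ?_)
    (B := B) fun y => ?_).trans ?_
  · have h1 : ∀ j, y j ∈ cube d R := by
      by_contra hcon
      exact hy (if_neg hcon)
    rw [cubeFun, if_pos h1] at hy
    exact ⟨cellIndex_mem_latticeBox.2 (cube_subset_box d R (h1 0)), hρ _ hy⟩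
  · simp only [cubeFun]
    split_ifs
    · exact hB _
    · simpa using hB0
  · rw [card_latticeBox]
    -- The left side is at most `R + 2`; here `2 ≤ R` enters, and the factor `2 ^ d` arises.
    have h1 : ((2 * (⌊R / 2⌋₊ + 1) : ℕ) : ℝ) ≤ 2 * R := by
      have := Nat.floor_le (show 0 ≤ R / 2 by linarith)
      push_cast
      linarith
    have h2 : (((2 * (⌊R / 2⌋₊ + 1)) ^ d : ℕ) : ℝ) ≤ 2 ^ d * R ^ d := by
      rw [Nat.cast_pow, ← mul_pow]
      exact pow_le_pow_left₀ (by positivity) h1 d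
    calc _ ≤ (2 ^ d * R ^ d) *
          ((K : ℝ) * (K * (2 * ρ + 1) ^ d : ℕ) ^ n * (c ^ (n + 1) * B)) := by gcongr
      _ = _ := by ring

end Averages

/-! ### Uniformly discrete point measures -/

section Configurations

variable {d m : ℕ}

/-- Translation as a homeomorphism of the space of coloured points. -/
def shiftHomeomorph (t : Pos d) : ColPt d m ≃ₜ ColPt d m :=
  (Homeomorph.addLeft t).prodCongr (Homeomorph.refl _)

lemma shift_eq (t : Pos d) : (shift t : ColPt d m → ColPt d m) = shiftHomeomorph t := rfl

lemma measurable_shift (t : Pos d) : Measurable (shift t : ColPt d m → ColPt d m) :=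
  (shiftHomeomorph t).measurable

lemma shiftMeasure_apply (t : Pos d) (lam : Measure (ColPt d m)) (A : Set (ColPt d m)) :
    shiftMeasure t lam A = lam (shift t ⁻¹' A) :=
  (shiftHomeomorph t).toMeasurableEquiv.map_apply A

lemma shiftMeasure_add (s t : Pos d) (lam : Measure (ColPt d m)) :
    shiftMeasure (s + t) lam = shiftMeasure s (shiftMeasure t lam) := by
  rw [shiftMeasure, shiftMeasure, shiftMeasure, Measure.map_map (measurable_shift s)
    (measurable_shift t)]
  congr 1
  ext p : 1
  simp [shift, add_assoc]

lemma shiftMeasure_zero (lam : Measure (ColPt d m)) : shiftMeasure 0 lam = lam := by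
  ext A _
  rw [shiftMeasure_apply]
  congr 1
  ext p
  simp [shift]

lemma measurable_shiftMeasure (t : Pos d) :
    Measurable (shiftMeasure t : Measure (ColPt d m) → Measure (ColPt d m)) :=
  Measure.measurable_map _ (measurable_shift t)

lemma weightAt_shiftMeasure (w : Fin m → ℝ) (t : Pos d) (lam : Measure (ColPt d m)) :
    weightAt w (shiftMeasure t lam) = fun x => weightAt w lam (x - t) := by
  ext x
  refine Finset.sum_congr rfl fun i _ => ?_
  rw [measureReal_def, measureReal_def, shiftMeasure_apply]
  congr 3
  ext p
  simp [shift, Prod.ext_iff, eq_sub_iff_add_eq']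

lemma isPointMeasure_shiftMeasure {lam : Measure (ColPt d m)} (h : IsPointMeasure lam)
    (t : Pos d) : IsPointMeasure (shiftMeasure t lam) := by
  intro A hA hAc
  rw [shiftMeasure_apply]
  refine h _ (measurable_shift t hA) ?_
  rw [shift_eq, ← (shiftHomeomorph t).preimage_closure]
  exact (shiftHomeomorph t).isCompact_preimage.2 hAc

lemma shiftMeasure_mem_uniformlyDiscrete {r : ℝ} {lam : Measure (ColPt d m)}
    (h : lam ∈ uniformlyDiscrete d m r) (t : Pos d) :
    shiftMeasure t lam ∈ uniformlyDiscrete d m r := by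
  refine ⟨isPointMeasure_shiftMeasure h.1 t, fun a => ?_⟩
  rw [shiftMeasure_apply]
  convert h.2 (a - t) using 3
  ext p
  simp only [Set.mem_preimage, shift, Set.mem_ofPred_eq]
  rw [add_comm, add_sub_assoc, sub_sub_eq_add_sub, add_sub_assoc]

lemma uniformlyDiscrete_anti {r s : ℝ} (h : r ≤ s) :
    uniformlyDiscrete d m s ⊆ uniformlyDiscrete d m r := fun lam hl =>
  ⟨hl.1, fun a => (measure_mono fun p hp k => (hp k).trans_le (by linarith)).trans (hl.2 a)⟩

lemma isOpen_cube (d : ℕ) (R : ℝ) : IsOpen (cube d R) := by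
  have : cube d R = ⋂ k, {x : Pos d | |x k| < R / 2} := by ext x; simp [cube]
  rw [this]
  exact isOpen_iInter_of_finite fun k => isOpen_lt (by fun_prop) continuous_const

lemma measurableSet_box (d N : ℕ) : MeasurableSet (box d N) := by
  have : box d N = ⋂ k, {x : Pos d | -(N : ℝ) ≤ x k ∧ x k < N} := by ext x; simp [box]
  rw [this]
  refine MeasurableSet.iInter fun k => MeasurableSet.inter ?_ ?_
  · exact measurableSet_le measurable_const (by fun_prop : Measurable fun x : Pos d => x k)
  · exact measurableSet_lt (by fun_prop : Measurable fun x : Pos d => x k) measurable_const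

lemma isBounded_box (d N : ℕ) : Bornology.IsBounded (box d N) := by
  refine isBounded_iff_forall_norm_le.2 ⟨√(∑ _k : Fin d, (N : ℝ) ^ 2), fun x hx => ?_⟩
  rw [EuclideanSpace.norm_eq]
  refine Real.sqrt_le_sqrt (Finset.sum_le_sum fun k _ => ?_)
  refine pow_le_pow_left₀ (norm_nonneg _) ?_ 2
  rw [Real.norm_eq_abs, abs_le]
  exact ⟨(hx k).1, (hx k).2.le⟩

/-- The coloured points with position in the box `[-N, N)^d`. -/
def colBox (d m N : ℕ) : Set (ColPt d m) := {p | p.1 ∈ box d N}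

lemma measurableSet_colBox (d m N : ℕ) : MeasurableSet (colBox d m N) :=
  measurable_fst (measurableSet_box d N)

lemma isCompact_closure_of_subset_colBox {N : ℕ} {A : Set (ColPt d m)} (h : A ⊆ colBox d m N) :
    IsCompact (closure A) := by
  refine ((isBounded_box d N).isCompact_closure.prod (isCompact_univ (X := Fin m))).closure_of_subset
    fun p hp => ?_
  exact ⟨subset_closure (h hp), Set.mem_univ _⟩

lemma exists_subset_colBox {A : Set (ColPt d m)} (h : IsCompact (closure A)) :
    ∃ N, A ⊆ colBox d m N := by
  obtain ⟨N, hN⟩ := exists_subset_box ((h.image continuous_fst).isBounded.subset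
    (Set.image_mono subset_closure))
  exact ⟨N, fun p hp => hN (Set.mem_image_of_mem _ hp)⟩

/-! #### Measurability of the set of uniformly discrete point measures -/

/-- Finite intersections from a countable generating family form it, the empty intersection giving
the whole space. It reduces conditions on all Borel sets to countably many. -/
lemma exists_countable_piSystem (α : Type*) [MeasurableSpace α]
    [MeasurableSpace.CountablyGenerated α] :
    ∃ S : Set (Set α), S.Countable ∧ IsPiSystem S ∧ Set.univ ∈ S ∧
      ‹MeasurableSpace α› = MeasurableSpace.generateFrom S := by
  classical
  set b := MeasurableSpace.countableGeneratingSet α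
  have : Countable b := MeasurableSpace.countable_countableGeneratingSet (α := α)
  refine ⟨Set.range fun F : Finset b => ⋂ s ∈ F, (s : Set α), Set.countable_range _, ?_,
    ⟨∅, by simp⟩, ?_⟩
  · rintro _ ⟨F, rfl⟩ _ ⟨F', rfl⟩ _
    exact ⟨F ∪ F', Finset.iInf_union⟩
  · apply le_antisymm
    · conv_lhs => rw [← MeasurableSpace.generateFrom_countableGeneratingSet (α := α)]
      refine MeasurableSpace.generateFrom_mono fun s hs => ⟨{⟨s, hs⟩}, by simp⟩
    · refine MeasurableSpace.generateFrom_le ?_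
      rintro _ ⟨F, rfl⟩
      exact Finset.measurableSet_biInter _ fun s _ =>
        MeasurableSpace.measurableSet_countableGeneratingSet s.2

lemma exists_nat_eq_of_tendsto {x : ℝ} {u : ℕ → ℝ} (hu : ∀ n, ∃ k : ℕ, u n = k)
    (h : Tendsto u atTop (𝓝 x)) : ∃ k : ℕ, x = k := by
  have hc : IsClosed (Set.range ((↑) : ℕ → ℝ)) := Nat.isClosedEmbedding_coe_real.isClosed_range
  obtain ⟨k, hk⟩ := hc.mem_of_tendsto h (Eventually.of_forall fun n => by
    obtain ⟨k, hk⟩ := hu n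
    exact ⟨k, hk.symm⟩)
  exact ⟨k, hk.symm⟩

/-- A finite measure with natural values on a generating `π`-system has natural values. -/
lemma exists_nat_eq_of_isPiSystem {α : Type*} [mα : MeasurableSpace α] (ν : Measure α)
    {S : Set (Set α)} (hS : IsPiSystem S) (hgen : mα = MeasurableSpace.generateFrom S)
    (huniv : Set.univ ∈ S) (h : ∀ A ∈ S, ∃ k : ℕ, ν A = k) {A : Set α} (hA : MeasurableSet A) :
    ∃ k : ℕ, ν A = k := by
  have hfin : IsFiniteMeasure ν := ⟨by obtain ⟨k, hk⟩ := h _ huniv; rw [hk]; simp⟩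
  have hiff : ∀ A, (∃ k : ℕ, ν A = k) ↔ ∃ k : ℕ, ν.real A = k := by
    intro A
    refine exists_congr fun k => ?_
    rw [measureReal_def]
    constructor
    · intro h; rw [h]; simp
    · intro h; rw [← ENNReal.ofReal_toReal (measure_ne_top ν A), h]; simp
  induction A, hA using MeasurableSpace.induction_on_inter hgen hS with
  | empty => exact ⟨0, by simp⟩
  | basic A hA => exact h A hA
  | compl A hA ih =>
    obtain ⟨k, hk⟩ := ih
    obtain ⟨l, hl⟩ := h _ huniv
    exact ⟨l - k, by rw [measure_compl hA (measure_ne_top _ _), hk, hl]; simp⟩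
  | iUnion f hd hm ih =>
    rw [hiff]
    have h1 : Tendsto (fun n => ∑ i ∈ Finset.range n, ν (f i)) atTop (𝓝 (ν (⋃ i, f i))) := by
      rw [measure_iUnion hd hm]
      exact ENNReal.tendsto_nat_tsum _
    have h2 := (ENNReal.tendsto_toReal (measure_ne_top ν (⋃ i, f i))).comp h1
    refine exists_nat_eq_of_tendsto (fun n => ?_) h2
    choose k hk using ih
    refine ⟨∑ i ∈ Finset.range n, k i, ?_⟩
    simp [hk, ENNReal.toReal_sum]

/-- Countably many evaluations suffice: integrality is tested on a countable `π`-system cut by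
boxes, and the packing condition on a dense set of centres, because an open cube is the increasing
union of slightly smaller ones. -/
theorem measurableSet_uniformlyDiscrete (d m : ℕ) (r : ℝ) :
    MeasurableSet (uniformlyDiscrete d m r) := by
  obtain ⟨S, hSc, hSpi, hSu, hSgen⟩ := exists_countable_piSystem (ColPt d m)
  obtain ⟨D, hDc, hDd⟩ := TopologicalSpace.exists_countable_dense (Pos d)
  have hSm : ∀ A ∈ S, MeasurableSet A := fun A hA => by
    rw [hSgen]; exact MeasurableSpace.measurableSet_generateFrom hA
  have hcm : ∀ a : Pos d, MeasurableSet {p : ColPt d m | p.1 - a ∈ cube d r} := fun a =>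
    ((isOpen_cube d r).preimage (by fun_prop : Continuous fun p : ColPt d m => p.1 - a)).measurableSet
  have key : uniformlyDiscrete d m r =
      (⋂ A ∈ S, ⋂ N, {lam | lam (A ∩ colBox d m N) ∈ Set.range ((↑) : ℕ → ENNReal)}) ∩
      ⋂ a ∈ D, {lam | lam {p : ColPt d m | p.1 - a ∈ cube d r} ≤ 1} := by
    ext lam
    simp only [Set.mem_inter_iff, Set.mem_iInter, Set.mem_ofPred_eq]
    constructor
    · rintro ⟨h1, h2⟩
      refine ⟨fun A hA N => ?_, fun a _ => h2 a⟩
      obtain ⟨k, hk⟩ := h1 (A ∩ colBox d m N) ((hSm A hA).inter (measurableSet_colBox d m N))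
        (isCompact_closure_of_subset_colBox Set.inter_subset_right)
      exact ⟨k, hk.symm⟩
    · rintro ⟨h1, h2⟩
      refine ⟨fun A hA hAc => ?_, fun a => ?_⟩
      · obtain ⟨N, hN⟩ := exists_subset_colBox hAc
        have := exists_nat_eq_of_isPiSystem (lam.restrict (colBox d m N)) hSpi hSgen hSu
          (fun A hA => by
            obtain ⟨k, hk⟩ := h1 A hA N
            exact ⟨k, by rw [Measure.restrict_apply (hSm A hA), hk]⟩) hA
        rwa [Measure.restrict_apply hA, Set.inter_eq_left.2 hN] at this
      · have hmono : Monotone fun n : ℕ =>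
            {p : ColPt d m | p.1 - a ∈ cube d (r - 1 / ((n : ℝ) + 1))} := by
          intro n k hnk p hp j
          refine (hp j).trans_le ?_
          have := Nat.one_div_le_one_div (α := ℝ) hnk
          linarith
        have hU : {p : ColPt d m | p.1 - a ∈ cube d r} =
            ⋃ n : ℕ, {p : ColPt d m | p.1 - a ∈ cube d (r - 1 / ((n : ℝ) + 1))} := by
          ext p
          simp only [Set.mem_iUnion, Set.mem_ofPred_eq]
          constructor
          · intro hp
            have : ∀ᶠ n : ℕ in atTop, ∀ j, |(p.1 - a) j| < (r - 1 / ((n : ℝ) + 1)) / 2 := by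
              rw [eventually_all]
              intro j
              have ht : Tendsto (fun n : ℕ => (r - 1 / ((n : ℝ) + 1)) / 2) atTop (𝓝 (r / 2)) := by
                have := (tendsto_one_div_add_atTop_nhds_zero_nat (𝕜 := ℝ)).const_sub r
                simpa using this.div_const 2
              exact ht.eventually_const_lt (hp j)
            exact this.exists
          · rintro ⟨n, hn⟩ j
            refine (hn j).trans_le ?_
            have := Nat.one_div_pos_of_nat (α := ℝ) (n := n)
            linarith
        rw [hU, hmono.measure_iUnion]
        refine iSup_le fun n => ?_
        -- Shrinking the edge by `1 / (n + 1)` frees half of that on each side, so this displacement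
        -- of the centre stays inside the full cube.
        obtain ⟨b, hbD, hb⟩ := hDd.exists_dist_lt a
          (show (0 : ℝ) < 1 / ((n : ℝ) + 1) / 2 by positivity)
        refine (measure_mono fun p hp => ?_).trans (h2 b hbD)
        intro j
        have h3 := hp j
        have h4 : |(a - b) j| < 1 / ((n : ℝ) + 1) / 2 := by
          rw [dist_eq_norm] at hb
          exact (PiLp.norm_apply_le (a - b) j).trans_lt hb
        have h5 : (p.1 - b) j = (p.1 - a) j + (a - b) j := by simp
        rw [h5]
        refine (abs_add_le _ _).trans_lt ?_
        linarith
  rw [key]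
  refine MeasurableSet.inter (MeasurableSet.biInter hSc fun A hA => MeasurableSet.iInter fun N => ?_)
    (MeasurableSet.biInter hDc fun a _ => ?_)
  · exact Measure.measurable_coe ((hSm A hA).inter (measurableSet_colBox d m N))
      (Set.countable_range _).measurableSet
  · exact measurableSet_le (Measure.measurable_coe (hcm a)) measurable_const

end Configurations

/-! ### Atoms of uniformly discrete point measures -/

section Atoms

variable {d m : ℕ} {r : ℝ} {lam : Measure (ColPt d m)}

lemma IsPointMeasure.measure_colBox_lt_top (h : IsPointMeasure lam) (N : ℕ) :
    lam (colBox d m N) < ⊤ := by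
  obtain ⟨k, hk⟩ := h _ (measurableSet_colBox d m N)
    (isCompact_closure_of_subset_colBox subset_rfl)
  rw [hk]
  exact ENNReal.natCast_lt_top k

/-- A point measure vanishes on bounded sets that contain no atoms. -/
lemma IsPointMeasure.measure_eq_zero (h : IsPointMeasure lam) {N : ℕ} {A : Set (ColPt d m)}
    (hA : MeasurableSet A) (hAN : A ⊆ colBox d m N) (h0 : ∀ p ∈ A, lam {p} = 0) : lam A = 0 := by
  refine measure_null_of_locally_null A fun p hp => ?_
  -- The masses of neighbourhoods of `p` in `A` decrease to `lam {p} = 0`; being integers, they are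
  -- eventually 0, so `A` is locally null.
  obtain ⟨u, hub⟩ := (𝓝 p).exists_antitone_basis
  set v : ℕ → Set (ColPt d m) := fun n => interior (u n) ∩ A with hv
  have hvm : ∀ n, MeasurableSet (v n) := fun n => isOpen_interior.measurableSet.inter hA
  have hanti : Antitone v := fun a b hab =>
    Set.inter_subset_inter_left _ (interior_mono (hub.antitone hab))
  have hInter : ⋂ n, v n = {p} := by
    ext q
    simp only [Set.mem_iInter, Set.mem_singleton_iff, hv, Set.mem_inter_iff]
    constructor
    · intro hq
      by_contra hne
      obtain ⟨n, hn⟩ := hub.mem_iff.1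
        (isOpen_compl_singleton.mem_nhds (Ne.symm hne) : {q}ᶜ ∈ 𝓝 p)
      exact hn (interior_subset (hq n).1) rfl
    · rintro rfl n
      exact ⟨mem_interior_iff_mem_nhds.2 (hub.mem n), hp⟩
  have hfin : ∀ n, lam (v n) ≠ ⊤ := fun n =>
    ((measure_mono (Set.inter_subset_right.trans hAN)).trans_lt (h.measure_colBox_lt_top N)).ne
  have ht := tendsto_measure_iInter_atTop (μ := lam) (fun n => (hvm n).nullMeasurableSet) hanti
    ⟨0, hfin 0⟩
  rw [hInter, h0 p hp] at ht
  obtain ⟨n, hn⟩ := (ht.eventually_lt_const one_pos).exists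
  refine ⟨v n, ?_, ?_⟩
  · rw [hv, mem_nhdsWithin_iff_exists_mem_nhds_inter]
    exact ⟨interior (u n), interior_mem_nhds.2 (hub.mem n), subset_rfl⟩
  · obtain ⟨k, hk⟩ := h (v n) (hvm n)
      (isCompact_closure_of_subset_colBox (Set.inter_subset_right.trans hAN))
    rw [Function.comp_apply, hk] at hn
    have : k < 1 := by exact_mod_cast hn
    rw [hk, Nat.lt_one_iff.1 this]
    simp

lemma IsPointMeasure.measure_singleton (h : IsPointMeasure lam) (p : ColPt d m) :
    ∃ k : ℕ, lam {p} = k := by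
  refine h {p} (measurableSet_singleton p) ?_
  rw [closure_singleton]
  exact isCompact_singleton

/-- Two atoms that are close to each other coincide. -/
lemma atom_unique (hl : lam ∈ uniformlyDiscrete d m r) {p q : ColPt d m} (hp : lam {p} ≠ 0)
    (hq : lam {q} ≠ 0) (hr : 0 < r) (hpq : q.1 - p.1 ∈ cube d r) : p = q := by
  by_contra hne
  have h1 : ∀ p : ColPt d m, lam {p} ≠ 0 → 1 ≤ lam {p} := by
    intro p hp
    obtain ⟨k, hk⟩ := hl.1.measure_singleton p
    rw [hk] at hp ⊢
    have : k ≠ 0 := by simpa using hp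
    exact_mod_cast Nat.one_le_iff_ne_zero.2 this
  have h2 : lam {p, q} ≤ 1 := by
    refine (measure_mono fun x hx => ?_).trans (hl.2 p.1)
    rcases hx with rfl | rfl
    · intro k; simpa using hr
    · exact hpq
  have h3 : lam {p, q} = lam {p} + lam {q} := by
    rw [← Set.singleton_union, measure_union (by simpa using hne) (measurableSet_singleton q)]
  have h4 : (1 : ENNReal) + 1 ≤ 1 := by
    rw [h3] at h2
    exact (add_le_add (h1 p hp) (h1 q hq)).trans h2
  norm_num at h4

lemma measureReal_singleton_eq (hl : lam ∈ uniformlyDiscrete d m r) (hr : 0 < r)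
    (p : ColPt d m) : lam.real {p} = if lam {p} = 0 then 0 else 1 := by
  split_ifs with h
  · simp [measureReal_def, h]
  · obtain ⟨k, hk⟩ := hl.1.measure_singleton p
    have h1 : lam {p} ≤ 1 := (measure_mono fun x hx => by
      rw [Set.mem_singleton_iff.1 hx]; intro k; simpa using hr).trans (hl.2 p.1)
    rw [hk] at h h1
    have h2 : k ≤ 1 := by exact_mod_cast h1
    have h3 : k ≠ 0 := by simpa using h
    rw [measureReal_def, hk, show k = 1 by omega]
    simp

/-- At an atom of colour `i` the weight is `w i`. -/
lemma weightAt_of_atom (hl : lam ∈ uniformlyDiscrete d m r) (hr : 0 < r) (w : Fin m → ℝ)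
    {x : Pos d} {i : Fin m} (h : lam {(x, i)} ≠ 0) : weightAt w lam x = w i := by
  rw [weightAt, Finset.sum_eq_single i]
  · rw [measureReal_singleton_eq hl hr, if_neg h, mul_one]
  · intro j _ hji
    rw [measureReal_singleton_eq hl hr, if_pos, mul_zero]
    by_contra hcon
    have := atom_unique hl h hcon hr (fun k => by simpa using hr)
    exact hji (congrArg Prod.snd this).symm
  · simp

lemma weightAt_of_no_atom (w : Fin m → ℝ) {x : Pos d} (h : ∀ i, lam {(x, i)} = 0) :
    weightAt w lam x = 0 :=
  Finset.sum_eq_zero fun i _ => by simp [measureReal_def, h i]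

lemma exists_atom_of_weightAt_ne_zero {w : Fin m → ℝ} {x : Pos d} (h : weightAt w lam x ≠ 0) :
    ∃ i, lam {(x, i)} ≠ 0 := by
  by_contra hcon
  push Not at hcon
  exact h (weightAt_of_no_atom w hcon)

lemma eq_of_weightAt_ne_zero (hl : lam ∈ uniformlyDiscrete d m r) (hr : 0 < r) {w : Fin m → ℝ}
    {x y : Pos d} (hx : weightAt w lam x ≠ 0) (hy : weightAt w lam y ≠ 0)
    (hxy : y - x ∈ cube d r) : x = y := by
  obtain ⟨i, hi⟩ := exists_atom_of_weightAt_ne_zero hx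
  obtain ⟨j, hj⟩ := exists_atom_of_weightAt_ne_zero hy
  exact congrArg Prod.fst (atom_unique hl hi hj hr hxy)

/-- A bound for the number of points of an `r`-uniformly discrete set in a unit cell. -/
noncomputable def cellBound (d : ℕ) (r : ℝ) : ℕ := (⌈2 / r⌉₊) ^ d

/-- Weights of uniformly discrete point measures are sparse. -/
theorem sparse_weightAt (hl : lam ∈ uniformlyDiscrete d m r) (hr : 0 < r) (w : Fin m → ℝ) :
    Sparse (weightAt w lam) (∑ i, |w i|) (cellBound d r) where
  abs_le x := by
    refine (Finset.abs_sum_le_sum_abs _ _).trans (Finset.sum_le_sum fun i _ => ?_)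
    rw [abs_mul]
    refine mul_le_of_le_one_right (abs_nonneg _) ?_
    rw [measureReal_singleton_eq hl hr]
    split_ifs <;> simp
  encard_le k := by
    set M := ⌈2 / r⌉₊ with hM
    have hMpos : 0 < M := Nat.ceil_pos.2 (by positivity)
    have hMr : 2 ≤ M * r := by
      have := Nat.le_ceil (2 / r)
      rw [div_le_iff₀ hr] at this
      exact this
    have hM0 : (0 : ℝ) < M := by exact_mod_cast hMpos
    -- The unit cell is cut into `M ^ d` subcells of edge `1 / M ≤ r / 2`, the half-edge of `C_r`,
    -- so each subcell holds at most one point.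
    set φ : Pos d → Fin d → ℤ := fun x j => ⌊(M : ℝ) * x j⌋ with hφ
    have hinj : Set.InjOn φ {x | weightAt w lam x ≠ 0 ∧ cellIndex x = k} := by
      intro x hx y hy hxy
      refine eq_of_weightAt_ne_zero hl hr hx.1 hy.1 fun j => ?_
      have h1 := Int.abs_sub_lt_one_of_floor_eq_floor (congrFun hxy j).symm
      rw [← mul_sub, abs_mul, abs_of_pos hM0] at h1
      rw [PiLp.sub_apply]
      nlinarith [abs_nonneg (y j - x j)]
    rw [← hinj.encard_image]
    have hsub : φ '' {x | weightAt w lam x ≠ 0 ∧ cellIndex x = k} ⊆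
        (Fintype.piFinset fun j => Finset.Ico (M * k j) (M * k j + M) : Finset (Fin d → ℤ)) := by
      rintro _ ⟨x, ⟨-, rfl⟩, rfl⟩
      simp only [Finset.mem_coe, Fintype.mem_piFinset, Finset.mem_Ico, hφ, cellIndex]
      intro j
      have h1 := Int.floor_le (x j)
      have h2 := Int.lt_floor_add_one (x j)
      constructor
      · rw [Int.le_floor]; push_cast; nlinarith
      · rw [Int.floor_lt]; push_cast; nlinarith
    refine (Set.encard_le_encard hsub).trans_eq ?_
    rw [Set.encard_coe_eq_coe_finsetCard, Fintype.card_piFinset]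
    simp [cellBound, hM]

/-- The mass of a bounded set is the sum of the masses of its atoms. -/
lemma measureReal_eq_sum (hl : lam ∈ uniformlyDiscrete d m r) {N : ℕ} {A : Set (Pos d)}
    (hA : MeasurableSet A) (hAN : A ⊆ box d N) (i : Fin m) (P : Finset (Pos d))
    (hP : ∀ x ∈ A, lam {(x, i)} ≠ 0 → x ∈ P) (hPA : ∀ x ∈ P, x ∈ A) :
    lam.real (A ×ˢ {i}) = ∑ x ∈ P, lam.real {(x, i)} := by
  classical
  have hAm : MeasurableSet (A ×ˢ ({i} : Set (Fin m))) := hA.prod (measurableSet_singleton i)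
  set Q : Finset (ColPt d m) := P.image fun x => (x, i) with hQ
  have hAN' : A ×ˢ ({i} : Set (Fin m)) ⊆ colBox d m N := fun p hp => hAN hp.1
  have hz : lam ((A ×ˢ {i}) \ (Q : Set (ColPt d m))) = 0 := by
    refine hl.1.measure_eq_zero (hAm.diff Q.measurableSet) (Set.sdiff_subset.trans hAN') ?_
    rintro ⟨x, j⟩ ⟨⟨hx, hj⟩, hxQ⟩
    obtain rfl : j = i := hj
    by_contra hcon
    exact hxQ (Finset.mem_coe.2 (Finset.mem_image.2 ⟨x, hP x hx hcon, rfl⟩))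
  have hsub : (Q : Set (ColPt d m)) ⊆ A ×ˢ ({i} : Set (Fin m)) := by
    intro p hp
    obtain ⟨x, hx, rfl⟩ := Finset.mem_image.1 (Finset.mem_coe.1 hp)
    exact ⟨hPA x hx, rfl⟩
  have hfin : ∀ s : Set (ColPt d m), s ⊆ A ×ˢ ({i} : Set (Fin m)) → lam s ≠ ⊤ := fun s hs =>
    ((measure_mono (hs.trans hAN')).trans_lt (hl.1.measure_colBox_lt_top N)).ne
  have h1 : lam (A ×ˢ {i}) = lam (Q : Set (ColPt d m)) := by
    rw [← measure_inter_add_sdiff _ Q.measurableSet, hz, add_zero, Set.inter_eq_right.2 hsub]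
  rw [measureReal_def, h1, ← sum_measure_singleton, ENNReal.toReal_sum, hQ, Finset.sum_image]
  · rfl
  · intro x _ y _ hxy; exact congrArg Prod.fst hxy
  · intro p hp; exact hfin _ (Set.singleton_subset_iff.2 (hsub (Finset.mem_coe.2 hp)))

/-! #### Measurability of multiple sums -/

/-- The cell of edge length `1 / l` with index `k`. -/
def fineCell (l : ℕ) (k : Fin d → ℤ) : Set (Pos d) := {x | ∀ j, ⌊(l : ℝ) * x j⌋ = k j}

lemma measurableSet_fineCell (l : ℕ) (k : Fin d → ℤ) : MeasurableSet (fineCell l k) := by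
  have : fineCell l k = ⋂ j, {x : Pos d | ⌊(l : ℝ) * x j⌋ = k j} := by ext x; simp [fineCell]
  rw [this]
  refine MeasurableSet.iInter fun j => ?_
  have hm : Measurable fun x : Pos d => ⌊(l : ℝ) * x j⌋ :=
    Int.measurable_floor.comp (by fun_prop)
  exact hm (measurableSet_singleton (k j))

/-- The corner of the cell with index `k`. -/
noncomputable def fineCorner (l : ℕ) (k : Fin d → ℤ) : Pos d := WithLp.toLp 2 fun j => (k j : ℝ) / l

lemma tendsto_fineCorner (x : Pos d) :
    Tendsto (fun l : ℕ => fineCorner l fun j => ⌊(l : ℝ) * x j⌋) atTop (𝓝 x) := by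
  have h : Tendsto (fun l : ℕ => fun j => (⌊(l : ℝ) * x j⌋ : ℝ) / l) atTop (𝓝 fun j => x j) := by
    rw [tendsto_pi_nhds]
    intro j
    have h1 : Tendsto (fun l : ℕ => x j - 1 / (l : ℝ)) atTop (𝓝 (x j)) := by
      simpa using (tendsto_one_div_atTop_nhds_zero_nat (𝕜 := ℝ)).const_sub (x j)
    refine tendsto_of_tendsto_of_tendsto_of_le_of_le' h1 tendsto_const_nhds ?_ ?_
    all_goals
      filter_upwards [eventually_ge_atTop 1] with l hl
      have hl0 : (0 : ℝ) < l := by exact_mod_cast hl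
    · rw [le_div_iff₀ hl0, sub_mul, one_div, inv_mul_cancel₀ hl0.ne']
      linarith [Int.lt_floor_add_one ((l : ℝ) * x j)]
    · rw [div_le_iff₀ hl0]
      linarith [Int.floor_le ((l : ℝ) * x j)]
  exact ((PiLp.continuous_toLp 2 _).tendsto _).comp h

/-- The weight of the cell with index `k`. -/
noncomputable def cellWeight (w : Fin m → ℝ) (l : ℕ) (k : Fin d → ℤ) (lam : Measure (ColPt d m)) :
    ℝ := ∑ i, w i * lam.real (fineCell l k ×ˢ {i})

lemma measurable_cellWeight (w : Fin m → ℝ) (l : ℕ) (k : Fin d → ℤ) :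
    Measurable (cellWeight w l k) :=
  Finset.measurable_sum _ fun i _ => (Measure.measurable_coe
    ((measurableSet_fineCell l k).prod (measurableSet_singleton i))).ennreal_toReal.const_mul _

open Classical in
lemma cellWeight_eq_sum (hl : lam ∈ uniformlyDiscrete d m r) (hr : 0 < r) {w : Fin m → ℝ}
    (hw0 : ∀ i, w i ≠ 0) (l : ℕ) (k : Fin d → ℤ) {N : ℕ} (hN : fineCell l k ⊆ box d N) :
    cellWeight w l k lam =
      ∑ x ∈ (sparse_weightAt hl hr w).points (latticeBox d N) with
        (fun j => ⌊(l : ℝ) * x j⌋) = k, weightAt w lam x := by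
  simp only [weightAt]
  rw [Finset.sum_comm, cellWeight]
  refine Finset.sum_congr rfl fun i _ => ?_
  rw [measureReal_eq_sum hl (measurableSet_fineCell l k) hN, Finset.mul_sum]
  · intro x hx hxi
    rw [Finset.mem_filter, Sparse.mem_points, cellIndex_mem_latticeBox, weightAt_of_atom hl hr w hxi]
    exact ⟨⟨hw0 i, hN hx⟩, funext hx⟩
  · intro x hx
    rw [Finset.mem_filter] at hx
    exact fun j => congrFun hx.2 j

/-- Moving every point to the corner of its cell of edge `1 / l` turns the sum into a polynomial in
the masses of finitely many cells, which is measurable in `lam`. As `l → ∞` it converges at each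
uniformly discrete `lam`, by continuity of `G`. Nonzero weights ensure that every atom is visible in
the support of `weightAt w lam`. -/
theorem measurable_indicator_multiSum {ι : Type*} [Fintype ι] (hr : 0 < r) {w : Fin m → ℝ}
    (hw0 : ∀ i, w i ≠ 0) {G : (ι → Pos d) → ℂ} (hGc : Continuous G) (hG : BoundedSupport G) :
    Measurable ((uniformlyDiscrete d m r).indicator fun lam => multiSum (weightAt w lam) G) := by
  classical
  obtain ⟨L, hL⟩ := hG
  set Ψ : ℕ → Measure (ColPt d m) → ℂ := fun l lam =>
    ∑ z ∈ Fintype.piFinset fun _ : ι => latticeBox d (l * L),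
      (∏ j, (cellWeight w l (z j) lam : ℂ)) * G fun j => fineCorner l (z j) with hΨ
  have hΨm : ∀ l, Measurable (Ψ l) := fun l =>
    Finset.measurable_sum _ fun z _ => Measurable.mul_const (Finset.measurable_prod _ fun j _ =>
      Complex.measurable_ofReal.comp (measurable_cellWeight w l (z j))) _
  refine measurable_of_tendsto_metrizable
    (fun l => (hΨm l).indicator (measurableSet_uniformlyDiscrete d m r)) ?_
  rw [tendsto_pi_nhds]
  intro lam
  by_cases hl : lam ∈ uniformlyDiscrete d m r
  swap
  · simp only [Set.indicator_of_notMem hl]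
    exact tendsto_const_nhds
  simp only [Set.indicator_of_mem hl]
  have hs := sparse_weightAt hl hr w
  set W := weightAt w lam with hW
  rw [hs.multiSum_eq_sum hL]
  set P := hs.points (latticeBox d L) with hP
  have hlim : Tendsto (fun l : ℕ => ∑ y ∈ Fintype.piFinset fun _ : ι => P,
      (∏ j, (W (y j) : ℂ)) * G fun j => fineCorner l fun a => ⌊(l : ℝ) * y j a⌋) atTop
      (𝓝 (∑ y ∈ Fintype.piFinset fun _ : ι => P, (∏ j, (W (y j) : ℂ)) * G y)) := by
    refine tendsto_finsetSum _ fun y _ => Tendsto.const_mul _ ?_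
    exact (hGc.tendsto y).comp (tendsto_pi_nhds.2 fun j => tendsto_fineCorner (y j))
  refine hlim.congr' ?_
  filter_upwards [eventually_ge_atTop 1] with l hl1
  have hl0 : (0 : ℝ) < l := by exact_mod_cast hl1
  have hcell : ∀ k ∈ latticeBox d (l * L), fineCell l k ⊆ box d L := by
    intro k hk x hx j
    simp only [latticeBox, Fintype.mem_piFinset, Finset.mem_Ico] at hk
    have h1 := hk j
    rw [← hx j, Int.le_floor, Int.floor_lt] at h1
    push_cast at h1
    constructor
    · nlinarith [h1.1]
    · nlinarith [h1.2]
  have hmaps : ∀ y ∈ Fintype.piFinset fun _ : ι => P,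
      (fun (j : ι) (a : Fin d) => ⌊(l : ℝ) * y j a⌋) ∈
        Fintype.piFinset fun _ : ι => latticeBox d (l * L) := by
    intro y hy
    refine Fintype.mem_piFinset.2 fun j => ?_
    have h1 := cellIndex_mem_latticeBox.1 (hs.mem_points.1 (Fintype.mem_piFinset.1 hy j)).2
    simp only [latticeBox, Fintype.mem_piFinset, Finset.mem_Ico]
    intro a
    have h2 := h1 a
    rw [Int.le_floor, Int.floor_lt]
    push_cast
    constructor
    · nlinarith [h2.1]
    · nlinarith [h2.2]
  rw [hΨ, ← Finset.sum_fiberwise_of_maps_to hmaps]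
  refine Finset.sum_congr rfl fun z hz => ?_
  -- Expanding the product of cell weights gives all tuples with the prescribed cells, including
  -- several points in one cell, so the regrouping is exact at every scale `l ≥ 1`.
  have hprod : ∏ j, (cellWeight w l (z j) lam : ℂ) =
      ∑ y ∈ Fintype.piFinset fun _ : ι => P with (fun j a => ⌊(l : ℝ) * y j a⌋) = z,
        ∏ j, (W (y j) : ℂ) := by
    have : ∀ j, (cellWeight w l (z j) lam : ℂ) =
        ∑ x ∈ P with (fun a => ⌊(l : ℝ) * x a⌋) = z j, (W x : ℂ) := by
      intro j
      rw [cellWeight_eq_sum hl hr hw0 l (z j) (hcell _ (Fintype.mem_piFinset.1 hz j))]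
      push_cast
      rfl
    simp only [this]
    rw [Finset.prod_univ_sum]
    refine Finset.sum_congr ?_ fun _ _ => rfl
    ext y
    simp only [Fintype.mem_piFinset, Finset.mem_filter, forall_and, funext_iff]
  rw [hprod, Finset.sum_mul]
  refine Finset.sum_congr rfl fun y hy => ?_
  rw [← (Finset.mem_filter.1 hy).2]

end Atoms

/-! ### Existence of the correlations -/

section Existence

variable {d m : ℕ} {r : ℝ} {μ : Measure (Measure (ColPt d m))}

/-- Averages of `F` over the integer translations in `[-N, N)^d`. -/
noncomputable def shiftAverage (F : Measure (ColPt d m) → ℝ) (N : ℕ) (lam : Measure (ColPt d m)) :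
    ℝ := (∑ k ∈ latticeBox d N, F (shiftMeasure (-latticeVec k) lam)) / (2 * N) ^ d

lemma measurable_shiftAverage {F : Measure (ColPt d m) → ℝ} (hF : Measurable F) (N : ℕ) :
    Measurable (shiftAverage F N) :=
  (Finset.measurable_sum _ fun _ _ => hF.comp (measurable_shiftMeasure _)).div_const _

lemma abs_shiftAverage_le {F : Measure (ColPt d m) → ℝ} {B : ℝ} (hB : ∀ lam, |F lam| ≤ B) (N : ℕ)
    (lam : Measure (ColPt d m)) : |shiftAverage F N lam| ≤ B := by
  rw [shiftAverage, abs_div, abs_of_nonneg (by positivity : (0 : ℝ) ≤ (2 * N) ^ d)]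
  refine div_le_of_le_mul₀ (by positivity) ((abs_nonneg _).trans (hB lam)) ?_
  refine (Finset.abs_sum_le_sum_abs _ _).trans ?_
  refine (Finset.sum_le_card_nsmul _ _ B fun k _ => hB _).trans ?_
  rw [card_latticeBox, nsmul_eq_mul, mul_comm]
  push_cast
  exact le_rfl

lemma IsProcess.integral_shiftMeasure {E : Type*} [NormedAddCommGroup E] [NormedSpace ℝ E]
    (hμ : IsProcess μ) (t : Pos d) {F : Measure (ColPt d m) → E} (hF : AEStronglyMeasurable F μ) :
    ∫ lam, F (shiftMeasure t lam) ∂μ = ∫ lam, F lam ∂μ := by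
  have h := hμ.stationary t
  rw [← integral_map h.measurable.aemeasurable (by rwa [h.map_eq]), h.map_eq]

/-- The ergodic theorem for functions whose averages are asymptotically translation invariant. -/
theorem IsProcess.ae_tendsto_shiftAverage (hμ : IsProcess μ)
    (hU : ∀ᵐ lam ∂μ, lam ∈ uniformlyDiscrete d m r) {F : Measure (ColPt d m) → ℝ}
    (hF : Measurable F) {B : ℝ} (hB : ∀ lam, |F lam| ≤ B)
    (hinv : ∀ lam ∈ uniformlyDiscrete d m r, ∀ t,
      Tendsto (fun N => shiftAverage F N (shiftMeasure t lam) - shiftAverage F N lam)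
        atTop (𝓝 0)) :
    ∀ᵐ lam ∂μ, Tendsto (fun N => shiftAverage F N lam) atTop (𝓝 (∫ lam, F lam ∂μ)) := by
  have := hμ.prob
  -- The limit `F₀` need not be constant at this point: the integer translations alone may fail to
  -- be ergodic.
  obtain ⟨F₀, -, hF₀⟩ := exists_ae_tendsto_average_latticeBox (μ := μ) d
    (fun k => shiftMeasure (-latticeVec k)) (fun k => hμ.stationary _)
    (fun lam => by rw [latticeVec_zero, neg_zero, shiftMeasure_zero])
    (fun k l lam => by rw [latticeVec_add, neg_add, shiftMeasure_add]) hF hB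
  -- Ergodicity is stated for strictly invariant measurable sets. The limit on `C`, extended by 0,
  -- is a strictly invariant measurable function.
  set C : Set (Measure (ColPt d m)) := uniformlyDiscrete d m r ∩
    {lam | ∃ c, Tendsto (fun N => shiftAverage F N lam) atTop (𝓝 c)} with hC
  have hCm : MeasurableSet C := (measurableSet_uniformlyDiscrete d m r).inter
    (measurableSet_exists_tendsto fun N => measurable_shiftAverage hF N)
  set l : Measure (ColPt d m) → ℝ := C.indicator fun lam =>
    limUnder atTop fun N => shiftAverage F N lam with hl
  have hlim : ∀ lam ∈ C, Tendsto (fun N => shiftAverage F N lam) atTop (𝓝 (l lam)) := by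
    intro lam hlam
    rw [hl, Set.indicator_of_mem hlam]
    exact tendsto_nhds_limUnder hlam.2
  have hlm : Measurable l := by
    refine measurable_of_tendsto_metrizable
      (fun N => (measurable_shiftAverage hF N).indicator hCm) (tendsto_pi_nhds.2 fun lam => ?_)
    by_cases hlam : lam ∈ C
    · simpa only [Set.indicator_of_mem hlam] using hlim lam hlam
    · rw [hl]
      simp only [Set.indicator_of_notMem hlam]
      exact tendsto_const_nhds
  have htrans : ∀ t, ∀ lam ∈ uniformlyDiscrete d m r, ∀ c,
      Tendsto (fun N => shiftAverage F N lam) atTop (𝓝 c) →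
      Tendsto (fun N => shiftAverage F N (shiftMeasure t lam)) atTop (𝓝 c) := by
    intro t lam hlam c hc
    simpa using (hinv lam hlam t).add hc
  have hCt : ∀ t, ∀ lam ∈ C, shiftMeasure t lam ∈ C := fun t lam hlam =>
    ⟨shiftMeasure_mem_uniformlyDiscrete hlam.1 t, l lam, htrans t lam hlam.1 _ (hlim lam hlam)⟩
  have hinvl : ∀ t lam, l (shiftMeasure t lam) = l lam := by
    intro t lam
    by_cases hlam : lam ∈ C
    · exact tendsto_nhds_unique (hlim _ (hCt t lam hlam)) (htrans t lam hlam.1 _ (hlim lam hlam))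
    · have : shiftMeasure t lam ∉ C := by
        intro h
        have := hCt (-t) _ h
        rw [← shiftMeasure_add, neg_add_cancel, shiftMeasure_zero] at this
        exact hlam this
      rw [hl, Set.indicator_of_notMem hlam, Set.indicator_of_notMem this]
  obtain ⟨c, hc⟩ : ∃ c, l =ᵐ[μ] Function.const _ c := by
    refine exists_eventuallyEq_const_of_forall_separating MeasurableSet fun S hS => ?_
    rcases hμ.ergodic (l ⁻¹' S) (hlm hS) (fun t => by ext lam; simp [hinvl]) with h | h
    · exact Or.inr (measure_eq_zero_iff_ae_notMem.1 h)
    · exact Or.inl ((mem_ae_iff_prob_eq_one (hlm hS)).2 h)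
  have hae : ∀ᵐ lam ∂μ, Tendsto (fun N => shiftAverage F N lam) atTop (𝓝 c) := by
    filter_upwards [hU, hF₀, hc] with lam h1 h2 h3
    have := hlim lam ⟨h1, F₀ lam, h2⟩
    rwa [h3] at this
  have hInt : Tendsto (fun N => ∫ lam, shiftAverage F N lam ∂μ) atTop (𝓝 (∫ _, c ∂μ)) :=
    tendsto_integral_of_dominated_convergence (fun _ => B)
      (fun N => (measurable_shiftAverage hF N).aestronglyMeasurable) (integrable_const _)
      (fun N => Eventually.of_forall fun lam => abs_shiftAverage_le hB N lam) hae
  have hFi : Integrable F μ :=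
    Integrable.of_bound hF.aestronglyMeasurable B (Eventually.of_forall hB)
  have hconst : ∀ᶠ N : ℕ in atTop, ∫ lam, F lam ∂μ = ∫ lam, shiftAverage F N lam ∂μ := by
    filter_upwards [eventually_ge_atTop 1] with N hN
    have hsi : ∀ k : Fin d → ℤ, Integrable (fun lam => F (shiftMeasure (-latticeVec k) lam)) μ :=
      fun k => (hμ.stationary _).integrable_comp_of_integrable hFi
    simp only [shiftAverage]
    rw [integral_div, integral_finsetSum _ fun k _ => hsi k]
    simp only [hμ.integral_shiftMeasure _ hF.aestronglyMeasurable, Finset.sum_const,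
      card_latticeBox, nsmul_eq_mul]
    have : ((2 : ℝ) * N) ^ d ≠ 0 := by positivity
    push_cast
    field_simp
  -- By stationarity every average has the mean of `F`, and dominated convergence passes this mean
  -- to the constant limit.
  have heq : ∫ lam, F lam ∂μ = c := by
    have := tendsto_nhds_unique (tendsto_const_nhds.congr' hconst) hInt
    simpa using this
  rwa [heq]

/-! #### Functions of bounded support -/

lemma BoundedSupport.hasCompactSupport {ι : Type*} {G : (ι → Pos d) → ℂ}
    (hG : BoundedSupport G) : HasCompactSupport G := by
  obtain ⟨L, hL⟩ := hG
  refine HasCompactSupport.of_support_subset_isCompact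
    (isCompact_univ_pi fun _ : ι => (isBounded_box d L).isCompact_closure) fun y hy j _ => ?_
  exact subset_closure (hL y hy j)

lemma exists_box_of_isCompact {ι : Type*} [Finite ι] {K : Set (ι → Pos d)} (hK : IsCompact K) :
    ∃ L : ℕ, ∀ y ∈ K, ∀ j, y j ∈ box d L := by
  have : ∀ j, ∃ L : ℕ, ∀ y ∈ K, y j ∈ box d L := by
    intro j
    obtain ⟨L, hL⟩ := exists_subset_box (hK.image (continuous_apply j)).isBounded
    exact ⟨L, fun y hy => hL (Set.mem_image_of_mem _ hy)⟩
  choose L hL using this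
  cases nonempty_fintype ι
  exact ⟨∑ j, L j, fun y hy j =>
    box_mono (Finset.single_le_sum (fun _ _ => Nat.zero_le _) (Finset.mem_univ j)) (hL j y hy)⟩

lemma boundedSupport_of_hasCompactSupport {ι : Type*} [Finite ι] {G : (ι → Pos d) → ℂ}
    (hG : HasCompactSupport G) : BoundedSupport G := by
  obtain ⟨L, hL⟩ := exists_box_of_isCompact hG.isCompact
  exact ⟨L, fun y hy => hL y (subset_tsupport _ hy)⟩

lemma BoundedSupport.exists_norm_le {ι : Type*} {G : (ι → Pos d) → ℂ} (hG : BoundedSupport G)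
    (hGc : Continuous G) : ∃ B, ∀ y, ‖G y‖ ≤ B :=
  hG.hasCompactSupport.exists_bound_of_continuous hGc

lemma exists_norm_indicator_multiSum_le {ι : Type*} [Fintype ι] (hr : 0 < r) (w : Fin m → ℝ)
    {G : (ι → Pos d) → ℂ} (hGc : Continuous G) (hG : BoundedSupport G) :
    ∃ B, ∀ lam, ‖(uniformlyDiscrete d m r).indicator
      (fun lam => multiSum (weightAt w lam) G) lam‖ ≤ B := by
  obtain ⟨B, hB⟩ := hG.exists_norm_le hGc
  obtain ⟨L, hL⟩ := hG
  refine ⟨((cellBound d r * (2 * L) ^ d : ℕ) : ℝ) ^ Fintype.card ι *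
    ((∑ i, |w i|) ^ Fintype.card ι * B), fun lam => ?_⟩
  have hB0 : 0 ≤ B := (norm_nonneg _).trans (hB fun _ => 0)
  by_cases hl : lam ∈ uniformlyDiscrete d m r
  · rw [Set.indicator_of_mem hl]
    exact (sparse_weightAt hl hr w).norm_multiSum_le hL hB
  · rw [Set.indicator_of_notMem hl, norm_zero]
    positivity

lemma indicator_ae_eq (hU : ∀ᵐ lam ∂μ, lam ∈ uniformlyDiscrete d m r)
    (F : Measure (ColPt d m) → ℂ) : (uniformlyDiscrete d m r).indicator F =ᵐ[μ] F :=
  hU.mono fun _ hl => Set.indicator_of_mem hl F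

lemma IsProcess.integrable_multiSum {ι : Type*} [Fintype ι] (hμ : IsProcess μ) {w : Fin m → ℝ}
    (hw0 : ∀ i, w i ≠ 0) {G : (ι → Pos d) → ℂ} (hGc : Continuous G) (hG : BoundedSupport G) :
    Integrable (fun lam => multiSum (weightAt w lam) G) μ := by
  have := hμ.prob
  obtain ⟨r, hr, hU⟩ := hμ.unifDiscrete
  obtain ⟨B, hB⟩ := exists_norm_indicator_multiSum_le (m := m) hr w hGc hG
  exact (Integrable.of_bound (measurable_indicator_multiSum hr hw0 hGc hG).aestronglyMeasurable B
    (Eventually.of_forall hB)).congr (indicator_ae_eq hU _)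

lemma continuous_diffFun {n : ℕ} {f : (Fin n → Pos d) → ℂ} (hf : Continuous f) :
    Continuous (diffFun f tent) := by
  have := continuous_tent (d := d)
  unfold diffFun
  fun_prop

lemma boundedSupport_diffFun_tent {n : ℕ} {f : (Fin n → Pos d) → ℂ} (hf : BoundedSupport f) :
    BoundedSupport (diffFun f tent) :=
  boundedSupport_diffFun hf fun _ hx => mem_box_of_tent_ne_zero hx

/-- Box averages converge almost surely to the mean of the tent sums. -/
theorem IsProcess.ae_tendsto_tentAverage (hμ : IsProcess μ) {w : Fin m → ℝ}
    (hw0 : ∀ i, w i ≠ 0) {n : ℕ} {f : (Fin n → Pos d) → ℂ} (hfc : Continuous f)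
    (hf : BoundedSupport f) :
    ∀ᵐ lam ∂μ, Tendsto (tentAverage (weightAt w lam) f) atTop
      (𝓝 (∫ lam, multiSum (weightAt w lam) (diffFun f tent) ∂μ)) := by
  have := hμ.prob
  obtain ⟨r, hr, hU⟩ := hμ.unifDiscrete
  set F : Measure (ColPt d m) → ℂ := (uniformlyDiscrete d m r).indicator fun lam =>
    multiSum (weightAt w lam) (diffFun f tent) with hF
  have hFm : Measurable F := measurable_indicator_multiSum hr hw0 (continuous_diffFun hfc)
    (boundedSupport_diffFun_tent hf)
  obtain ⟨B, hB⟩ := exists_norm_indicator_multiSum_le (m := m) hr w (continuous_diffFun hfc)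
    (boundedSupport_diffFun_tent hf)
  obtain ⟨Bf, hBf⟩ := hf.exists_norm_le hfc
  have hFi : Integrable F μ :=
    Integrable.of_bound hFm.aestronglyMeasurable B (Eventually.of_forall hB)
  have havg : ∀ lam ∈ uniformlyDiscrete d m r, ∀ N : ℕ, tentAverage (weightAt w lam) f N =
      (∑ k ∈ latticeBox d N, F (shiftMeasure (-latticeVec k) lam)) / (2 * N) ^ d := by
    intro lam hl N
    rw [tentAverage, (sparse_weightAt hl hr w).multiSum_tentSum hf]
    congr 1
    refine Finset.sum_congr rfl fun k _ => ?_
    rw [hF, Set.indicator_of_mem (shiftMeasure_mem_uniformlyDiscrete hl _), weightAt_shiftMeasure]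
    simp only [sub_neg_eq_add]
  have hcast : ∀ N : ℕ, ((2 : ℂ) * N) ^ d = (((2 * N) ^ d : ℝ) : ℂ) := fun N => by push_cast; rfl
  have hre : ∀ lam ∈ uniformlyDiscrete d m r, ∀ N : ℕ,
      shiftAverage (fun lam => (F lam).re) N lam = (tentAverage (weightAt w lam) f N).re := by
    intro lam hl N
    rw [havg lam hl N, shiftAverage, hcast, Complex.div_ofReal_re, Complex.re_sum]
  have him : ∀ lam ∈ uniformlyDiscrete d m r, ∀ N : ℕ,
      shiftAverage (fun lam => (F lam).im) N lam = (tentAverage (weightAt w lam) f N).im := by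
    intro lam hl N
    rw [havg lam hl N, shiftAverage, hcast, Complex.div_ofReal_im, Complex.im_sum]
  have htr : ∀ lam ∈ uniformlyDiscrete d m r, ∀ t, Tendsto (fun N =>
      tentAverage (weightAt w (shiftMeasure t lam)) f N - tentAverage (weightAt w lam) f N)
      atTop (𝓝 0) := by
    intro lam hl t
    rw [weightAt_shiftMeasure]
    exact (sparse_weightAt hl hr w).tendsto_tentAverage_translate hf hBf t
  have h1 := hμ.ae_tendsto_shiftAverage hU (F := fun lam => (F lam).re)
    (Complex.measurable_re.comp hFm) (B := B)
    (fun lam => (Complex.abs_re_le_norm _).trans (hB lam)) (fun lam hl t => by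
      simp only [hre _ hl, hre _ (shiftMeasure_mem_uniformlyDiscrete hl t)]
      have := (Complex.continuous_re.tendsto _).comp (htr lam hl t)
      simpa [Function.comp_def] using this)
  have h2 := hμ.ae_tendsto_shiftAverage hU (F := fun lam => (F lam).im)
    (Complex.measurable_im.comp hFm) (B := B)
    (fun lam => (Complex.abs_im_le_norm _).trans (hB lam)) (fun lam hl t => by
      simp only [him _ hl, him _ (shiftMeasure_mem_uniformlyDiscrete hl t)]
      have := (Complex.continuous_im.tendsto _).comp (htr lam hl t)
      simpa [Function.comp_def] using this)
  filter_upwards [h1, h2, hU] with lam h1 h2 hl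
  rw [← integral_congr_ae (indicator_ae_eq hU _), ← hF]
  simp only [hre lam hl] at h1
  simp only [him lam hl] at h2
  have e1 : ∫ lam, (F lam).re ∂μ = (∫ lam, F lam ∂μ).re := integral_re hFi
  have e2 : ∫ lam, (F lam).im ∂μ = (∫ lam, F lam ∂μ).im := integral_im hFi
  rw [e1] at h1
  rw [e2] at h2
  have h3 := ((Complex.continuous_ofReal.tendsto _).comp h1).add
    (((Complex.continuous_ofReal.tendsto _).comp h2).mul_const Complex.I)
  rw [Complex.re_add_im] at h3
  exact h3.congr fun N => by simp [Complex.re_add_im]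

/-- The correlation of a process, as a linear functional on `C_c`. -/
noncomputable def corrFunctional (hμ : IsProcess μ) {w : Fin m → ℝ} (hw0 : ∀ i, w i ≠ 0) (n : ℕ) :
    C_c(Fin n → Pos d, ℂ) →ₗ[ℂ] ℂ where
  toFun f := ∫ lam, multiSum (weightAt w lam) (diffFun f tent) ∂μ
  map_add' f g := by
    obtain ⟨r, hr, hU⟩ := hμ.unifDiscrete
    have hf := boundedSupport_diffFun_tent (boundedSupport_of_hasCompactSupport f.hasCompactSupport)
    have hg := boundedSupport_diffFun_tent (boundedSupport_of_hasCompactSupport g.hasCompactSupport)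
    rw [← integral_add (hμ.integrable_multiSum hw0 (continuous_diffFun (map_continuous f)) hf)
      (hμ.integrable_multiSum hw0 (continuous_diffFun (map_continuous g)) hg)]
    refine integral_congr_ae (hU.mono fun lam hl => ?_)
    simp only
    rw [← (sparse_weightAt hl hr w).multiSum_add hf hg]
    congr 1
    ext y
    simp [diffFun, mul_add]
  map_smul' a f := by
    rw [RingHom.id_apply, smul_eq_mul, ← integral_const_mul]
    refine integral_congr_ae (Eventually.of_forall fun lam => ?_)
    simp only
    rw [← multiSum_const_mul]
    congr 1
    ext y
    simp [diffFun, mul_left_comm]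

lemma exists_norm_corrFunctional_le (hμ : IsProcess μ) {w : Fin m → ℝ} (hw0 : ∀ i, w i ≠ 0)
    (n ρ : ℕ) : ∃ C : ℝ, ∀ f : C_c(Fin n → Pos d, ℂ), (∀ z, f z ≠ 0 → ∀ j, z j ∈ box d ρ) →
      ∀ B : ℝ, (∀ z, ‖f z‖ ≤ B) → ‖corrFunctional hμ hw0 n f‖ ≤ C * B := by
  have := hμ.prob
  obtain ⟨r, hr, hU⟩ := hμ.unifDiscrete
  refine ⟨(latticeBox d 1).card * ((cellBound d r : ℝ) * (cellBound d r * (2 * ρ + 1) ^ d : ℕ) ^ n *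
    (∑ i, |w i|) ^ (n + 1)), fun f hf B hB => ?_⟩
  have h1 : ∀ᵐ lam ∂μ, ‖multiSum (weightAt w lam) (diffFun f tent)‖ ≤
      (latticeBox d 1).card * ((cellBound d r : ℝ) * (cellBound d r * (2 * ρ + 1) ^ d : ℕ) ^ n *
        ((∑ i, |w i|) ^ (n + 1) * B)) := by
    filter_upwards [hU] with lam hl
    refine (sparse_weightAt hl hr w).norm_multiSum_le_card _ ρ (fun y hy => ?_) fun y => ?_
    · rw [diffFun, mul_ne_zero_iff, Complex.ofReal_ne_zero] at hy
      exact ⟨cellIndex_mem_latticeBox.2 (mem_box_of_tent_ne_zero hy.1), hf _ hy.2⟩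
    · rw [diffFun, norm_mul, Complex.norm_real, Real.norm_eq_abs, abs_of_nonneg (tent_nonneg _)]
      exact (mul_le_of_le_one_left (norm_nonneg _) (tent_le_one _)).trans (hB _)
  have h2 := norm_integral_le_of_norm_le_const h1
  rw [probReal_univ, mul_one] at h2
  refine h2.trans_eq ?_
  ring

lemma isRadonFunctional_corrFunctional (hμ : IsProcess μ) {w : Fin m → ℝ} (hw0 : ∀ i, w i ≠ 0)
    (n : ℕ) : IsRadonFunctional (corrFunctional hμ hw0 n) := by
  intro K hK
  obtain ⟨ρ, hρ⟩ := exists_box_of_isCompact hK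
  obtain ⟨C, hC⟩ := exists_norm_corrFunctional_le hμ hw0 n ρ
  exact ⟨C, fun f hf B hB => hC f (fun z hz => hρ z (hf (subset_tsupport _ hz))) B hB⟩

/-- Separability of the space of continuous functions supported in a fixed box. -/
lemma exists_countable_dense_of_box (d n ρ : ℕ) :
    ∃ D : Set C_c(Fin n → Pos d, ℂ), D.Countable ∧
      ∀ f : C_c(Fin n → Pos d, ℂ), (∀ z, f z ≠ 0 → ∀ j, z j ∈ box d ρ) → ∀ ε > 0, ∃ g ∈ D,
        (∀ z, g z ≠ 0 → ∀ j, z j ∈ box d ρ) ∧ ∀ z, ‖f z - g z‖ ≤ ε := by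
  set K : Set (Fin n → Pos d) := Set.univ.pi fun _ => closure (box d ρ) with hK
  have hKc : IsCompact K := isCompact_univ_pi fun _ => (isBounded_box d ρ).isCompact_closure
  have : CompactSpace K := isCompact_iff_compactSpace.1 hKc
  let X := {f : C_c(Fin n → Pos d, ℂ) // ∀ z, f z ≠ 0 → ∀ j, z j ∈ box d ρ}
  let res : X → C(K, ℂ) := fun f => ⟨fun z => f.1 z, f.1.continuous.comp continuous_subtype_val⟩
  -- Restriction to the compact `K` places these functions in `C(K, ℂ)`, whose second countability,
  -- unlike mere separability, passes to subsets.
  let _ : TopologicalSpace X := TopologicalSpace.induced res inferInstance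
  have : SecondCountableTopology X := (Topology.IsInducing.induced res).secondCountableTopology
  obtain ⟨D, hDc, hDd⟩ := TopologicalSpace.exists_countable_dense X
  refine ⟨Subtype.val '' D, hDc.image _, fun f hf ε hε => ?_⟩
  have hopen : IsOpen (res ⁻¹' Metric.ball (res ⟨f, hf⟩) ε) :=
    Metric.isOpen_ball.preimage continuous_induced_dom
  obtain ⟨g, hg, hgD⟩ := hDd.exists_mem_open hopen ⟨⟨f, hf⟩, Metric.mem_ball_self hε⟩
  refine ⟨g.1, ⟨g, hg, rfl⟩, g.2, fun z => ?_⟩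
  by_cases hz : z ∈ K
  · have h1 : dist (res g) (res ⟨f, hf⟩) < ε := hgD
    have h2 := (ContinuousMap.dist_apply_le_dist (f := res g) (g := res ⟨f, hf⟩) ⟨z, hz⟩).trans h1.le
    rw [dist_comm, dist_eq_norm] at h2
    exact h2
  · have h0 : ∀ h : C_c(Fin n → Pos d, ℂ), (∀ z, h z ≠ 0 → ∀ j, z j ∈ box d ρ) → h z = 0 := by
      intro h hh
      by_contra hcon
      exact hz fun j _ => subset_closure (hh z hcon j)
    rw [h0 f hf, h0 g.1 g.2, sub_zero, norm_zero]
    exact hε.le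

/-- Almost surely the correlations exist and agree with those of the process. -/
theorem IsProcess.ae_isCorrelation (hμ : IsProcess μ) {w : Fin m → ℝ} (hw0 : ∀ i, w i ≠ 0)
    (n : ℕ) : ∀ᵐ lam ∂μ, IsCorrelation w lam n (corrFunctional hμ hw0 n) := by
  obtain ⟨r, hr, hU⟩ := hμ.unifDiscrete
  choose D hDc hD using exists_countable_dense_of_box d n
  -- The exceptional null set must not depend on `f`, so it is fixed using countably many test
  -- functions only.
  have h1 : ∀ᵐ lam ∂μ, ∀ ρ, ∀ g ∈ D ρ, Tendsto (tentAverage (weightAt w lam) g) atTop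
      (𝓝 (corrFunctional hμ hw0 n g)) := by
    rw [ae_all_iff]
    intro ρ
    rw [ae_ball_iff (hDc ρ)]
    exact fun g _ => hμ.ae_tendsto_tentAverage hw0 (map_continuous g)
      (boundedSupport_of_hasCompactSupport g.hasCompactSupport)
  filter_upwards [h1, hU] with lam h1 hl
  have hs := sparse_weightAt hl hr w
  refine ⟨isRadonFunctional_corrFunctional hμ hw0 n, fun f => ?_⟩
  obtain ⟨ρ, hρ⟩ := boundedSupport_of_hasCompactSupport f.hasCompactSupport
  obtain ⟨C₁, hC₁⟩ := exists_norm_corrFunctional_le hμ hw0 n ρ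
  set C₂ := 2 ^ d * ((cellBound d r : ℝ) * (cellBound d r * (2 * ρ + 1) ^ d : ℕ) ^ n *
    (∑ i, |w i|) ^ (n + 1)) with hC₂
  have hC₂0 : 0 ≤ C₂ := by positivity
  rw [Metric.tendsto_atTop]
  intro ε hε
  -- Replacing `f` by `g` costs at most `C₂ * δ` in the correlation sum and `|C₁| * δ` in the limit;
  -- the remaining `ε / 2` is for the convergence at `g`.
  set δ := ε / (2 * (|C₁| + C₂ + 1)) with hδ
  have hden : 0 < |C₁| + C₂ + 1 := by positivity
  have hδ0 : 0 < δ := by positivity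
  obtain ⟨g, hgD, hgρ, hfg⟩ := hD ρ f hρ δ hδ0
  have hfgρ : ∀ z, (f - g) z ≠ 0 → ∀ j, z j ∈ box d ρ := by
    intro z hz
    by_cases h0 : f z = 0
    · refine hgρ z fun h1 => hz ?_
      rw [CompactlySupportedContinuousMap.sub_apply, h0, h1, sub_zero]
    · exact hρ z h0
  have hfgδ : ∀ z, ‖(f - g) z‖ ≤ δ := fun z => hfg z
  obtain ⟨Bg, hBg⟩ := (boundedSupport_of_hasCompactSupport g.hasCompactSupport).exists_norm_le
    g.continuous
  have hg := hs.tendsto_corrSum (boundedSupport_of_hasCompactSupport g.hasCompactSupport) hBg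
    (h1 ρ g hgD)
  obtain ⟨R₀, hR₀⟩ := Metric.tendsto_atTop.1 hg (ε / 2) (half_pos hε)
  refine ⟨max R₀ 2, fun R hR => ?_⟩
  have e1 := hR₀ R ((le_max_left _ _).trans hR)
  have e2 := hs.norm_corrSum_div_le hfgρ hfgδ ((le_max_right R₀ 2).trans hR)
  have e3 := hC₁ (f - g) hfgρ δ hfgδ
  have e4 : corrSum w lam n R (f - g) = corrSum w lam n R f - corrSum w lam n R g := by
    rw [hs.corrSum_eq_multiSum, hs.corrSum_eq_multiSum, hs.corrSum_eq_multiSum,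
      ← hs.multiSum_sub (boundedSupport_cubeFun _ _) (boundedSupport_cubeFun _ _)]
    congr 1
    ext y
    simp only [cubeFun]
    split_ifs <;> simp
  rw [map_sub] at e3
  rw [CompactlySupportedContinuousMap.coe_sub, e4, sub_div] at e2
  rw [dist_eq_norm] at e1 ⊢
  have e5 : C₁ * δ ≤ |C₁| * δ := mul_le_mul_of_nonneg_right (le_abs_self _) hδ0.le
  have e6 : (|C₁| + C₂ + 1) * δ = ε / 2 := by
    rw [hδ]; field_simp
  set a := corrSum w lam n R f / ((volume.real (cube d R) : ℝ) : ℂ)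
  set b := corrSum w lam n R g / ((volume.real (cube d R) : ℝ) : ℂ)
  set p := corrFunctional hμ hw0 n f
  set q := corrFunctional hμ hw0 n g
  have e7 : a - p = (a - b) + (b - q) - (p - q) := by ring
  rw [e7]
  have e8 := norm_sub_le ((a - b) + (b - q)) (p - q)
  have e9 := norm_add_le (a - b) (b - q)
  nlinarith

end Existence

/-! ### Moments from correlations -/

section Moments

variable {d m : ℕ} {r : ℝ} {μ : Measure (Measure (ColPt d m))}

lemma continuous_integral_of_box {X : Type*} [TopologicalSpace X] [FirstCountableTopology X]
    [LocallyCompactSpace X] {H : X → Pos d → ℂ} (hH : Continuous (Function.uncurry H)) {L : ℕ}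
    (hL : ∀ x t, H x t ≠ 0 → t ∈ box d L) : Continuous fun x => ∫ t, H x t := by
  have h := continuous_parametric_integral_of_continuous (μ := (volume : Measure (Pos d))) hH
    (isBounded_box d L).isCompact_closure
  convert h using 2 with x
  refine (setIntegral_eq_integral_of_forall_compl_eq_zero fun t ht => ?_).symm
  by_contra hcon
  exact ht (subset_closure (hL x t hcon))

lemma integrable_of_box {H : Pos d → ℂ} (hH : Continuous H) {L : ℕ}
    (hL : ∀ t, H t ≠ 0 → t ∈ box d L) : Integrable H :=
  hH.integrable_of_hasCompactSupport (HasCompactSupport.of_support_subset_isCompact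
    (isBounded_box d L).isCompact_closure fun t ht => subset_closure (hL t ht))

/-- Fubini's theorem for a continuous family of multiple sums. -/
lemma IsProcess.integral_multiSum_swap {ι : Type*} [Fintype ι] (hμ : IsProcess μ) {w : Fin m → ℝ}
    (hw0 : ∀ i, w i ≠ 0) {H : Pos d → (ι → Pos d) → ℂ} (hH : Continuous (Function.uncurry H))
    {L : ℕ} (hL : ∀ t y, H t y ≠ 0 → t ∈ box d L ∧ ∀ j, y j ∈ box d L) :
    ∫ t, ∫ lam, multiSum (weightAt w lam) (H t) ∂μ =
      ∫ lam, multiSum (weightAt w lam) (fun y => ∫ t, H t y) ∂μ := by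
  classical
  have := hμ.prob
  obtain ⟨r, hr, hU⟩ := hμ.unifDiscrete
  have hHt : ∀ t, Continuous (H t) := fun t => hH.comp (Continuous.prodMk_right t)
  have hHy : ∀ y, Continuous fun t => H t y := fun y => hH.comp (Continuous.prodMk_left y)
  set Ψ : Pos d → Measure (ColPt d m) → ℂ := fun t =>
    (uniformlyDiscrete d m r).indicator fun lam => multiSum (weightAt w lam) (H t) with hΨ
  obtain ⟨B, hB⟩ : ∃ B, ∀ t y, ‖H t y‖ ≤ B := by
    have hc : HasCompactSupport (Function.uncurry H) :=
      HasCompactSupport.of_support_subset_isCompact ((isBounded_box d L).isCompact_closure.prod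
        (isCompact_univ_pi fun _ : ι => (isBounded_box d L).isCompact_closure)) fun p hp =>
          ⟨subset_closure (hL _ _ hp).1, fun j _ => subset_closure ((hL _ _ hp).2 j)⟩
    obtain ⟨B, hB⟩ := hc.exists_bound_of_continuous hH
    exact ⟨B, fun t y => hB (t, y)⟩
  have hB0 : 0 ≤ B := (norm_nonneg _).trans (hB 0 fun _ => 0)
  set C := ((cellBound d r * (2 * L) ^ d : ℕ) : ℝ) ^ Fintype.card ι *
    ((∑ i, |w i|) ^ Fintype.card ι * B) with hC
  have hC0 : 0 ≤ C := by positivity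
  have hΨsum : ∀ t lam, (hl : lam ∈ uniformlyDiscrete d m r) → Ψ t lam =
      ∑ y ∈ Fintype.piFinset fun _ : ι => (sparse_weightAt hl hr w).points (latticeBox d L),
        (∏ j, (weightAt w lam (y j) : ℂ)) * H t y := by
    intro t lam hl
    simp only [hΨ]
    rw [Set.indicator_of_mem hl, (sparse_weightAt hl hr w).multiSum_eq_sum fun y hy => (hL t y hy).2]
  -- Joint measurability follows from continuity in `t` and measurability in `lam`.
  have hΨm : Measurable (Function.uncurry Ψ) := by
    refine measurable_uncurry_of_continuous_of_measurable (fun lam => ?_) fun t =>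
      measurable_indicator_multiSum hr hw0 (hHt t) ⟨L, fun y hy => (hL t y hy).2⟩
    by_cases hl : lam ∈ uniformlyDiscrete d m r
    · simp only [hΨsum _ lam hl]
      exact continuous_finsetSum _ fun y _ => continuous_const.mul (hHy y)
    · simp only [hΨ, Set.indicator_of_notMem hl]
      exact continuous_const
  have hΨb : ∀ t lam, ‖Ψ t lam‖ ≤ (box d L).indicator (fun _ => C) t := by
    intro t lam
    by_cases ht : t ∈ box d L
    · rw [Set.indicator_of_mem ht]
      by_cases hl : lam ∈ uniformlyDiscrete d m r
      · simp only [hΨ]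
        rw [Set.indicator_of_mem hl]
        exact (sparse_weightAt hl hr w).norm_multiSum_le (fun y hy => (hL t y hy).2) (hB t)
      · simp only [hΨ]
        rw [Set.indicator_of_notMem hl, norm_zero]
        exact hC0
    · rw [Set.indicator_of_notMem ht]
      have h0 : ∀ y, H t y = 0 := fun y => by
        by_contra hcon
        exact ht (hL t y hcon).1
      by_cases hl : lam ∈ uniformlyDiscrete d m r
      · rw [hΨsum t lam hl]
        simp [h0]
      · simp only [hΨ]
        rw [Set.indicator_of_notMem hl, norm_zero]
  have hgi : Integrable ((box d L).indicator fun _ => C) (volume : Measure (Pos d)) := by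
    rw [integrable_indicator_iff (measurableSet_box d L)]
    exact integrableOn_const (isBounded_box d L).measure_lt_top.ne
  have hΨi : Integrable (Function.uncurry Ψ) ((volume : Measure (Pos d)).prod μ) :=
    Integrable.mono' (hgi.comp_fst μ) hΨm.aestronglyMeasurable
      (Eventually.of_forall fun p => hΨb p.1 p.2)
  have h1 : ∀ t, ∫ lam, multiSum (weightAt w lam) (H t) ∂μ = ∫ lam, Ψ t lam ∂μ := fun t =>
    (integral_congr_ae (indicator_ae_eq hU _)).symm
  simp only [h1]
  rw [integral_integral_swap hΨi]
  refine integral_congr_ae (hU.mono fun lam hl => ?_)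
  have hs := sparse_weightAt hl hr w
  simp only [hΨsum _ lam hl]
  rw [integral_finsetSum, hs.multiSum_eq_sum (L := L)]
  · exact Finset.sum_congr rfl fun y _ => integral_const_mul _ _
  · intro y hy
    by_contra hcon
    apply hy
    have : ∀ t, H t y = 0 := fun t => by
      by_contra h0
      exact hcon (hL t y h0).2
    simp [this]
  · intro y _
    exact (integrable_of_box (hHy y) fun t ht => (hL t y ht).1).const_mul _

/-- Integrating out the position of the first point. -/
noncomputable def reduceFun {n : ℕ} (G : (Fin (n + 1) → Pos d) → ℂ) (z : Fin n → Pos d) : ℂ :=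
  ∫ s : Pos d, G (Fin.cons s fun j => z j + s)

lemma continuous_reduceFun {n : ℕ} {G : (Fin (n + 1) → Pos d) → ℂ} (hGc : Continuous G)
    (hG : BoundedSupport G) : Continuous (reduceFun G) := by
  obtain ⟨L, hL⟩ := hG
  refine continuous_integral_of_box
    (H := fun (z : Fin n → Pos d) s => G (Fin.cons s fun j => z j + s)) ?_ (L := L)
    fun z s hs => hL _ hs 0
  refine hGc.comp (continuous_pi fun j => ?_)
  refine Fin.cases ?_ (fun j => ?_) j
  · simp only [Fin.cons_zero]; fun_prop
  · simp only [Fin.cons_succ]; fun_prop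

lemma boundedSupport_reduceFun {n : ℕ} {G : (Fin (n + 1) → Pos d) → ℂ}
    (hG : BoundedSupport G) : BoundedSupport (reduceFun G) := by
  obtain ⟨L, hL⟩ := hG
  refine ⟨L + (L + 1), fun z hz j => ?_⟩
  by_contra hcon
  apply hz
  have : ∀ s : Pos d, G (Fin.cons s fun j => z j + s) = 0 := by
    intro s
    by_contra h0
    have h1 := hL _ h0 0
    have h2 := hL _ h0 j.succ
    rw [Fin.cons_zero] at h1
    rw [Fin.cons_succ] at h2
    have := add_mem_box h2 (neg_mem_box h1)
    rw [add_neg_cancel_right] at this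
    exact hcon this
  simp [reduceFun, this]

/-- `reduceFun` as a compactly supported function. -/
noncomputable def reduceMap {n : ℕ} (G : (Fin (n + 1) → Pos d) → ℂ) (hGc : Continuous G)
    (hG : BoundedSupport G) : C_c(Fin n → Pos d, ℂ) where
  toFun := reduceFun G
  continuous_toFun := continuous_reduceFun hGc hG
  hasCompactSupport' := (boundedSupport_reduceFun hG).hasCompactSupport

lemma integral_tent_pos : 0 < ∫ x : Pos d, tent x := by
  refine continuous_tent.integral_pos_of_hasCompactSupport_nonneg_nonzero ?_
    (fun x => tent_nonneg x) (x := 0) (by rw [tent_zero]; exact one_ne_zero)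
  exact HasCompactSupport.of_support_subset_isCompact
    (isBounded_box d 1).isCompact_closure fun t ht => subset_closure (mem_box_of_tent_ne_zero ht)

/-- The correlations determine the moment measures. -/
theorem corrFunctional_reduceMap (hμ : IsProcess μ) {w : Fin m → ℝ} (hw0 : ∀ i, w i ≠ 0) {n : ℕ}
    {G : (Fin (n + 1) → Pos d) → ℂ} (hGc : Continuous G) (hG : BoundedSupport G) :
    corrFunctional hμ hw0 n (reduceMap G hGc hG) =
      ((∫ x : Pos d, tent x : ℝ) : ℂ) * ∫ lam, multiSum (weightAt w lam) G ∂μ := by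
  have htc := continuous_tent (d := d)
  obtain ⟨L, hL⟩ := id hG
  -- Substituting `s = y 0 + t` turns the reduced function into an integral over common translations
  -- of `G`. After Fubini, stationarity moves the translation from `G` to the tent; Fubini again
  -- leaves `∫ tent (y 0 - t) dt`, which does not depend on `y`.
  have e1 : ∀ y : Fin (n + 1) → Pos d, diffFun (reduceFun G) tent y =
      ∫ t, (tent (y 0) : ℂ) * G fun j => y j + t := by
    intro y
    rw [integral_const_mul, diffFun, reduceFun]
    congr 1
    rw [← integral_add_left_eq_self (μ := volume)
      (fun s : Pos d => G (Fin.cons s fun j => y j.succ - y 0 + s)) (y 0)]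
    congr 1
    ext t
    congr 1
    ext j : 1
    refine Fin.cases (by simp) (fun j => ?_) j
    rw [Fin.cons_succ]
    abel
  have e2 := hμ.integral_multiSum_swap hw0 (L := 2 * L + 3)
    (H := fun t (y : Fin (n + 1) → Pos d) => (tent (y 0) : ℂ) * G fun j => y j + t)
    (by simp only [Function.uncurry_def]; fun_prop) (fun t y hty => by
      rw [mul_ne_zero_iff, Complex.ofReal_ne_zero] at hty
      have h0 := mem_box_of_tent_ne_zero hty.1
      have h1 := hL _ hty.2
      have ht : t ∈ box d (L + (1 + 1)) := by
        have := add_mem_box (h1 0) (neg_mem_box h0)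
        rwa [show y 0 + t + -y 0 = t by abel] at this
      refine ⟨box_mono (by omega) ht, fun j => ?_⟩
      have := add_mem_box (h1 j) (neg_mem_box ht)
      rw [add_neg_cancel_right] at this
      exact box_mono (by omega) this)
  have e3 := hμ.integral_multiSum_swap hw0 (L := L + 2)
    (H := fun t (y : Fin (n + 1) → Pos d) => (tent (y 0 - t) : ℂ) * G y)
    (by simp only [Function.uncurry_def]; fun_prop) (fun t y hty => by
      rw [mul_ne_zero_iff, Complex.ofReal_ne_zero] at hty
      have h1 := hL _ hty.2
      refine ⟨?_, fun j => box_mono (by omega) (h1 j)⟩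
      have := add_mem_box (h1 0) (neg_mem_box (mem_box_of_tent_ne_zero hty.1))
      rwa [show y 0 + -(y 0 - t) = t by abel] at this)
  have e4 : ∀ t, ∫ lam, multiSum (weightAt w lam)
        (fun y : Fin (n + 1) → Pos d => (tent (y 0) : ℂ) * G fun j => y j + t) ∂μ =
      ∫ lam, multiSum (weightAt w lam)
        (fun y : Fin (n + 1) → Pos d => (tent (y 0 - t) : ℂ) * G y) ∂μ := by
    intro t
    have hi := hμ.integrable_multiSum hw0
      (G := fun y : Fin (n + 1) → Pos d => (tent (y 0 - t) : ℂ) * G y) (by fun_prop)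
      ⟨L, fun y hy => hL y (mul_ne_zero_iff.1 hy).2⟩
    rw [← hμ.integral_shiftMeasure t hi.aestronglyMeasurable]
    refine integral_congr_ae (Eventually.of_forall fun lam => ?_)
    simp only
    rw [weightAt_shiftMeasure, multiSum_translate]
    simp only [add_sub_cancel_right]
  have e5 : ∀ y : Fin (n + 1) → Pos d, ∫ t, (tent (y 0 - t) : ℂ) * G y =
      ((∫ x : Pos d, tent x : ℝ) : ℂ) * G y := by
    intro y
    rw [integral_mul_const, integral_sub_left_eq_self (fun x : Pos d => (tent x : ℂ)) volume (y 0),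
      integral_complex_ofReal]
  calc corrFunctional hμ hw0 n (reduceMap G hGc hG)
      = ∫ lam, multiSum (weightAt w lam) (diffFun (reduceFun G) tent) ∂μ := rfl
    _ = ∫ lam, multiSum (weightAt w lam)
          (fun y => ∫ t, (tent (y 0) : ℂ) * G fun j => y j + t) ∂μ := by
        rw [funext e1]
    _ = _ := by
        rw [← e2]
        simp only [e4]
        rw [e3]
        simp only [e5, multiSum_const_mul, integral_const_mul]

end Moments

/-! ### The algebra of multiple sums -/

section Algebra

variable {d m : ℕ} {r : ℝ} {μ ν : Measure (Measure (ColPt d m))} {w : Fin m → ℝ}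

/-- Multiple sums with at least two points, restricted to uniformly discrete measures. -/
def multiSumSet (d : ℕ) (w : Fin m → ℝ) (r : ℝ) : Set (Measure (ColPt d m) → ℂ) :=
  {Ψ | ∃ n : ℕ, 1 ≤ n ∧ ∃ G : (Fin (n + 1) → Pos d) → ℂ, Continuous G ∧ BoundedSupport G ∧
    Ψ = (uniformlyDiscrete d m r).indicator fun lam => multiSum (weightAt w lam) G}

/-- The linear span of the multiple sums with at least two points. -/
def multiSumSpan (d : ℕ) (w : Fin m → ℝ) (r : ℝ) : Submodule ℂ (Measure (ColPt d m) → ℂ) :=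
  Submodule.span ℂ (multiSumSet d w r)

/-- Concatenate the tuples: `(n + 1) + (n' + 1)` points are `(n + n' + 1) + 1` points. -/
lemma mul_mem_multiSumSet (hr : 0 < r) {Ψ Ψ' : Measure (ColPt d m) → ℂ}
    (h : Ψ ∈ multiSumSet d w r) (h' : Ψ' ∈ multiSumSet d w r) : Ψ * Ψ' ∈ multiSumSet d w r := by
  obtain ⟨n, hn, G, hGc, hG, rfl⟩ := h
  obtain ⟨n', hn', G', hGc', hG', rfl⟩ := h'
  set e : Fin (n + n' + 1 + 1) ≃ Fin (n + 1) ⊕ Fin (n' + 1) :=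
    (finCongr (by omega)).trans (finSumFinEquiv (m := n + 1) (n := n' + 1)).symm with he
  set H : (Fin (n + 1) ⊕ Fin (n' + 1) → Pos d) → ℂ := fun y =>
    G (y ∘ Sum.inl) * G' (y ∘ Sum.inr) with hH
  have hHc : Continuous H := by
    refine (hGc.comp ?_).mul (hGc'.comp ?_) <;> exact continuous_pi fun j => continuous_apply _
  refine ⟨n + n' + 1, by omega, fun y => H (y ∘ e.symm), ?_, ?_, ?_⟩
  · exact hHc.comp (continuous_pi fun j => continuous_apply _)
  · obtain ⟨L, hL⟩ := hG
    obtain ⟨L', hL'⟩ := hG'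
    refine ⟨max L L', fun y hy j => ?_⟩
    obtain ⟨h1, h2⟩ := mul_ne_zero_iff.1 hy
    have h3 : ∀ i, (y ∘ e.symm) i ∈ box d (max L L') := by
      rintro (i | i)
      · exact box_mono (le_max_left _ _) (hL _ h1 i)
      · exact box_mono (le_max_right _ _) (hL' _ h2 i)
    simpa using h3 (e j)
  · ext lam
    by_cases hl : lam ∈ uniformlyDiscrete d m r
    · simp only [Pi.mul_apply, Set.indicator_of_mem hl]
      rw [(sparse_weightAt hl hr w).multiSum_mul hG hG', multiSum_reindex]
    · simp [Set.indicator_of_notMem hl]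

lemma mul_mem_multiSumSpan (hr : 0 < r) {Ψ Ψ' : Measure (ColPt d m) → ℂ}
    (h : Ψ ∈ multiSumSpan d w r) (h' : Ψ' ∈ multiSumSpan d w r) : Ψ * Ψ' ∈ multiSumSpan d w r := by
  have := Submodule.mul_mem_mul h h'
  rw [multiSumSpan, Submodule.span_mul_span] at this
  refine Submodule.span_mono ?_ this
  rintro _ ⟨a, ha, b, hb, rfl⟩
  exact mul_mem_multiSumSet hr ha hb

/-- Only positive powers are claimed, since constants are not among the generators; the zeroth
moment is 1 for any probability measure. -/
lemma pow_mem_multiSumSpan (hr : 0 < r) {Ψ : Measure (ColPt d m) → ℂ}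
    (h : Ψ ∈ multiSumSpan d w r) (k : ℕ) : Ψ ^ (k + 1) ∈ multiSumSpan d w r := by
  induction k with
  | zero => simpa using h
  | succ k ih => rw [pow_succ]; exact mul_mem_multiSumSpan hr ih h

lemma measurable_of_mem_multiSumSpan (hr : 0 < r) (hw0 : ∀ i, w i ≠ 0)
    {Ψ : Measure (ColPt d m) → ℂ} (h : Ψ ∈ multiSumSpan d w r) : Measurable Ψ := by
  induction h using Submodule.span_induction with
  | mem Ψ h =>
    obtain ⟨n, hn, G, hGc, hG, rfl⟩ := h
    exact measurable_indicator_multiSum hr hw0 hGc hG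
  | zero => exact measurable_const
  | add Ψ Ψ' _ _ h h' => exact h.add h'
  | smul a Ψ _ h => exact h.const_smul a

lemma bounded_of_mem_multiSumSpan (hr : 0 < r) {Ψ : Measure (ColPt d m) → ℂ}
    (h : Ψ ∈ multiSumSpan d w r) : ∃ B, ∀ lam, ‖Ψ lam‖ ≤ B := by
  induction h using Submodule.span_induction with
  | mem Ψ h =>
    obtain ⟨n, hn, G, hGc, hG, rfl⟩ := h
    exact exists_norm_indicator_multiSum_le hr w hGc hG
  | zero => exact ⟨0, fun lam => by simp⟩
  | add Ψ Ψ' _ _ h h' =>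
    obtain ⟨B, hB⟩ := h
    obtain ⟨B', hB'⟩ := h'
    exact ⟨B + B', fun lam => (norm_add_le _ _).trans (add_le_add (hB lam) (hB' lam))⟩
  | smul a Ψ _ h =>
    obtain ⟨B, hB⟩ := h
    refine ⟨‖a‖ * B, fun lam => ?_⟩
    rw [Pi.smul_apply, norm_smul]
    exact mul_le_mul_of_nonneg_left (hB lam) (norm_nonneg _)

lemma integrable_of_mem_multiSumSpan [IsFiniteMeasure μ] (hr : 0 < r) (hw0 : ∀ i, w i ≠ 0)
    {Ψ : Measure (ColPt d m) → ℂ} (h : Ψ ∈ multiSumSpan d w r) : Integrable Ψ μ := by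
  obtain ⟨B, hB⟩ := bounded_of_mem_multiSumSpan hr h
  exact Integrable.of_bound (measurable_of_mem_multiSumSpan hr hw0 h).aestronglyMeasurable B
    (Eventually.of_forall hB)

/-- Processes with the same correlations have the same moments. -/
lemma integral_eq_of_mem_multiSumSpan (hμ : IsProcess μ) (hν : IsProcess ν) (hw0 : ∀ i, w i ≠ 0)
    (hr : 0 < r) (hUμ : ∀ᵐ lam ∂μ, lam ∈ uniformlyDiscrete d m r)
    (hUν : ∀ᵐ lam ∂ν, lam ∈ uniformlyDiscrete d m r)
    (hγ : ∀ n, 1 ≤ n → corrFunctional hμ hw0 n = corrFunctional hν hw0 n)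
    {Ψ : Measure (ColPt d m) → ℂ} (h : Ψ ∈ multiSumSpan d w r) :
    ∫ lam, Ψ lam ∂μ = ∫ lam, Ψ lam ∂ν := by
  have := hμ.prob
  have := hν.prob
  induction h using Submodule.span_induction with
  | mem Ψ h =>
    obtain ⟨n, hn, G, hGc, hG, rfl⟩ := h
    rw [integral_congr_ae (indicator_ae_eq hUμ _), integral_congr_ae (indicator_ae_eq hUν _)]
    have h1 := corrFunctional_reduceMap hμ hw0 hGc hG
    have h2 := corrFunctional_reduceMap hν hw0 hGc hG
    rw [hγ n hn, h2] at h1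
    have h3 : ((∫ x : Pos d, tent x : ℝ) : ℂ) ≠ 0 := by exact_mod_cast integral_tent_pos.ne'
    exact (mul_left_cancel₀ h3 h1).symm
  | zero => simp
  | add Ψ Ψ' h h' ih ih' =>
    simp only [Pi.add_apply]
    rw [integral_add (integrable_of_mem_multiSumSpan hr hw0 h)
      (integrable_of_mem_multiSumSpan hr hw0 h'), ih, ih',
      integral_add (integrable_of_mem_multiSumSpan hr hw0 h)
      (integrable_of_mem_multiSumSpan hr hw0 h')]
  | smul a Ψ h ih => simp only [Pi.smul_apply, integral_smul, ih]

/-- Boundedness makes the exponential series dominated, so moments determine the integral of the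
exponential and no moment problem arises. -/
lemma hasSum_integral_exp {Ω : Type*} [MeasurableSpace Ω] {P : Measure Ω} [IsFiniteMeasure P]
    {Y : Ω → ℂ} (hY : Measurable Y) {B : ℝ} (hB : ∀ x, ‖Y x‖ ≤ B) :
    HasSum (fun k : ℕ => ∫ x, (Y x * Complex.I) ^ k / (k.factorial : ℂ) ∂P)
      (∫ x, Complex.exp (Y x * Complex.I) ∂P) := by
  refine hasSum_integral_of_dominated_convergence (fun k _ => B ^ k / (k.factorial : ℝ)) ?_ ?_ ?_ ?_ ?_
  · exact fun k => (((hY.mul_const _).pow_const k).div_const _).aestronglyMeasurable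
  · refine fun k => Eventually.of_forall fun x => ?_
    rw [norm_div, norm_pow, norm_mul, Complex.norm_I, mul_one, Complex.norm_natCast]
    gcongr
    exact hB x
  · exact Eventually.of_forall fun x => Real.summable_pow_div_factorial B
  · exact integrable_const _
  · refine Eventually.of_forall fun x => ?_
    rw [Complex.exp_eq_exp_ℂ]
    exact NormedSpace.expSeries_div_hasSum_exp (Y x * Complex.I)

lemma integral_exp_eq_of_mem_multiSumSpan (hμ : IsProcess μ) (hν : IsProcess ν)
    (hw0 : ∀ i, w i ≠ 0) (hr : 0 < r) (hUμ : ∀ᵐ lam ∂μ, lam ∈ uniformlyDiscrete d m r)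
    (hUν : ∀ᵐ lam ∂ν, lam ∈ uniformlyDiscrete d m r)
    (hγ : ∀ n, 1 ≤ n → corrFunctional hμ hw0 n = corrFunctional hν hw0 n)
    {Y : Measure (ColPt d m) → ℂ} (h : Y ∈ multiSumSpan d w r) :
    ∫ lam, Complex.exp (Y lam * Complex.I) ∂μ = ∫ lam, Complex.exp (Y lam * Complex.I) ∂ν := by
  have := hμ.prob
  have := hν.prob
  have hm := measurable_of_mem_multiSumSpan hr hw0 h
  obtain ⟨B, hB⟩ := bounded_of_mem_multiSumSpan hr h
  refine (hasSum_integral_exp (P := μ) hm hB).unique ?_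
  convert hasSum_integral_exp (P := ν) hm hB using 2 with k
  cases k with
  | zero => simp
  | succ k =>
    simp only [mul_pow, mul_div_assoc, integral_mul_const]
    congr 1
    exact integral_eq_of_mem_multiSumSpan hμ hν hw0 hr hUμ hUν hγ (pow_mem_multiSumSpan hr h k)

/-! #### Sums over the points of one colour -/

/-- The sum of `f` over the points of colour `i`. -/
noncomputable def colourSum (f : Pos d → ℝ) (i : Fin m) (lam : Measure (ColPt d m)) : ℝ :=
  ∑ᶠ x, lam.real {(x, i)} * f x

lemma colourSum_eq_sum {lam : Measure (ColPt d m)} (hl : lam ∈ uniformlyDiscrete d m r)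
    (hr : 0 < r) (hw0 : ∀ i, w i ≠ 0) {f : Pos d → ℝ} {L : ℕ} (hf : ∀ x, f x ≠ 0 → x ∈ box d L)
    (i : Fin m) : colourSum f i lam =
      ∑ x ∈ (sparse_weightAt hl hr w).points (latticeBox d L), lam.real {(x, i)} * f x := by
  refine finsum_eq_sum_of_support_subset _ fun x hx => ?_
  rw [Function.mem_support, mul_ne_zero_iff] at hx
  rw [Finset.mem_coe, Sparse.mem_points, cellIndex_mem_latticeBox]
  refine ⟨?_, hf x hx.2⟩
  have : lam {(x, i)} ≠ 0 := fun h0 => hx.1 (by simp [measureReal_def, h0])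
  rw [weightAt_of_atom hl hr w this]
  exact hw0 i

/-- The polynomial identifying the colour `i` among the weights. -/
noncomputable def colourPoly (w : Fin m → ℝ) (i : Fin m) : Polynomial ℝ :=
  Lagrange.interpolate Finset.univ w fun j => if j = i then (w i ^ 2)⁻¹ else 0

/-- At an atom of colour `j` the weight is `w j`, and interpolation at the distinct nodes separates
`j = i` from `j ≠ i`. The square kills the positions without atoms, whatever the polynomial does at
0, and guarantees degree at least two in the weight. -/
lemma measureReal_eq_colourPoly {lam : Measure (ColPt d m)} (hl : lam ∈ uniformlyDiscrete d m r)
    (hr : 0 < r) (hw : Function.Injective w) (hw0 : ∀ i, w i ≠ 0) (x : Pos d) (i : Fin m) :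
    lam.real {(x, i)} = weightAt w lam x ^ 2 * (colourPoly w i).eval (weightAt w lam x) := by
  by_cases h : ∃ j, lam {(x, j)} ≠ 0
  · obtain ⟨j, hj⟩ := h
    rw [weightAt_of_atom hl hr w hj, colourPoly,
      Lagrange.eval_interpolate_at_node _ hw.injOn (Finset.mem_univ j),
      measureReal_singleton_eq hl hr]
    by_cases hji : j = i
    · subst hji
      rw [if_neg hj, if_pos rfl, mul_inv_cancel₀ (pow_ne_zero 2 (hw0 j))]
    · rw [if_neg hji, mul_zero, if_pos]
      by_contra hcon
      exact hji (congrArg Prod.snd (atom_unique hl hj hcon hr fun k => by simpa using hr))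
  · push Not at h
    rw [weightAt_of_no_atom w h, measureReal_singleton_eq hl hr, if_pos (h i)]
    simp

/-- A function of `k + 1` points that forces them to coincide. -/
noncomputable def diagFun (f : Pos d → ℝ) (r : ℝ) (k : ℕ) (y : Fin (k + 1) → Pos d) : ℂ :=
  ((f (y 0) * ∏ j, tent ((4 / r) • (y j - y 0)) : ℝ) : ℂ)

/-- The rescaled tent lives on `|x j| < r / 4`, well within the half-edge `r / 2`. -/
lemma mem_cube_of_tent_ne_zero (hr : 0 < r) {x : Pos d} (h : tent ((4 / r) • x) ≠ 0) :
    x ∈ cube d r := by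
  intro j
  have h1 := hat_ne_zero (Finset.prod_ne_zero_iff.1 h j (Finset.mem_univ j))
  rw [PiLp.smul_apply, smul_eq_mul, abs_mul, abs_of_pos (by positivity), div_mul_eq_mul_div,
    div_lt_one hr] at h1
  linarith

lemma continuous_diagFun {f : Pos d → ℝ} (hf : Continuous f) (r : ℝ) (k : ℕ) :
    Continuous (diagFun f r k) := by
  have := continuous_tent (d := d)
  unfold diagFun
  fun_prop

lemma diagFun_ne_zero (hr : 0 < r) {f : Pos d → ℝ} {k : ℕ} {y : Fin (k + 1) → Pos d}
    (h : diagFun f r k y ≠ 0) : f (y 0) ≠ 0 ∧ ∀ j, y j - y 0 ∈ cube d r := by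
  rw [diagFun, Complex.ofReal_ne_zero, mul_ne_zero_iff, Finset.prod_ne_zero_iff] at h
  exact ⟨h.1, fun j => mem_cube_of_tent_ne_zero hr (h.2 j (Finset.mem_univ j))⟩

lemma boundedSupport_diagFun (hr : 0 < r) {f : Pos d → ℝ} {L : ℕ}
    (hf : ∀ x, f x ≠ 0 → x ∈ box d L) (k : ℕ) : BoundedSupport (diagFun f r k) := by
  refine ⟨L + (⌊r / 2⌋₊ + 1), fun y hy j => ?_⟩
  obtain ⟨h1, h2⟩ := diagFun_ne_zero hr hy
  have := add_mem_box (hf _ h1) (cube_subset_box d r (h2 j))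
  rwa [add_sub_cancel] at this

/-- Points of the support that lie within `C_r` of each other coincide, so only constant tuples
contribute. There the tents equal 1 and the weights multiply to a power. -/
lemma multiSum_diagFun {lam : Measure (ColPt d m)} (hl : lam ∈ uniformlyDiscrete d m r)
    (hr : 0 < r) {f : Pos d → ℝ} {L : ℕ} (hf : ∀ x, f x ≠ 0 → x ∈ box d L) (k : ℕ) :
    multiSum (weightAt w lam) (diagFun f r k) =
      ((∑ x ∈ (sparse_weightAt hl hr w).points (latticeBox d L),
        weightAt w lam x ^ (k + 1) * f x : ℝ) : ℂ) := by
  classical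
  rw [multiSum_eq_sum_of_subset
    (((sparse_weightAt hl hr w).points (latticeBox d L)).image fun x _ => x), Finset.sum_image]
  · push_cast
    refine Finset.sum_congr rfl fun x _ => ?_
    simp [diagFun, tent_zero]
  · intro x _ y _ hxy
    exact congrFun hxy 0
  · intro y h1 h2
    obtain ⟨h3, h4⟩ := diagFun_ne_zero hr h1
    refine Finset.mem_image.2 ⟨y 0, ?_, funext fun j =>
      eq_of_weightAt_ne_zero hl hr (h2 0) (h2 j) (h4 j)⟩
    rw [Sparse.mem_points, cellIndex_mem_latticeBox]
    exact ⟨h2 0, hf _ h3⟩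

/-- Expanding the colour polynomial, the coefficient of degree `k` multiplies a diagonal sum over `k
+ 2` points, thanks to the factor `W^2`; so each term has at least two points. -/
lemma colourSum_mem_multiSumSpan (hr : 0 < r) (hw : Function.Injective w) (hw0 : ∀ i, w i ≠ 0)
    {f : Pos d → ℝ} (hfc : Continuous f) {L : ℕ} (hf : ∀ x, f x ≠ 0 → x ∈ box d L) (i : Fin m) :
    (fun lam => (((uniformlyDiscrete d m r).indicator (colourSum f i) lam : ℝ) : ℂ)) ∈
      multiSumSpan d w r := by
  have key : (fun lam => (((uniformlyDiscrete d m r).indicator (colourSum f i) lam : ℝ) : ℂ)) =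
      ∑ k ∈ Finset.range ((colourPoly w i).natDegree + 1),
        (((colourPoly w i).coeff k : ℝ) : ℂ) •
          (uniformlyDiscrete d m r).indicator fun lam : Measure (ColPt d m) =>
            multiSum (weightAt w lam) (diagFun f r (k + 1)) := by
    ext lam
    simp only [Finset.sum_apply, Pi.smul_apply]
    by_cases hl : lam ∈ uniformlyDiscrete d m r
    · simp only [Set.indicator_of_mem hl, multiSum_diagFun hl hr hf, smul_eq_mul]
      norm_cast
      rw [colourSum_eq_sum hl hr hw0 hf]
      simp only [measureReal_eq_colourPoly hl hr hw hw0 _ i, Polynomial.eval_eq_sum_range,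
        Finset.mul_sum, Finset.sum_mul]
      rw [Finset.sum_comm]
      exact Finset.sum_congr rfl fun k _ => Finset.sum_congr rfl fun x _ => by ring
    · simp [Set.indicator_of_notMem hl]
  rw [key]
  refine Submodule.sum_mem _ fun k _ => Submodule.smul_mem _ _ (Submodule.subset_span ?_)
  exact ⟨k + 1, by omega, diagFun f r (k + 1), continuous_diagFun hfc r _,
    boundedSupport_diagFun hr hf _, rfl⟩

end Algebra

/-! ### Uniqueness of the process -/

section Uniqueness

variable {d m : ℕ} {r : ℝ} {μ ν : Measure (Measure (ColPt d m))} {w : Fin m → ℝ}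

/-- The colour sums of all test functions. -/
noncomputable def colourMap (d m : ℕ) (r : ℝ) (lam : Measure (ColPt d m)) :
    C_c(Pos d, ℝ) × Fin m → ℝ :=
  fun p => (uniformlyDiscrete d m r).indicator (colourSum p.1 p.2) lam

lemma exists_box_of_compactlySupported (f : C_c(Pos d, ℝ)) :
    ∃ L : ℕ, ∀ x, f x ≠ 0 → x ∈ box d L := by
  obtain ⟨L, hL⟩ := exists_subset_box f.hasCompactSupport.isCompact.isBounded
  exact ⟨L, fun x hx => hL (subset_tsupport _ hx)⟩

lemma colourMap_mem_multiSumSpan (hr : 0 < r) (hw : Function.Injective w) (hw0 : ∀ i, w i ≠ 0)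
    (p : C_c(Pos d, ℝ) × Fin m) :
    (fun lam => ((colourMap d m r lam p : ℝ) : ℂ)) ∈ multiSumSpan d w r := by
  obtain ⟨L, hL⟩ := exists_box_of_compactlySupported p.1
  exact colourSum_mem_multiSumSpan hr hw hw0 (map_continuous p.1) hL p.2

lemma measurable_colourMap (hr : 0 < r) (hw : Function.Injective w) (hw0 : ∀ i, w i ≠ 0) :
    Measurable (colourMap d m r) := by
  refine measurable_pi_lambda _ fun p => ?_
  have := Complex.measurable_re.comp (measurable_of_mem_multiSumSpan hr hw0
    (colourMap_mem_multiSumSpan hr hw hw0 p))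
  simpa [Function.comp_def] using this

lemma dual_apply_eq_sum {ι : Type*} [Fintype ι] [DecidableEq ι] (l : StrongDual ℝ (ι → ℝ))
    (v : ι → ℝ) : l v = ∑ j, l (Pi.single j 1) * v j := by
  conv_lhs => rw [pi_eq_sum_univ' v, map_sum]
  refine Finset.sum_congr rfl fun j _ => ?_
  rw [map_smul, smul_eq_mul, mul_comm]

lemma dual_colourMap_mem_multiSumSpan (hr : 0 < r) (hw : Function.Injective w)
    (hw0 : ∀ i, w i ≠ 0) (J : Finset (C_c(Pos d, ℝ) × Fin m)) (l : StrongDual ℝ (J → ℝ)) :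
    (fun lam => ((l (J.restrict (colourMap d m r lam)) : ℝ) : ℂ)) ∈ multiSumSpan d w r := by
  classical
  set X : J → Measure (ColPt d m) → ℂ := fun j lam => ((colourMap d m r lam j.1 : ℝ) : ℂ) with hX
  have hXm : ∀ j, X j ∈ multiSumSpan d w r := fun j => colourMap_mem_multiSumSpan hr hw hw0 j.1
  have e : (fun lam => ((l (J.restrict (colourMap d m r lam)) : ℝ) : ℂ)) =
      ∑ j : J, ((l (Pi.single j 1) : ℝ) : ℂ) • X j := by
    ext lam
    rw [dual_apply_eq_sum, Complex.ofReal_sum, Finset.sum_apply]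
    refine Finset.sum_congr rfl fun j _ => ?_
    rw [Complex.ofReal_mul, Pi.smul_apply, smul_eq_mul]
    rfl
  rw [e]
  exact Submodule.sum_mem _ fun j _ => Submodule.smul_mem _ _ (hXm j)

/-- A linear functional of finitely many colour sums is again in the span, so the characteristic
functions of the finite-dimensional marginals agree. These marginals determine the law on the full
product. -/
lemma map_colourMap_eq (hμ : IsProcess μ) (hν : IsProcess ν) (hw : Function.Injective w)
    (hw0 : ∀ i, w i ≠ 0) (hr : 0 < r) (hUμ : ∀ᵐ lam ∂μ, lam ∈ uniformlyDiscrete d m r)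
    (hUν : ∀ᵐ lam ∂ν, lam ∈ uniformlyDiscrete d m r)
    (hγ : ∀ n, 1 ≤ n → corrFunctional hμ hw0 n = corrFunctional hν hw0 n) :
    μ.map (colourMap d m r) = ν.map (colourMap d m r) := by
  classical
  have := hμ.prob
  have := hν.prob
  have hΦ : Measurable (colourMap d m r) := measurable_colourMap hr hw hw0
  refine IsProjectiveLimit.unique (P := fun J => (ν.map (colourMap d m r)).map J.restrict)
    (fun J => ?_) fun J => rfl
  have hJ : Measurable (J.restrict : (C_c(Pos d, ℝ) × Fin m → ℝ) → _) := Finset.measurable_restrict J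
  have : IsProbabilityMeasure (μ.map (colourMap d m r)) :=
    Measure.isProbabilityMeasure_map hΦ.aemeasurable
  have : IsProbabilityMeasure (ν.map (colourMap d m r)) :=
    Measure.isProbabilityMeasure_map hΦ.aemeasurable
  refine Measure.ext_of_charFunDual (funext fun l => ?_)
  have hmem := dual_colourMap_mem_multiSumSpan (m := m) hr hw hw0 J l
  have hexp : ∀ P : Measure (Measure (ColPt d m)),
      charFunDual ((P.map (colourMap d m r)).map J.restrict) l =
        ∫ lam, Complex.exp (((l (J.restrict (colourMap d m r lam)) : ℝ) : ℂ) * Complex.I) ∂P := by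
    intro P
    have hlm : Measurable fun v : J → ℝ => Complex.exp ((l v : ℂ) * Complex.I) := by fun_prop
    rw [charFunDual_apply, Measure.map_map hJ hΦ,
      integral_map (hJ.comp hΦ).aemeasurable hlm.aestronglyMeasurable]
    rfl
  rw [hexp, hexp]
  exact integral_exp_eq_of_mem_multiSumSpan hμ hν hw0 hr hUμ hUν hγ hmem

/-- Colour sums approximate the mass of compact sets. -/
lemma exists_tendsto_colourMap (hr : 0 < r) {E : Set (Pos d)} (hE : IsCompact E) (i : Fin m) :
    ∃ f : ℕ → C_c(Pos d, ℝ), ∀ lam ∈ uniformlyDiscrete d m r,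
      Tendsto (fun k => colourMap d m r lam (f k, i)) atTop (𝓝 (lam.real (E ×ˢ {i}))) := by
  classical
  have hδ : ∀ k : ℕ, (0 : ℝ) < 1 / ((k : ℝ) + 1) := fun k => Nat.one_div_pos_of_nat
  have hsupp : ∀ (k : ℕ) x, x ∉ Metric.cthickening 1 E → thickenedIndicator (hδ k) E x = 0 := by
    intro k x hx
    refine thickenedIndicator_zero (hδ k) E fun h => hx ?_
    refine Metric.thickening_subset_cthickening 1 E (Metric.thickening_mono ?_ E h)
    rw [div_le_one (by positivity)]
    linarith [(Nat.cast_nonneg k : (0 : ℝ) ≤ k)]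
  let f : ℕ → C_c(Pos d, ℝ) := fun k =>
    { toFun := fun x => (thickenedIndicator (hδ k) E x : ℝ)
      continuous_toFun := NNReal.continuous_coe.comp (thickenedIndicator (hδ k) E).continuous
      hasCompactSupport' := HasCompactSupport.intro (hE.cthickening (r := 1)) fun x hx => by
        rw [hsupp k x hx, NNReal.coe_zero] }
  have hfk : ∀ k x, f k x = (thickenedIndicator (hδ k) E x : ℝ) := fun k x => rfl
  refine ⟨f, fun lam hl => ?_⟩
  obtain ⟨L, hL⟩ := exists_subset_box (hE.cthickening (r := 1)).isBounded
  have hfL : ∀ k x, f k x ≠ 0 → x ∈ box d L := by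
    intro k x hx
    by_contra hcon
    exact hx (by rw [hfk, hsupp k x fun h => hcon (hL h), NNReal.coe_zero])
  have hEL : E ⊆ box d L := (Metric.self_subset_cthickening E).trans hL
  -- Unit weights serve only to enumerate the atoms; the statement is independent of `w`.
  have hs := sparse_weightAt hl hr (fun _ : Fin m => (1 : ℝ))
  have hw1 : ∀ i : Fin m, (fun _ : Fin m => (1 : ℝ)) i ≠ 0 := fun _ => one_ne_zero
  have h1 : lam.real (E ×ˢ {i}) = ∑ x ∈ hs.points (latticeBox d L),
      lam.real {(x, i)} * (((closure E).indicator (fun _ => (1 : NNReal)) x : NNReal) : ℝ) := by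
    rw [hE.isClosed.closure_eq, measureReal_eq_sum hl hE.measurableSet hEL i
      ((hs.points (latticeBox d L)).filter (· ∈ E)), Finset.sum_filter]
    · refine Finset.sum_congr rfl fun x _ => ?_
      by_cases hx : x ∈ E <;> simp [hx]
    · intro x hx hxi
      rw [Finset.mem_filter, Sparse.mem_points, cellIndex_mem_latticeBox,
        weightAt_of_atom hl hr _ hxi]
      exact ⟨⟨one_ne_zero, hEL hx⟩, hx⟩
    · intro x hx
      exact (Finset.mem_filter.1 hx).2
  simp only [colourMap, Set.indicator_of_mem hl]
  rw [h1]
  simp only [fun k => colourSum_eq_sum hl hr hw1 (hfL k) i]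
  refine tendsto_finsetSum _ fun x _ => Tendsto.const_mul _ ?_
  have ht := tendsto_pi_nhds.1 (thickenedIndicator_tendsto_indicator_closure hδ
    (tendsto_one_div_add_atTop_nhds_zero_nat (𝕜 := ℝ)) E) x
  exact (NNReal.continuous_coe.tendsto _).comp ht

/-- On uniformly discrete measures, colour sums generate the `σ`-algebra. -/
lemma measurable_subtype_val_comap (hr : 0 < r) :
    @Measurable (uniformlyDiscrete d m r) (Measure (ColPt d m))
      (MeasurableSpace.comap (fun lam => colourMap d m r lam.1) MeasurableSpace.pi) _
      Subtype.val := by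
  let mU : MeasurableSpace (uniformlyDiscrete d m r) :=
    MeasurableSpace.comap (fun lam => colourMap d m r lam.1) MeasurableSpace.pi
  have hcm : Measurable fun lam : uniformlyDiscrete d m r => colourMap d m r lam.1 :=
    comap_measurable _
  set b : ℕ → Set (ColPt d m) := fun n => Metric.closedBall 0 n ×ˢ Set.univ with hb
  have hbm : ∀ n, MeasurableSet (b n) := fun n =>
    Metric.isClosed_closedBall.measurableSet.prod MeasurableSet.univ
  have hbL : ∀ n, ∃ N, b n ⊆ colBox d m N := by
    intro n
    obtain ⟨N, hN⟩ := exists_subset_box (Metric.isBounded_closedBall (x := (0 : Pos d)) (r := n))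
    exact ⟨N, fun p hp => hN hp.1⟩
  have hfin : ∀ (lam : uniformlyDiscrete d m r) n, lam.1 (b n) < ⊤ := by
    intro lam n
    obtain ⟨N, hN⟩ := hbL n
    exact (measure_mono hN).trans_lt (lam.2.1.measure_colBox_lt_top N)
  have hcompact : ∀ (E : Set (Pos d)), IsCompact E → ∀ i : Fin m,
      Measurable fun lam : uniformlyDiscrete d m r => lam.1 (E ×ˢ {i}) := by
    intro E hE i
    obtain ⟨f, hf⟩ := exists_tendsto_colourMap (r := r) hr hE i
    have h1 : Measurable fun lam : uniformlyDiscrete d m r => lam.1.real (E ×ˢ {i}) :=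
      measurable_of_tendsto_metrizable (fun k => (measurable_pi_apply (f k, i)).comp hcm)
        (tendsto_pi_nhds.2 fun lam => hf lam.1 lam.2)
    obtain ⟨L, hL⟩ := exists_subset_box hE.isBounded
    have h2 : (fun lam : uniformlyDiscrete d m r => lam.1 (E ×ˢ {i})) =
        fun lam => ENNReal.ofReal (lam.1.real (E ×ˢ {i})) := by
      ext lam
      have : lam.1 (E ×ˢ {i}) < ⊤ := (measure_mono (fun p hp => hL hp.1 :
        E ×ˢ {i} ⊆ colBox d m L)).trans_lt (lam.2.1.measure_colBox_lt_top L)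
      rw [measureReal_def, ENNReal.ofReal_toReal this.ne]
    rw [h2]
    exact h1.ennreal_ofReal
  -- Restriction to a ball makes the measures finite, so a generating `π`-system suffices. For
  -- products of a closed set with a set of colours, the intersection with the ball is compact in
  -- each colour.
  have hres : ∀ n, Measurable fun lam : uniformlyDiscrete d m r => lam.1.restrict (b n) := by
    intro n
    have : ∀ lam : uniformlyDiscrete d m r, IsFiniteMeasure (lam.1.restrict (b n)) := fun lam =>
      ⟨by rw [Measure.restrict_apply_univ]; exact hfin lam n⟩
    have hbasic : ∀ (F : Set (Pos d)), IsClosed F → ∀ T : Set (Fin m),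
        Measurable fun lam : uniformlyDiscrete d m r => lam.1.restrict (b n) (F ×ˢ T) := by
      intro F hF T
      have hE : IsCompact (F ∩ Metric.closedBall (0 : Pos d) n) :=
        (isCompact_closedBall 0 (n : ℝ)).inter_left hF
      have h3 : ∀ lam : uniformlyDiscrete d m r, lam.1.restrict (b n) (F ×ˢ T) =
          ∑ i ∈ T.toFinite.toFinset, lam.1 ((F ∩ Metric.closedBall 0 n) ×ˢ {i}) := by
        intro lam
        rw [Measure.restrict_apply (hF.measurableSet.prod T.toFinite.measurableSet), hb,
          Set.prod_inter_prod, Set.inter_univ, ← measure_biUnion_finset]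
        · congr 1
          ext p
          simp
        · intro i _ j _ hij
          rw [Function.onFun, Set.disjoint_left]
          rintro p ⟨-, h⟩ ⟨-, h'⟩
          exact hij (h.symm.trans h')
        · exact fun i _ => hE.measurableSet.prod (measurableSet_singleton i)
      simp only [h3]
      exact Finset.measurable_sum _ fun i _ => hcompact _ hE i
    refine Measurable.measure_of_isPiSystem
      (S := Set.image2 (· ×ˢ ·) {F : Set (Pos d) | IsClosed F} {T : Set (Fin m) | MeasurableSet T})
      (generateFrom_eq_prod ?_ MeasurableSpace.generateFrom_measurableSet ?_
        isCountablySpanning_measurableSet).symm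
      (isPiSystem_isClosed.prod MeasurableSpace.isPiSystem_measurableSet) ?_ ?_
    · rw [BorelSpace.measurable_eq (α := Pos d), borel_eq_generateFrom_isClosed]
    · exact ⟨fun _ => Set.univ, fun _ => isClosed_univ, Set.iUnion_const _⟩
    · rintro _ ⟨F, hF, T, hT, rfl⟩
      exact hbasic F hF T
    · simpa only [Set.univ_prod_univ] using hbasic Set.univ isClosed_univ Set.univ
  refine Measure.measurable_of_measurable_coe _ fun A hA => ?_
  have hmono : Monotone fun n => A ∩ b n := by
    intro n k hnk p hp
    exact ⟨hp.1, Metric.closedBall_subset_closedBall (by exact_mod_cast hnk) hp.2.1, trivial⟩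
  have hU : A = ⋃ n, A ∩ b n := by
    rw [← Set.inter_iUnion, Set.inter_eq_left.2]
    intro p _
    obtain ⟨n, hn⟩ := exists_nat_ge ‖p.1‖
    exact Set.mem_iUnion.2 ⟨n, by simpa using hn, trivial⟩
  have h4 : (fun lam : uniformlyDiscrete d m r => lam.1 A) =
      fun lam => ⨆ n, lam.1.restrict (b n) A := by
    ext lam
    simp only [Measure.restrict_apply hA]
    rw [← hmono.measure_iUnion, ← hU]
  rw [h4]
  exact Measurable.iSup fun n => (Measure.measurable_coe hA).comp (hres n)

/-- A process is determined by its correlations. -/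
theorem eq_of_corrFunctional_eq (hμ : IsProcess μ) (hν : IsProcess ν) (hw : Function.Injective w)
    (hw0 : ∀ i, w i ≠ 0)
    (hγ : ∀ n, 1 ≤ n → corrFunctional hμ hw0 n = corrFunctional hν hw0 n) : μ = ν := by
  obtain ⟨r₁, hr₁, hU₁⟩ := hμ.unifDiscrete
  obtain ⟨r₂, hr₂, hU₂⟩ := hν.unifDiscrete
  -- Both processes are concentrated on the `r`-uniformly discrete measures for the smaller radius,
  -- so one map `colourMap d m r` serves both.
  set r := min r₁ r₂ with hrdef
  have hr : 0 < r := lt_min hr₁ hr₂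
  have hUμ : ∀ᵐ lam ∂μ, lam ∈ uniformlyDiscrete d m r :=
    hU₁.mono fun lam hl => uniformlyDiscrete_anti (min_le_left _ _) hl
  have hUν : ∀ᵐ lam ∂ν, lam ∈ uniformlyDiscrete d m r :=
    hU₂.mono fun lam hl => uniformlyDiscrete_anti (min_le_right _ _) hl
  have hmap := map_colourMap_eq hμ hν hw hw0 hr hUμ hUν hγ
  have hΦ : Measurable (colourMap d m r) := measurable_colourMap hr hw hw0
  ext D hD
  obtain ⟨D', hD', hDD'⟩ := measurable_subtype_val_comap (d := d) (m := m) hr hD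
  have hiff : ∀ lam ∈ uniformlyDiscrete d m r, (lam ∈ colourMap d m r ⁻¹' D' ↔ lam ∈ D) := by
    intro lam hl
    have := Set.ext_iff.1 hDD' ⟨lam, hl⟩
    exact this
  have h1 : ∀ P : Measure (Measure (ColPt d m)), (∀ᵐ lam ∂P, lam ∈ uniformlyDiscrete d m r) →
      P D = P.map (colourMap d m r) D' := by
    intro P hP
    rw [Measure.map_apply hΦ hD']
    exact measure_congr (hP.mono fun lam hl => propext (hiff lam hl).symm)
  rw [h1 μ hUμ, h1 ν hUν, hmap]

end Uniqueness

end ColouredPointProcess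

/-- The weighted correlations of `μ`-almost every `lam` exist and do not depend on `lam`; and `μ` is
the only process for which they occur as the correlations of a non-null set of configurations. -/
theorem theorem7p3 {d m : ℕ} (w : Fin m → ℝ) (hw : Function.Injective w) (hw0 : ∀ i, w i ≠ 0)
    (μ : Measure (Measure (ColPt d m))) (hμ : IsProcess μ) :
    ∃ γ : (n : ℕ) → C_c(Fin n → Pos d, ℂ) →ₗ[ℂ] ℂ,
      (∀ᵐ lam ∂μ, ∀ n : ℕ, 1 ≤ n → IsCorrelation w lam n (γ n)) ∧
      ∀ ν : Measure (Measure (ColPt d m)), IsProcess ν →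
        (∃ᵐ lam ∂ν, ∀ n : ℕ, 1 ≤ n → IsCorrelation w lam n (γ n)) → ν = μ := by
  refine ⟨corrFunctional hμ hw0, ?_, fun ν hν hfreq => ?_⟩
  · exact ae_all_iff.2 fun n => (hμ.ae_isCorrelation hw0 n).mono fun _ h _ => h
  · have hae : ∀ᵐ lam ∂ν, ∀ n, IsCorrelation w lam n (corrFunctional hν hw0 n) :=
      ae_all_iff.2 fun n => hν.ae_isCorrelation hw0 n
    -- A non-null set meets a set of full `ν`-measure, which gives one configuration whose
    -- correlations are those of both processes; limits are unique.
    obtain ⟨lam, h1, h2⟩ := (hfreq.and_eventually hae).exists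
    refine (eq_of_corrFunctional_eq hμ hν hw hw0 fun n hn => ?_).symm
    exact LinearMap.ext fun f => tendsto_nhds_unique ((h1 n hn).tendsto f) ((h2 n).tendsto f)
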